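/- Let $\gamma:[0,1]\to\mathbb{T}^2=\mathbb{R}^2/\mathbb{Z}^2$ be a curve parametrized by arc length ($\|\gamma'(t)\|=1$) with nowhere vanishing curvature ($\gamma''(t)\neq 0$ for all $t\in[0,1]$), and suppose that (a lift to $\mathbb{R}^2$ of) $\gamma$ extends holomorphically to a $\mathbb{C}^2$-valued function, still denoted $\gamma$, on an open neighbourhood $U\subset\mathbb{C}$ of $[0,1]$. For a positive integer $m$ that is a sum of two squares put $\lambda=2\pi\sqrt{m}$, $\mathcal{E}_\lambda=\{\mu\in\mathbb{Z}^2:\mu_1^2+\mu_2^2=m\}$ and $N=\#\mathcal{E}_\lambda$. Then there is a constant $C>0$, depending only on the curve $\gamma$ (with its extension to $U$), such that for almost all $\lambda$ there are at most $N^2$ intervals $S_\alpha\subset[0,1]$, each of length at most $CN^{-3}$, with the following properties for every function $\Phi(x)=\sum_{\mu\in\mathcal{E}_\lambda}a_\mu e^{2\pi i\langle\mu,x\rangle}$ with $a_\mu\in\mathbb{C}$ and $\sum_\mu|a_\mu|^2=1$: 1. $\#\big(\{x\in\mathbb{T}^2:\Phi(x)=0\}\cap\bigcup_\alpha\gamma(S_\alpha)\big)\le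 C\lambda/N$; 2. for every $s\in[0,1]\setminus\bigcup_\alpha S_\alpha$, the disc $B(s,N^7/\lambda)\subset\mathbb{C}$ is contained in $U$ and $\#\{z\in B(s,N^7/\lambda):\Phi(\gamma(z))=0\}\le CN^7$. The intervals do not depend on $\Phi$. "For almost all $\lambda$" means: among the positive integers $m\le x$ that are sums of two squares, the proportion of those for which the assertion fails tends to $0$ as $x\to\infty$. -/

import Mathlib

open Set Filter Topology

noncomputable section

/-- The frequency set `𝓔` of the eigenvalue `λ² = 4π²m` of the flat torus `ℝ²/ℤ²`: all lattice
points `μ ∈ ℤ²` with `μ₁² + μ₂² = m`. -/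
def latticeCircle (m : ℕ) : Finset (Fin 2 → ℤ) :=
  (Fintype.piFinset fun _ : Fin 2 => Finset.Icc (-(m : ℤ)) (m : ℤ)).filter
    fun μ => μ 0 ^ 2 + μ 1 ^ 2 = (m : ℤ)

theorem mem_latticeCircle {m : ℕ} {μ : Fin 2 → ℤ} :
    μ ∈ latticeCircle m ↔ μ 0 ^ 2 + μ 1 ^ 2 = (m : ℤ) := by
  unfold latticeCircle
  simp only [Finset.mem_filter, Fintype.mem_piFinset, Finset.mem_Icc, and_iff_right_iff_imp,
    Fin.forall_fin_two]
  intro h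
  refine ⟨⟨?_, ?_⟩, ⟨?_, ?_⟩⟩ <;>
    nlinarith [sq_nonneg (μ 0), sq_nonneg (μ 1), Int.le_self_sq (μ 0), Int.le_self_sq (μ 1),
      Int.le_self_sq (-μ 0), Int.le_self_sq (-μ 1)]

/-- `N`, the number of frequencies, i.e. the dimension of the eigenspace. -/
def latticeCount (m : ℕ) : ℕ := (latticeCircle m).card

/-- The frequency `λ = 2π√m`, for which `λ² = 4π²m`. -/
def torusFrequency (m : ℕ) : ℝ := 2 * Real.pi * Real.sqrt m

/-- The positive integers up to `x` that are sums of two squares, i.e. those `m ≤ x` for which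
`4π²m` is an eigenvalue of the flat torus. -/
def sumsOfTwoSquaresUpTo (x : ℕ) : Set ℕ :=
  {m : ℕ | 1 ≤ m ∧ m ≤ x ∧ ∃ p q : ℕ, m = p ^ 2 + q ^ 2}

/-- `P` holds for almost all eigenvalues `λ² = 4π²m`: among the sums of two squares `m ≤ x`, the
proportion of those for which `P` fails tends to `0` as `x → ∞`. -/
def ForAlmostAllEigenvalues (P : ℕ → Prop) : Prop :=
  Tendsto (fun x : ℕ => (({m ∈ sumsOfTwoSquaresUpTo x | ¬ P m}.ncard : ℕ) : ℝ) /
    ((sumsOfTwoSquaresUpTo x).ncard : ℝ)) atTop (𝓝 0)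

/-- The toral eigenfunction `Φ(x) = ∑_{μ ∈ 𝓔} a_μ exp (2πi⟨μ, x⟩)` on `ℝ²/ℤ²`. -/
def toralEigenfunction (m : ℕ) (a : (Fin 2 → ℤ) → ℂ) (x : UnitAddTorus (Fin 2)) : ℂ :=
  ∑ μ ∈ latticeCircle m, a μ * UnitAddTorus.mFourier μ x

/-- The same trigonometric polynomial as an entire function of `w ∈ ℂ²`. -/
def complexifiedEigenfunction (m : ℕ) (a : (Fin 2 → ℤ) → ℂ) (w : Fin 2 → ℂ) : ℂ :=
  ∑ μ ∈ latticeCircle m,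
    a μ * Complex.exp (2 * Real.pi * Complex.I * ∑ j, (μ j : ℂ) * w j)

/-- The point of the torus `ℝ²/ℤ²` represented by a vector of `ℝ²`. -/
def toTorus (v : EuclideanSpace ℝ (Fin 2)) : UnitAddTorus (Fin 2) :=
  fun j => ((v j : ℝ) : UnitAddCircle)

/-- `γ`, restricted to `[0,1]`, is (a lift to `ℝ²` of) an arc-length parametrized toral curve with
nowhere vanishing curvature, and `Γ` is an analytic continuation of it to the open
neighbourhood `U` of `[0,1]` in `ℂ`. -/
structure IsAnalyticCurvedArc (γ : ℝ → EuclideanSpace ℝ (Fin 2)) (U : Set ℂ)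
    (Γ : ℂ → Fin 2 → ℂ) : Prop where
  isOpen : IsOpen U
  subset : ∀ t ∈ Icc (0 : ℝ) 1, (t : ℂ) ∈ U
  holomorphic : DifferentiableOn ℂ Γ U
  extends_curve : ∀ t ∈ Icc (0 : ℝ) 1, ∀ j, Γ (t : ℂ) j = ((γ t j : ℝ) : ℂ)
  unit_speed : ∀ t ∈ Icc (0 : ℝ) 1, ‖derivWithin γ (Icc 0 1) t‖ = 1
  curvature_ne_zero : ∀ t ∈ Icc (0 : ℝ) 1,
    iteratedDerivWithin 2 γ (Icc 0 1) t ≠ 0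

end

/-! Near a parameter `s` the curve is its tangent line up to `O(|w|²)`, so there `Φ ∘ Γ` is close to
an exponential sum in `w` with the `N` real frequencies `2π⟨μ, γ'(s)⟩`
(`norm_eigenfunction_sub_tangentSum_le`). For real `w` the error is of order `Nλ|w|²`. Since `N` is
at most a power of `log m`, this is tiny at scales `N^A/λ`. By a Jensen-type inequality
(`zeros_finite_and_ncard_le`) it then suffices to bound the exponential sum from below at one point
near `s`.

Such a bound has two sources. If the frequencies are separated by `δλ`, the mean square gives a
value at least `1/2` within distance about `N/(δλ)` (`exists_half_le_norm_expSum`). Turán's lemma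
(`norm_expSum_le`) carries a lower bound to an interval `q` times shorter at the cost of a factor
`(8q)^N`.

Separation needs `|μ - ν|` to be large and `γ'(s)` not to be nearly orthogonal to `μ - ν`. Curvature
confines near orthogonality to a given direction to boundedly many short intervals. The number of
directions is at most `N^(5/3)`, because the direction of `μ - ν` is determined up to sign by the
product `μν` of Gaussian integers, and such products are few
(`card_gaussianCircle_mul_self_pow_three_le`). The gap between `N^(5/3)` and `N²` absorbs the
constant.

Outside these intervals the second property follows from `zeros_in_good_disc_le`. Inside them, a
parameter that is good for the weaker threshold `cN⁻⁵` lies close by, so each disc of radius about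
`N⁻³` has `O(λ/N³)` zeros (`zeros_in_short_disc_le`); `N²` such discs give `O(λ/N)`.

For almost all `m` one has `N ≤ (log m)²` and `|μ - ν| ≥ √m/(log m)^(9/4)` for distinct points. Both
come from counting close pairs of lattice points on circles through `ab = cd`, and the second moment
of `N` also yields a sufficient lower bound for the number of sums of two squares. -/

/-! ### Zeros of holomorphic functions in a disc. -/

theorem exists_eq_prod_sub_mul_of_zeros {V : Set ℂ} (hV : IsOpen V) {f : ℂ → ℂ}
    (hf : DifferentiableOn ℂ f V) (S : Finset ℂ) (hS : ∀ a ∈ S, a ∈ V ∧ f a = 0) :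
    ∃ g : ℂ → ℂ, DifferentiableOn ℂ g V ∧ ∀ z, f z = (∏ a ∈ S, (z - a)) * g z := by
  classical
  induction S using Finset.induction_on with
  | empty => exact ⟨f, hf, by simp⟩
  | insert b S hb ih =>
    obtain ⟨g, hg, hfg⟩ := ih fun a ha => hS a (Finset.mem_insert_of_mem ha)
    have hbV := hS b (Finset.mem_insert_self b S)
    have hgb : g b = 0 := by
      have h := hfg b
      rw [hbV.2] at h
      rcases mul_eq_zero.1 h.symm with h | h
      · obtain ⟨a, ha, hab⟩ := Finset.prod_eq_zero_iff.1 h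
        rw [sub_eq_zero] at hab
        exact absurd (hab ▸ ha) hb
      · exact h
    refine ⟨dslope g b, (Complex.differentiableOn_dslope (hV.mem_nhds hbV.1)).2 hg, fun z => ?_⟩
    have := sub_smul_dslope g b z
    rw [hgb, sub_zero, smul_eq_mul] at this
    rw [Finset.prod_insert hb, hfg z, ← this]
    ring

/-- A Jensen-type bound for the number of zeros of a holomorphic function in a disc. -/
theorem three_pow_card_zeros_mul_le {V : Set ℂ} (hV : IsOpen V) {f : ℂ → ℂ}
    (hf : DifferentiableOn ℂ f V) {c : ℂ} {r : ℝ} (hr : 0 < r)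
    (hsub : Metric.closedBall c (4 * r) ⊆ V) {A : ℝ}
    (hA : ∀ z ∈ Metric.closedBall c (4 * r), ‖f z‖ ≤ A) (S : Finset ℂ)
    (hS : ∀ a ∈ S, a ∈ Metric.closedBall c r ∧ f a = 0) :
    (3 : ℝ) ^ S.card * ‖f c‖ ≤ A := by
  have hS' : ∀ a ∈ S, a ∈ V ∧ f a = 0 := fun a ha =>
    ⟨hsub (Metric.closedBall_subset_closedBall (by linarith) (hS a ha).1), (hS a ha).2⟩
  obtain ⟨g, hg, hfg⟩ := exists_eq_prod_sub_mul_of_zeros hV hf S hS'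
  have hA0 : 0 ≤ A := (norm_nonneg _).trans (hA c (Metric.mem_closedBall_self (by linarith)))
  have h4r : (4 * r) ≠ 0 := by linarith
  -- On the sphere of radius `4r` every factor `|z - a|` is at least `3r`, and at the centre it is
  -- at most `r`; each zero thus gains a factor 3.
  have hmax : ‖g c‖ ≤ A / (3 * r) ^ S.card := by
    refine Complex.norm_le_of_forall_mem_frontier_norm_le (U := Metric.ball c (4 * r))
      Metric.isBounded_ball (DifferentiableOn.diffContOnCl (hg.mono ?_))
      (fun z hz => ?_) (subset_closure (Metric.mem_ball_self (by linarith)))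
    · rw [closure_ball _ h4r]; exact hsub
    · rw [frontier_ball _ h4r] at hz
      have hzA := hA z (Metric.sphere_subset_closedBall hz)
      rw [hfg z, norm_mul, norm_prod] at hzA
      have hp : (3 * r) ^ S.card ≤ ∏ a ∈ S, ‖z - a‖ := by
        rw [← Finset.prod_const]
        refine Finset.prod_le_prod (fun _ _ => by linarith) fun a ha => ?_
        have h1 := (hS a ha).1
        rw [Metric.mem_closedBall] at h1
        rw [Metric.mem_sphere] at hz
        have := dist_triangle z a c
        rw [← dist_eq_norm]
        linarith
      rw [le_div_iff₀ (by positivity), mul_comm]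
      exact (mul_le_mul_of_nonneg_right hp (norm_nonneg _)).trans hzA
  have hfc : ‖f c‖ ≤ r ^ S.card * ‖g c‖ := by
    rw [hfg c, norm_mul, norm_prod]
    gcongr
    rw [← Finset.prod_const]
    refine Finset.prod_le_prod (fun _ _ => norm_nonneg _) fun a ha => ?_
    rw [← dist_eq_norm, dist_comm]
    exact (hS a ha).1
  calc (3 : ℝ) ^ S.card * ‖f c‖ ≤ 3 ^ S.card * (r ^ S.card * (A / (3 * r) ^ S.card)) := by
        gcongr
        exact hfc.trans (by gcongr)
    _ = A := by rw [mul_pow]; field_simp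

/-- `ncard` is `0` on infinite sets, so a bound on it says something only together with finiteness;
finite subsets control both. -/
theorem Set.finite_and_ncard_le_of_forall_finset {α : Type*} {Z : Set α} {B : ℝ}
    (h : ∀ S : Finset α, (S : Set α) ⊆ Z → (S.card : ℝ) ≤ B) :
    Z.Finite ∧ (Z.ncard : ℝ) ≤ B := by
  have hfin : Z.Finite := by
    by_contra hinf
    obtain ⟨n, hn⟩ := exists_nat_gt B
    obtain ⟨S, hS, hc⟩ := Set.Infinite.exists_subset_card_eq hinf n
    have := h S hS
    rw [hc] at this
    linarith
  refine ⟨hfin, ?_⟩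
  rw [Set.ncard_eq_toFinset_card _ hfin]
  exact h _ (by simp)

/-- If `f` is bounded by `A` on a disc of radius `4r` and its value at the centre is at least
`A exp(-T)`, then `f` has at most `T` zeros in the disc of radius `r`. -/
theorem zeros_finite_and_ncard_le {V : Set ℂ} (hV : IsOpen V) {f : ℂ → ℂ}
    (hf : DifferentiableOn ℂ f V) {c : ℂ} {r : ℝ} (hr : 0 < r)
    (hsub : Metric.closedBall c (4 * r) ⊆ V) {A T : ℝ}
    (hA : ∀ z ∈ Metric.closedBall c (4 * r), ‖f z‖ ≤ A) (hc : 0 < ‖f c‖)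
    (hT : A ≤ Real.exp T * ‖f c‖) {Z : Set ℂ}
    (hZ : ∀ a ∈ Z, a ∈ Metric.closedBall c r ∧ f a = 0) :
    Z.Finite ∧ (Z.ncard : ℝ) ≤ T := by
  refine Set.finite_and_ncard_le_of_forall_finset fun S hS => ?_
  have h := three_pow_card_zeros_mul_le hV hf hr hsub hA S fun a ha => hZ a (hS ha)
  have h1 : (3 : ℝ) ^ S.card ≤ Real.exp T := le_of_mul_le_mul_right (h.trans hT) hc
  -- Since `3 > e`, the logarithm bounds the number of zeros with constant 1.
  have h2 : Real.exp S.card ≤ 3 ^ S.card := by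
    rw [← mul_one (S.card : ℝ), Real.exp_nat_mul]
    gcongr
    linarith [Real.exp_one_lt_d9]
  exact Real.exp_le_exp.1 (h2.trans h1)

/-! ### Exponential sums: Turán's lemma and the mean square. -/

/-- Turán's bound for power sums. -/
theorem norm_sum_mul_pow_le {ι : Type*} (s : Finset ι) (z b : ι → ℂ) (hz : ∀ i ∈ s, ‖z i‖ ≤ 1)
    {q : ℝ} (hq : 1 ≤ q) {B : ℝ} (hB0 : 0 ≤ B)
    (hB : ∀ k < s.card, ‖∑ i ∈ s, b i * z i ^ k‖ ≤ B) (K : ℕ) :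
    ‖∑ i ∈ s, b i * z i ^ K‖ ≤ B * (q ^ s.card * (1 + 2 / q) ^ K) := by
  classical
  have hq0 : 0 < q := by linarith
  induction s using Finset.induction_on generalizing b B K with
  | empty => simp only [Finset.sum_empty, norm_zero]; positivity
  | insert j s hj ih =>
    have hcard : (insert j s).card = s.card + 1 := Finset.card_insert_of_notMem hj
    rw [hcard] at hB ⊢
    -- Passing from `S_k` to `S_{k+1} - z_j S_k` removes the node `z_j` and at most doubles the
    -- bound. The recurrence `S_{k+1} = z_j S_k + T_k` is then summed as a geometric series of ratio
    -- `1 + 2/q`.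
    have hT : ∀ k, ∑ i ∈ s, b i * (z i - z j) * z i ^ k =
        (∑ i ∈ insert j s, b i * z i ^ (k + 1)) - z j * ∑ i ∈ insert j s, b i * z i ^ k := by
      intro k
      rw [Finset.sum_insert hj, Finset.sum_insert hj, mul_add, Finset.mul_sum]
      rw [show ∀ x y u v : ℂ, x + y - (u + v) = (x - u) + (y - v) by intros; ring,
        ← Finset.sum_sub_distrib, show b j * z j ^ (k + 1) - z j * (b j * z j ^ k) = 0 by ring,
        zero_add]
      exact Finset.sum_congr rfl fun i _ => by ring
    have hzj : ‖z j‖ ≤ 1 := hz j (Finset.mem_insert_self j s)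
    have ih' : ∀ k, ‖∑ i ∈ s, b i * (z i - z j) * z i ^ k‖ ≤
        2 * B * (q ^ s.card * (1 + 2 / q) ^ k) := by
      intro k
      refine ih (fun i => b i * (z i - z j)) (fun i hi => hz i (Finset.mem_insert_of_mem hi))
        (B := 2 * B) (by linarith) (fun k hk => ?_) k
      rw [hT k]
      refine (norm_sub_le _ _).trans ?_
      rw [norm_mul]
      have h1 := hB (k + 1) (by omega)
      have h2 := hB k (by omega)
      nlinarith [norm_nonneg (∑ i ∈ insert j s, b i * z i ^ k)]
    have hmain : ∀ K, ‖∑ i ∈ insert j s, b i * z i ^ K‖ ≤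
        B + B * q ^ (s.card + 1) * ((1 + 2 / q) ^ K - 1) := by
      intro K
      induction K with
      | zero => simpa using hB 0 (by omega)
      | succ K ihK =>
        have h1 : ∑ i ∈ insert j s, b i * z i ^ (K + 1) =
            z j * (∑ i ∈ insert j s, b i * z i ^ K) + ∑ i ∈ s, b i * (z i - z j) * z i ^ K := by
          rw [hT K]; ring
        rw [h1]
        refine (norm_add_le _ _).trans ?_
        rw [norm_mul]
        have h2 : ‖z j‖ * ‖∑ i ∈ insert j s, b i * z i ^ K‖ ≤
            ‖∑ i ∈ insert j s, b i * z i ^ K‖ := mul_le_of_le_one_left (norm_nonneg _) hzj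
        have h3 : B + B * q ^ (s.card + 1) * ((1 + 2 / q) ^ (K + 1) - 1) =
          B + B * q ^ (s.card + 1) * ((1 + 2 / q) ^ K - 1) +
            2 * B * (q ^ s.card * (1 + 2 / q) ^ K) := by
          rw [pow_succ (1 + 2 / q), pow_succ q]
          field_simp
          ring
        rw [h3]
        linarith [ih' K]
    refine (hmain K).trans ?_
    have : (1 : ℝ) ≤ q ^ (s.card + 1) := one_le_pow₀ hq
    nlinarith

/-- Reaching a segment `q` times longer takes the exponent `K = qn`, and `(1 + 2/q)^q ≤ e² < 8`. -/
theorem turan_pow_le {q n : ℕ} (hq : 1 ≤ q) :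
    (q : ℝ) ^ n * (1 + 2 / q) ^ (q * n) ≤ (8 * q : ℝ) ^ n := by
  have hq0 : (0 : ℝ) < q := by exact_mod_cast hq
  have h1 : (1 + 2 / q : ℝ) ^ q ≤ 8 := by
    calc (1 + 2 / q : ℝ) ^ q ≤ (Real.exp (2 / q)) ^ q := by
          gcongr
          linarith [Real.add_one_le_exp (2 / q : ℝ)]
      _ = Real.exp 2 := by rw [← Real.exp_nat_mul]; congr 1; field_simp
      _ = Real.exp 1 * Real.exp 1 := by rw [← Real.exp_add]; norm_num
      _ ≤ 8 := by nlinarith [Real.exp_one_lt_d9, Real.exp_pos 1]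
  rw [pow_mul, ← mul_pow, mul_comm (8 : ℝ)]
  gcongr

/-- Turán's bound for exponential sums with real frequencies, along a complex segment. -/
theorem norm_expSum_le {ι : Type*} (s : Finset ι) (θ : ι → ℝ) (b : ι → ℂ) {Λ : ℝ}
    (hθ : ∀ i ∈ s, |θ i| ≤ Λ) {q : ℕ} (hq : 1 ≤ q) (w : ℂ) {B : ℝ} (hB0 : 0 ≤ B)
    (hs : 0 < s.card)
    (hB : ∀ t : ℝ, 0 ≤ t → t ≤ (q : ℝ)⁻¹ →
      ‖∑ i ∈ s, b i * Complex.exp (Complex.I * θ i * (t * w))‖ ≤ B) :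
    ‖∑ i ∈ s, b i * Complex.exp (Complex.I * θ i * w)‖ ≤
      B * (8 * q) ^ s.card * Real.exp (Λ * |w.im|) := by
  set n := s.card
  have hq0 : (0 : ℝ) < q := by exact_mod_cast hq
  have hn0 : (0 : ℝ) < n := by exact_mod_cast hs
  -- The segment from `0` to `w` is sampled at the multiples of `w/K`; the first `n` samples lie in
  -- its initial `1/q`-th. The damping factor `e` brings the nodes into the unit disc and is paid
  -- for by `exp(Λ|Im w|)` at the end.
  set K := q * n
  have hK0 : (0 : ℝ) < K := by simp only [K]; push_cast; positivity
  have hK0' : (K : ℂ) ≠ 0 := by exact_mod_cast hK0.ne'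
  set e : ℂ := Complex.exp (-(Λ * |w.im| / K : ℝ))
  set z : ι → ℂ := fun i => Complex.exp (Complex.I * θ i * w / K) * e
  have hΛ : ∀ i ∈ s, ‖z i‖ ≤ 1 := by
    intro i hi
    simp only [z, e]
    rw [← Complex.exp_add, Complex.norm_exp, Real.exp_le_one_iff]
    have : (Complex.I * θ i * w / K + -(Λ * |w.im| / K : ℝ)).re =
        -(θ i * w.im + Λ * |w.im|) / K := by
      rw [show Complex.I * θ i * w / K = ((θ i / K : ℝ) : ℂ) * (Complex.I * w) by
        push_cast; ring, ← Complex.ofReal_neg, Complex.add_re, Complex.re_ofReal_mul,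
        Complex.ofReal_re, Complex.I_mul_re]
      ring
    rw [this]
    have h2 : -(θ i * w.im) ≤ Λ * |w.im| := by
      refine (neg_le_abs _).trans ?_
      rw [abs_mul]
      exact mul_le_mul_of_nonneg_right (hθ i hi) (abs_nonneg _)
    exact div_nonpos_of_nonpos_of_nonneg (by linarith) hK0.le
  have hz : ∀ k : ℕ, ∑ i ∈ s, b i * z i ^ k =
      e ^ k * ∑ i ∈ s, b i * Complex.exp (Complex.I * θ i * ((k / K : ℝ) * w)) := by
    intro k
    rw [Finset.mul_sum]
    refine Finset.sum_congr rfl fun i _ => ?_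
    simp only [z]
    rw [mul_pow, ← Complex.exp_nat_mul]
    rw [show (k : ℂ) * (Complex.I * θ i * w / K) = Complex.I * θ i * ((k / K : ℝ) * w) by
      push_cast; ring]
    ring
  have hne : ‖e‖ = Real.exp (-(Λ * |w.im| / K)) := by
    simp only [e]; rw [← Complex.ofReal_neg, Complex.norm_exp, Complex.ofReal_re]
  have hT := norm_sum_mul_pow_le s z b hΛ (q := q) (by exact_mod_cast hq) hB0 (fun k hk => ?_) K
  · rw [hz K, norm_mul, norm_pow, hne, ← Real.exp_nat_mul, div_self hK0.ne',
      Complex.ofReal_one] at hT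
    simp only [one_mul] at hT
    rw [show (K : ℝ) * -(Λ * |w.im| / K) = -(Λ * |w.im|) by field_simp] at hT
    have hT2 := hT.trans (mul_le_mul_of_nonneg_left (turan_pow_le (n := n) hq) hB0)
    rw [Real.exp_neg, inv_mul_le_iff₀ (Real.exp_pos _)] at hT2
    linarith
  · rw [hz k, norm_mul, norm_pow]
    have he : ‖e‖ ^ k ≤ 1 := by
      refine pow_le_one₀ (norm_nonneg _) ?_
      rw [hne, Real.exp_le_one_iff, neg_nonpos]
      obtain ⟨i, hi⟩ := Finset.card_pos.1 hs
      have : 0 ≤ Λ := (abs_nonneg _).trans (hθ i hi)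
      positivity
    have hkK : (k / K : ℝ) ≤ (q : ℝ)⁻¹ := by
      rw [div_le_iff₀ hK0]
      simp only [K]
      push_cast
      rw [← mul_assoc, inv_mul_cancel₀ hq0.ne', one_mul]
      exact_mod_cast hk.le
    have := hB (k / K) (by positivity) hkK
    calc _ ≤ 1 * B := by gcongr
      _ = B := one_mul B

/-- Jordan's inequality bounds the denominator of the geometric sum below; the bound is uniform in
`K`. -/
theorem norm_geom_sum_exp_le {φ : ℝ} (hφ : |φ| ≤ Real.pi) (hφ0 : φ ≠ 0) (K : ℕ) :
    ‖∑ k ∈ Finset.range K, Complex.exp (Complex.I * φ) ^ k‖ ≤ Real.pi / |φ| := by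
  have hpi := Real.pi_pos
  have h1 : 2 / Real.pi * |φ| ≤ ‖Complex.exp (Complex.I * φ) - 1‖ := by
    rw [Complex.norm_exp_I_mul_ofReal_sub_one, norm_mul, Real.norm_eq_abs, Real.norm_eq_abs]
    have := Real.mul_abs_le_abs_sin (x := φ / 2) (by rw [abs_div, abs_two]; linarith)
    rw [abs_div] at this
    rw [abs_two] at this ⊢
    linarith
  have h0 : 0 < |φ| := abs_pos.2 hφ0
  have h2 : 0 < ‖Complex.exp (Complex.I * φ) - 1‖ := lt_of_lt_of_le (by positivity) h1
  have hne : Complex.exp (Complex.I * φ) ≠ 1 := by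
    intro h; rw [h, sub_self, norm_zero] at h2; exact lt_irrefl _ h2
  rw [geom_sum_eq hne, norm_div, div_le_div_iff₀ h2 h0]
  have h3 : ‖Complex.exp (Complex.I * φ) ^ K - 1‖ ≤ 2 := by
    refine (norm_sub_le _ _).trans ?_
    rw [norm_pow, mul_comm, Complex.norm_exp_ofReal_mul_I]
    norm_num
  calc _ ≤ 2 * |φ| := by gcongr
    _ = Real.pi * (2 / Real.pi * |φ|) := by field_simp
    _ ≤ _ := by gcongr

/-- An exponential sum with separated frequencies is not small on a long arithmetic progression. -/
theorem exists_half_le_norm_expSum {ι : Type*} (s : Finset ι) (θ : ι → ℝ) (b : ι → ℂ)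
    (hb : ∑ i ∈ s, ‖b i‖ ^ 2 = 1) {h δ : ℝ} (hh : 0 < h) (hδ : 0 < δ)
    (hsep : ∀ i ∈ s, ∀ j ∈ s, i ≠ j → δ ≤ |θ i - θ j|)
    (hpi : ∀ i ∈ s, ∀ j ∈ s, |θ i - θ j| * h ≤ Real.pi) {K : ℕ}
    (hK : 5 * s.card ≤ K * (h * δ)) :
    ∃ k < K, 1 / 2 ≤ ‖∑ i ∈ s, b i * Complex.exp (Complex.I * θ i * (k * h : ℝ))‖ := by
  classical
  by_contra! hcon
  set F : ℕ → ℂ := fun k => ∑ i ∈ s, b i * Complex.exp (Complex.I * θ i * (k * h : ℝ))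
  have hcard : 0 < s.card := by
    rw [Finset.card_pos, Finset.nonempty_iff_ne_empty]
    rintro rfl
    simp at hb
  have hN1 : (1 : ℝ) ≤ s.card := by exact_mod_cast hcard
  have hK0 : (0 : ℝ) < K := by
    rcases Nat.eq_zero_or_pos K with h0 | h0
    · rw [h0] at hK; norm_num at hK; linarith
    · exact_mod_cast h0
  have hexp : ∀ k, ((‖F k‖ ^ 2 : ℝ) : ℂ) = ∑ i ∈ s, ∑ j ∈ s,
      b i * (starRingEnd ℂ) (b j) * Complex.exp (Complex.I * ((θ i - θ j) * h : ℝ)) ^ k := by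
    intro k
    rw [Complex.ofReal_pow, ← Complex.mul_conj', map_sum, Finset.sum_mul_sum]
    refine Finset.sum_congr rfl fun i _ => Finset.sum_congr rfl fun j _ => ?_
    rw [map_mul, ← Complex.exp_conj, ← Complex.exp_nat_mul, mul_mul_mul_comm, ← Complex.exp_add]
    congr 2
    simp only [map_mul, Complex.conj_I, Complex.conj_ofReal]
    push_cast
    ring
  have hsum : ((∑ k ∈ Finset.range K, ‖F k‖ ^ 2 : ℝ) : ℂ) = ∑ i ∈ s, ∑ j ∈ s,
      b i * (starRingEnd ℂ) (b j) *
        ∑ k ∈ Finset.range K, Complex.exp (Complex.I * ((θ i - θ j) * h : ℝ)) ^ k := by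
    rw [Complex.ofReal_sum, Finset.sum_congr rfl fun k _ => hexp k, Finset.sum_comm]
    refine Finset.sum_congr rfl fun i _ => ?_
    rw [Finset.sum_comm]
    exact Finset.sum_congr rfl fun j _ => by rw [Finset.mul_sum]
  have hdiag : (K : ℂ) = ∑ i ∈ s, ∑ j ∈ s, if i = j then (K : ℂ) * (‖b i‖ ^ 2 : ℝ) else 0 := by
    simp_rw [Finset.sum_ite_eq]
    rw [Finset.sum_congr rfl fun i hi => if_pos hi, ← Finset.mul_sum, ← Complex.ofReal_sum, hb]
    simp
  -- The diagonal of the expanded square contributes exactly `K`; by separation each off-diagonal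
  -- geometric sum is at most `π/(hδ)`.
  have hdiff : ‖((∑ k ∈ Finset.range K, ‖F k‖ ^ 2 : ℝ) : ℂ) - K‖ ≤
      ∑ i ∈ s, ∑ j ∈ s, ‖b i‖ * ‖b j‖ * (Real.pi / (h * δ)) := by
    rw [hsum, hdiag, ← Finset.sum_sub_distrib]
    refine (norm_sum_le _ _).trans (Finset.sum_le_sum fun i hi => ?_)
    rw [← Finset.sum_sub_distrib]
    refine (norm_sum_le _ _).trans (Finset.sum_le_sum fun j hj => ?_)
    by_cases hij : i = j
    · subst hij
      rw [if_pos rfl]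
      simp only [sub_self, zero_mul, Complex.ofReal_zero, mul_zero, Complex.exp_zero, one_pow,
        Finset.sum_const, Finset.card_range, nsmul_eq_mul, mul_one, Complex.mul_conj']
      rw [Complex.ofReal_pow, mul_comm, sub_self, norm_zero]
      positivity
    · rw [if_neg hij, sub_zero, norm_mul, norm_mul, RCLike.norm_conj]
      have hd := hsep i hi j hj hij
      have habs : |(θ i - θ j) * h| = |θ i - θ j| * h := by rw [abs_mul, abs_of_pos hh]
      have h3 : 0 < |θ i - θ j| * h := mul_pos (hδ.trans_le hd) hh
      gcongr
      refine (norm_geom_sum_exp_le (by rw [habs]; exact hpi i hi j hj) ?_ K).trans ?_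
      · rw [← abs_pos, habs]; exact h3
      · rw [habs, mul_comm h]
        gcongr
  have hcs : (∑ i ∈ s, ‖b i‖) ^ 2 ≤ s.card := by
    have := sq_sum_le_card_mul_sum_sq (s := s) (f := fun i => ‖b i‖)
    rwa [hb, mul_one] at this
  have hdiff2 : ∑ i ∈ s, ∑ j ∈ s, ‖b i‖ * ‖b j‖ * (Real.pi / (h * δ)) ≤
      s.card * (Real.pi / (h * δ)) := by
    simp_rw [← Finset.sum_mul]
    rw [← Finset.sum_mul_sum, ← sq]
    have := Real.pi_pos
    gcongr
  have hle : ∑ k ∈ Finset.range K, ‖F k‖ ^ 2 ≤ K * (1 / 4) := by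
    calc _ ≤ ∑ k ∈ Finset.range K, (1 / 4 : ℝ) := by
          refine Finset.sum_le_sum fun k hk => ?_
          have := hcon k (Finset.mem_range.1 hk)
          have h0 := norm_nonneg (F k)
          change ‖F k‖ < 1 / 2 at this
          nlinarith
      _ = _ := by simp
  have h5 : (K : ℝ) - ∑ k ∈ Finset.range K, ‖F k‖ ^ 2 ≤ s.card * (Real.pi / (h * δ)) := by
    refine le_trans ?_ (hdiff.trans hdiff2)
    rw [← Complex.ofReal_natCast, ← Complex.ofReal_sub, Complex.norm_real, Real.norm_eq_abs]
    exact (le_abs_self _).trans (abs_sub_comm _ _).le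
  have h6 : (s.card : ℝ) * (Real.pi / (h * δ)) ≤ K * (Real.pi / 5) := by
    rw [mul_div_assoc', div_le_iff₀ (by positivity)]
    nlinarith [Real.pi_pos]
  -- The off-diagonal part is at most `Kπ/5`, whereas values all below `1/2` would force it to be at
  -- least `3K/4`.
  nlinarith [Real.pi_lt_d2]

/-! ### Geometry of the curve: Taylor expansion and curvature. -/

/-- The second derivative is bounded on a compact thickening of `S`, and two applications of the
mean value inequality make the remainder uniform in the base point. It serves both `Γ` and its
derivative. -/
theorem exists_taylor_bound {E : Type*} [NormedAddCommGroup E] [NormedSpace ℂ E] [CompleteSpace E]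
    {U : Set ℂ} (hU : IsOpen U) {S : Set ℂ} (hS : IsCompact S) (hSU : S ⊆ U) {g : ℂ → E}
    (hg : DifferentiableOn ℂ g U) :
    ∃ r K : ℝ, 0 < r ∧ 0 ≤ K ∧ (∀ s ∈ S, Metric.closedBall s r ⊆ U) ∧
      ∀ s ∈ S, ∀ w : ℂ, ‖w‖ ≤ r → ‖g (s + w) - g s - w • deriv g s‖ ≤ K * ‖w‖ ^ 2 := by
  obtain ⟨r, hr, hrU⟩ := hS.exists_cthickening_subset_open hU hSU
  have hball : ∀ s ∈ S, Metric.closedBall s r ⊆ Metric.cthickening r S := fun s hs =>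
    Metric.closedBall_subset_cthickening hs r
  have hg1 := hg.deriv hU
  have hg2 := hg1.deriv hU
  obtain ⟨K, hK⟩ := (hS.cthickening (r := r)).exists_bound_of_continuousOn
    (hg2.continuousOn.mono hrU)
  have hK' : ∀ z ∈ Metric.cthickening r S, ‖deriv (deriv g) z‖ ≤ max K 0 := fun z hz =>
    (hK z hz).trans (le_max_left _ _)
  refine ⟨r, max K 0, hr, le_max_right _ _, fun s hs => (hball s hs).trans hrU, ?_⟩
  intro s hs w hw
  have hsub : Metric.closedBall s ‖w‖ ⊆ Metric.cthickening r S :=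
    (Metric.closedBall_subset_closedBall hw).trans (hball s hs)
  have hnhds : ∀ z ∈ Metric.closedBall s ‖w‖, U ∈ 𝓝 z := fun z hz => hU.mem_nhds (hrU (hsub hz))
  have hs0 : s ∈ Metric.closedBall s ‖w‖ := Metric.mem_closedBall_self (norm_nonneg _)
  have h1 : ∀ z ∈ Metric.closedBall s ‖w‖, ‖deriv g z - deriv g s‖ ≤ max K 0 * ‖w‖ := by
    intro z hz
    refine ((convex_closedBall s ‖w‖).norm_image_sub_le_of_norm_deriv_le
      (fun x hx => hg1.differentiableAt (hnhds x hx)) (fun x hx => hK' x (hsub hx)) hs0 hz).trans ?_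
    gcongr
    rwa [← dist_eq_norm]
  have h2 := (convex_closedBall s ‖w‖).norm_image_sub_le_of_norm_deriv_le
    (f := fun z => g z - (z - s) • deriv g s) (C := max K 0 * ‖w‖) (x := s) (y := s + w)
    (fun x hx => ((hg.differentiableAt (hnhds x hx)).sub (by fun_prop)))
    (fun x hx => ?_) hs0 (by simp)
  · simp only [add_sub_cancel_left, sub_self, zero_smul, sub_zero] at h2
    calc _ = ‖g (s + w) - w • deriv g s - g s‖ := by congr 1; abel
      _ ≤ _ := h2
      _ = _ := by ring
  · have hd : HasDerivAt (fun z => g z - (z - s) • deriv g s) (deriv g x - (1 : ℂ) • deriv g s) x :=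
      (hg.differentiableAt (hnhds x hx)).hasDerivAt.sub
        (((hasDerivAt_id x).sub_const s).smul_const (deriv g s))
    rw [hd.deriv, one_smul]
    exact h1 x hx

/-- The imaginary part of `e` is the real part of `-ie`; it vanishes along the interval, hence so
does its derivative. -/
theorem hasDerivWithinAt_re_and_im_eq_zero {e : ℂ → ℂ} {e' : ℂ} {x : ℝ → ℝ}
    (h : ∀ t ∈ Icc (0 : ℝ) 1, e t = x t) {t : ℝ} (ht : t ∈ Icc (0 : ℝ) 1)
    (he : HasDerivAt e e' t) : HasDerivWithinAt x e'.re (Icc 0 1) t ∧ e' = e'.re := by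
  have huniq : UniqueDiffWithinAt ℝ (Icc (0 : ℝ) 1) t := uniqueDiffOn_Icc zero_lt_one t ht
  have h1 : HasDerivWithinAt x e'.re (Icc 0 1) t :=
    he.real_of_complex.hasDerivWithinAt.congr (fun y hy => by rw [h y hy, Complex.ofReal_re])
      (by rw [h t ht, Complex.ofReal_re])
  refine ⟨h1, ?_⟩
  have h2 : HasDerivWithinAt (fun _ : ℝ => (0 : ℝ)) (-Complex.I * e').re (Icc 0 1) t :=
    (he.const_mul (-Complex.I)).real_of_complex.hasDerivWithinAt.congr
      (fun y hy => by rw [h y hy]; simp) (by rw [h t ht]; simp)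
  have h3 := (huniq.eq_deriv _ h2 (hasDerivWithinAt_const t _ (0 : ℝ)))
  apply Complex.ext <;> simp at h3 ⊢
  exact h3

theorem hasDerivWithinAt_euclideanSpace {γ : ℝ → EuclideanSpace ℝ (Fin 2)} {v : Fin 2 → ℝ}
    {s : Set ℝ} {t : ℝ} (h : ∀ j, HasDerivWithinAt (fun y => γ y j) (v j) s t) :
    HasDerivWithinAt γ (WithLp.toLp 2 v) s t := by
  rw [hasDerivWithinAt_iff_hasFDerivWithinAt, hasFDerivWithinAt_euclidean]
  intro j
  refine (h j).hasFDerivWithinAt.congr_fderiv ?_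
  ext
  simp

/-- In the plane `a ⊥ v` forces `⟨u,a⟩² = |a|²(1 - ⟨u,v⟩²)`: a direction far from the tangent has a
large component along the acceleration. -/
theorem abs_inner_normal_ge {u0 u1 v0 v1 a0 a1 k : ℝ} (hu : u0 ^ 2 + u1 ^ 2 = 1)
    (hv : v0 ^ 2 + v1 ^ 2 = 1) (hva : v0 * a0 + v1 * a1 = 0) (hk : 0 ≤ k)
    (hak : k ^ 2 ≤ a0 ^ 2 + a1 ^ 2) (huv : |u0 * v0 + u1 * v1| ≤ 1 / 2) :
    k / 2 ≤ |u0 * a0 + u1 * a1| := by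
  have h1 : (u0 * v0 + u1 * v1) ^ 2 ≤ (1 / 2) ^ 2 := sq_le_sq' (by linarith [abs_le.1 huv])
    (abs_le.1 huv).2
  set α := -a0 * v1 + a1 * v0
  have ha0 : a0 = -α * v1 := by
    simp only [α]; linear_combination (-a0) * hv + v0 * hva
  have ha1 : a1 = α * v0 := by
    simp only [α]; linear_combination (-a1) * hv + v1 * hva
  have h2 : a0 ^ 2 + a1 ^ 2 = α ^ 2 := by
    rw [ha0, ha1]; linear_combination α ^ 2 * hv
  have h3 : (u0 * a0 + u1 * a1) ^ 2 = α ^ 2 * (1 - (u0 * v0 + u1 * v1) ^ 2) := by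
    rw [ha0, ha1]
    linear_combination α ^ 2 * (v0 ^ 2 + v1 ^ 2) * hu + α ^ 2 * hv
  rw [← abs_of_nonneg (by linarith : (0 : ℝ) ≤ k / 2)]
  apply sq_le_sq.1
  rw [h3]
  nlinarith [sq_nonneg α]

/-- The Taylor expansion of the curve, with real velocity `V`, and the transversality that the
curvature gives. -/
theorem IsAnalyticCurvedArc.exists_velocity {γ : ℝ → EuclideanSpace ℝ (Fin 2)} {U : Set ℂ}
    {Γ : ℂ → Fin 2 → ℂ} (hγ : IsAnalyticCurvedArc γ U Γ) :
    ∃ (r K τ κ : ℝ) (V : ℝ → Fin 2 → ℝ), 0 < r ∧ r ≤ 1 ∧ 1 ≤ K ∧ 0 < τ ∧ 0 < κ ∧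
      (∀ s ∈ Icc (0 : ℝ) 1, Metric.closedBall (s : ℂ) r ⊆ U) ∧
      (∀ s ∈ Icc (0 : ℝ) 1, ∀ w : ℂ, ‖w‖ ≤ r → ∀ j,
        ‖Γ (s + w) j - Γ s j - w * V s j‖ ≤ K * ‖w‖ ^ 2) ∧
      (∀ s ∈ Icc (0 : ℝ) 1, V s 0 ^ 2 + V s 1 ^ 2 = 1) ∧
      ∀ u0 u1 : ℝ, u0 ^ 2 + u1 ^ 2 = 1 → ∀ s ∈ Icc (0 : ℝ) 1, ∀ t ∈ Icc (0 : ℝ) 1, |t - s| ≤ τ →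
        |u0 * V s 0 + u1 * V s 1| ≤ 1 / 2 →
          κ * |t - s| ≤ |(u0 * V t 0 + u1 * V t 1) - (u0 * V s 0 + u1 * V s 1)| := by
  have hU := hγ.isOpen
  have hI : IsCompact ((fun t : ℝ => (t : ℂ)) '' Icc 0 1) :=
    isCompact_Icc.image Complex.continuous_ofReal
  have hIU : (fun t : ℝ => (t : ℂ)) '' Icc 0 1 ⊆ U := by
    rintro _ ⟨t, ht, rfl⟩; exact hγ.subset t ht
  have hg1 := hγ.holomorphic.deriv hU
  obtain ⟨r, K, hr, hK, hrU, hT⟩ := exists_taylor_bound hU hI hIU hγ.holomorphic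
  obtain ⟨r', K', hr', hK', -, hT'⟩ := exists_taylor_bound hU hI hIU hg1
  have hd1 : ∀ t ∈ Icc (0 : ℝ) 1, ∀ j, HasDerivAt (fun z => Γ z j) (deriv Γ t j) t := fun t ht =>
    hasDerivAt_pi.1 (hγ.holomorphic.differentiableAt (hU.mem_nhds (hγ.subset t ht))).hasDerivAt
  have hd2 : ∀ t ∈ Icc (0 : ℝ) 1, ∀ j,
      HasDerivAt (fun z => deriv Γ z j) (deriv (deriv Γ) t j) t := fun t ht =>
    hasDerivAt_pi.1 (hg1.differentiableAt (hU.mem_nhds (hγ.subset t ht))).hasDerivAt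
  set V : ℝ → Fin 2 → ℝ := fun t j => (deriv Γ t j).re
  set A : ℝ → Fin 2 → ℝ := fun t j => (deriv (deriv Γ) t j).re
  have hV1 := fun j t (ht : t ∈ Icc (0 : ℝ) 1) => hasDerivWithinAt_re_and_im_eq_zero
    (fun t ht => hγ.extends_curve t ht j) ht (hd1 t ht j)
  have hV2 := fun j t (ht : t ∈ Icc (0 : ℝ) 1) => hasDerivWithinAt_re_and_im_eq_zero
    (x := fun t => V t j) (fun t ht => (hV1 j t ht).2) ht (hd2 t ht j)
  have hγ1 : ∀ t ∈ Icc (0 : ℝ) 1, HasDerivWithinAt γ (WithLp.toLp 2 (V t)) (Icc 0 1) t :=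
    fun t ht => hasDerivWithinAt_euclideanSpace fun j => (hV1 j t ht).1
  have hγ2 : ∀ t ∈ Icc (0 : ℝ) 1,
      HasDerivWithinAt (fun t => WithLp.toLp 2 (V t)) (WithLp.toLp 2 (A t)) (Icc 0 1) t :=
    fun t ht => hasDerivWithinAt_euclideanSpace fun j => (hV2 j t ht).1
  have huniq := uniqueDiffOn_Icc (zero_lt_one' ℝ)
  have hunit : ∀ s ∈ Icc (0 : ℝ) 1, V s 0 ^ 2 + V s 1 ^ 2 = 1 := by
    intro s hs
    have h := hγ.unit_speed s hs
    rw [(hγ1 s hs).derivWithin (huniq s hs), EuclideanSpace.norm_eq, Real.sqrt_eq_one] at h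
    simpa [Fin.sum_univ_two] using h
  have horth : ∀ s ∈ Icc (0 : ℝ) 1, V s 0 * A s 0 + V s 1 * A s 1 = 0 := by
    intro s hs
    have h1 := ((hV2 0 s hs).1.pow 2).add ((hV2 1 s hs).1.pow 2)
    have h2 : HasDerivWithinAt (fun _ : ℝ => (1 : ℝ)) _ (Icc 0 1) s :=
      h1.congr (fun y hy => (hunit y hy).symm) (hunit s hs).symm
    have h3 := (huniq s hs).eq_deriv _ h2 (hasDerivWithinAt_const s _ (1 : ℝ))
    simp only [A]
    simp at h3
    linarith
  have hApos : ∀ s ∈ Icc (0 : ℝ) 1, 0 < A s 0 ^ 2 + A s 1 ^ 2 := by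
    intro s hs
    have h := hγ.curvature_ne_zero s hs
    rw [iteratedDerivWithin_succ, iteratedDerivWithin_one,
      derivWithin_congr (fun t ht => (hγ1 t ht).derivWithin (huniq t ht))
        ((hγ1 s hs).derivWithin (huniq s hs)), (hγ2 s hs).derivWithin (huniq s hs)] at h
    by_contra hcon
    apply h
    have h0 : A s 0 = 0 := by nlinarith [sq_nonneg (A s 0), sq_nonneg (A s 1)]
    have h1 : A s 1 = 0 := by nlinarith [sq_nonneg (A s 0), sq_nonneg (A s 1)]
    ext j
    fin_cases j
    · exact h0
    · exact h1
  have hAcont : ContinuousOn (fun s => A s 0 ^ 2 + A s 1 ^ 2) (Icc 0 1) := by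
    have hc : ∀ j, ContinuousOn (fun s => A s j) (Icc 0 1) := by
      intro j
      have h1 : ContinuousOn (fun s : ℝ => deriv (deriv Γ) s) (Icc 0 1) :=
        (hg1.deriv hU).continuousOn.comp Complex.continuous_ofReal.continuousOn hγ.subset
      exact Complex.continuous_re.comp_continuousOn ((continuous_apply j).comp_continuousOn h1)
    exact ((hc 0).pow 2).add ((hc 1).pow 2)
  obtain ⟨s₀, hs₀, hmin⟩ := isCompact_Icc.exists_isMinOn
    (nonempty_Icc.2 (zero_le_one' ℝ)) hAcont
  set k := Real.sqrt (A s₀ 0 ^ 2 + A s₀ 1 ^ 2)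
  have hk0 : 0 < k := Real.sqrt_pos.2 (hApos s₀ hs₀)
  have hk2 : ∀ s ∈ Icc (0 : ℝ) 1, k ^ 2 ≤ A s 0 ^ 2 + A s 1 ^ 2 := by
    intro s hs
    rw [Real.sq_sqrt (hApos s₀ hs₀).le]
    exact hmin hs
  -- Here `k` is the least curvature. The linear term of `⟨u, V⟩` has slope at least `k/2`, and
  -- within `τ` the quadratic error `2K'|t - s|²` costs at most half of it, which leaves `κ = k/4`.
  refine ⟨min r 1, max K 1, min r' (k / (8 * (K' + 1))), k / 4, V, by positivity,
    min_le_right _ _, le_max_right _ _, by positivity, by positivity, ?_, ?_, hunit, ?_⟩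
  · exact fun s hs => (Metric.closedBall_subset_closedBall (min_le_left _ _)).trans
      (hrU s ⟨s, hs, rfl⟩)
  · intro s hs w hw j
    have h := (norm_le_pi_norm _ j).trans (hT s ⟨s, hs, rfl⟩ w (hw.trans (min_le_left _ _)))
    simp only [Pi.sub_apply, Pi.smul_apply, smul_eq_mul] at h
    rw [(hV1 j s hs).2] at h
    exact h.trans (by gcongr; exact le_max_left _ _)
  · intro u0 u1 hu s hs t ht hts huv
    have hj : ∀ j, |V t j - V s j - (t - s) * A s j| ≤ K' * |t - s| ^ 2 := by
      intro j
      have hn : ‖(t : ℂ) - s‖ = |t - s| := by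
        rw [← Complex.ofReal_sub, Complex.norm_real, Real.norm_eq_abs]
      have h := (norm_le_pi_norm _ j).trans (hT' s ⟨s, hs, rfl⟩ (t - s)
        (by rw [hn]; exact hts.trans (min_le_left _ _)))
      simp only [Pi.sub_apply, Pi.smul_apply, smul_eq_mul, add_sub_cancel] at h
      rw [hn] at h
      refine le_trans ?_ h
      rw [← Real.norm_eq_abs, ← Complex.norm_real]
      simp only [V, A]
      push_cast
      rw [← (hV1 j s hs).2, ← (hV1 j t ht).2, ← (hV2 j s hs).2]
    have hmain := abs_inner_normal_ge hu (hunit s hs) (horth s hs) hk0.le (hk2 s hs) huv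
    have hu0 : |u0| ≤ 1 := abs_le_one_iff_mul_self_le_one.2 (by nlinarith)
    have hu1 : |u1| ≤ 1 := abs_le_one_iff_mul_self_le_one.2 (by nlinarith)
    have hτ : |t - s| * (8 * (K' + 1)) ≤ k :=
      (le_div_iff₀ (by positivity)).1 (hts.trans (min_le_right _ _))
    have e0 : |u0 * (V t 0 - V s 0 - (t - s) * A s 0)| ≤ K' * |t - s| ^ 2 := by
      rw [abs_mul]
      exact (mul_le_of_le_one_left (abs_nonneg _) hu0).trans (hj 0)
    have e1 : |u1 * (V t 1 - V s 1 - (t - s) * A s 1)| ≤ K' * |t - s| ^ 2 := by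
      rw [abs_mul]
      exact (mul_le_of_le_one_left (abs_nonneg _) hu1).trans (hj 1)
    have e2 : |t - s| * (k / 2) ≤ |(t - s) * (u0 * A s 0 + u1 * A s 1)| := by
      rw [abs_mul]; gcongr
    have e3 : (t - s) * (u0 * A s 0 + u1 * A s 1) =
        ((u0 * V t 0 + u1 * V t 1) - (u0 * V s 0 + u1 * V s 1)) -
        (u0 * (V t 0 - V s 0 - (t - s) * A s 0) + u1 * (V t 1 - V s 1 - (t - s) * A s 1)) := by
      ring
    rw [e3] at e2
    have e4 := e2.trans (abs_sub _ _)
    have e5 := abs_add_le (u0 * (V t 0 - V s 0 - (t - s) * A s 0))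
      (u1 * (V t 1 - V s 1 - (t - s) * A s 1))
    have e6 : 2 * (K' * |t - s| ^ 2) ≤ |t - s| * (k / 4) := by
      nlinarith [abs_nonneg (t - s)]
    linarith

/-! ### The eigenfunction near a point of the curve, compared with its tangential sum. -/

noncomputable section

/-- The frequency with which `exp (2πi⟨μ, ·⟩)` oscillates along a line of velocity `v`. -/
def directionalFrequency (v : Fin 2 → ℝ) (μ : Fin 2 → ℤ) : ℝ :=
  2 * Real.pi * (μ 0 * v 0 + μ 1 * v 1)

/-- The eigenfunction along the tangent line of velocity `v` at the point `p`. -/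
def tangentSum (m : ℕ) (a : (Fin 2 → ℤ) → ℂ) (p : Fin 2 → ℂ) (v : Fin 2 → ℝ) (w : ℂ) : ℂ :=
  ∑ μ ∈ latticeCircle m, (a μ * Complex.exp (2 * Real.pi * Complex.I * ∑ j, (μ j : ℂ) * p j)) *
    Complex.exp (Complex.I * directionalFrequency v μ * w)

/-- `Γ` has the first order Taylor expansion with unit velocity `v` at the point `s`, with error
`K|w|²` for `|w| ≤ r`. -/
structure HasUnitTaylor (Γ : ℂ → Fin 2 → ℂ) (r K : ℝ) (s : ℝ) (v : Fin 2 → ℝ) : Prop where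
  pos : 0 < r
  le_one : r ≤ 1
  one_le : 1 ≤ K
  im_eq_zero : ∀ j, (Γ s j).im = 0
  taylor : ∀ w : ℂ, ‖w‖ ≤ r → ∀ j, ‖Γ (s + w) j - Γ s j - w * v j‖ ≤ K * ‖w‖ ^ 2
  unit : v 0 ^ 2 + v 1 ^ 2 = 1

end

theorem abs_add_abs_le_of_mem {m : ℕ} {μ : Fin 2 → ℤ} (hμ : μ ∈ latticeCircle m) :
    |(μ 0 : ℝ)| + |(μ 1 : ℝ)| ≤ 2 * Real.sqrt m := by
  have h : (μ 0 : ℝ) ^ 2 + (μ 1 : ℝ) ^ 2 = m := by exact_mod_cast mem_latticeCircle.1 hμ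
  have h0 : |(μ 0 : ℝ)| ≤ Real.sqrt m := Real.abs_le_sqrt (by nlinarith [sq_nonneg (μ 1 : ℝ)])
  have h1 : |(μ 1 : ℝ)| ≤ Real.sqrt m := Real.abs_le_sqrt (by nlinarith [sq_nonneg (μ 0 : ℝ)])
  linarith

theorem abs_directionalFrequency_le {m : ℕ} {μ : Fin 2 → ℤ} (hμ : μ ∈ latticeCircle m)
    {v : Fin 2 → ℝ} (hv : v 0 ^ 2 + v 1 ^ 2 = 1) :
    |directionalFrequency v μ| ≤ torusFrequency m := by
  have h : (μ 0 : ℝ) ^ 2 + (μ 1 : ℝ) ^ 2 = m := by exact_mod_cast mem_latticeCircle.1 hμ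
  unfold directionalFrequency torusFrequency
  rw [abs_mul, abs_of_pos (by positivity : 0 < 2 * Real.pi)]
  gcongr
  apply Real.abs_le_sqrt
  nlinarith [sq_nonneg ((μ 0 : ℝ) * v 1 - μ 1 * v 0)]

theorem torusFrequency_nonneg (m : ℕ) : 0 ≤ torusFrequency m := by
  unfold torusFrequency; positivity

section

variable {m : ℕ} {a : (Fin 2 → ℤ) → ℂ} {Γ : ℂ → Fin 2 → ℂ} {r K : ℝ} {s : ℝ} {v : Fin 2 → ℝ}

theorem norm_phase_eq_one (hΓ : HasUnitTaylor Γ r K s v) (μ : Fin 2 → ℤ) :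
    ‖Complex.exp (2 * Real.pi * Complex.I * ∑ j, (μ j : ℂ) * Γ s j)‖ = 1 := by
  rw [Complex.norm_exp]
  have h : ∀ j, Γ s j = ((Γ s j).re : ℂ) := fun j => by
    apply Complex.ext <;> simp [hΓ.im_eq_zero j]
  rw [Fin.sum_univ_two, h 0, h 1]
  simp

theorem norm_coeff_le_one (ha : ∑ μ ∈ latticeCircle m, ‖a μ‖ ^ 2 = 1) {μ : Fin 2 → ℤ}
    (hμ : μ ∈ latticeCircle m) : ‖a μ‖ ≤ 1 := by
  have := Finset.single_le_sum (f := fun μ => ‖a μ‖ ^ 2) (fun _ _ => by positivity) hμ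
  rw [ha] at this
  exact (sq_le_one_iff₀ (norm_nonneg _)).1 this

theorem norm_exp_frequency_le {μ : Fin 2 → ℤ} (hμ : μ ∈ latticeCircle m)
    (hv : v 0 ^ 2 + v 1 ^ 2 = 1) (w : ℂ) :
    ‖Complex.exp (Complex.I * directionalFrequency v μ * w)‖ ≤
      Real.exp (torusFrequency m * |w.im|) := by
  rw [Complex.norm_exp]
  gcongr
  have : (Complex.I * directionalFrequency v μ * w).re = -(directionalFrequency v μ * w.im) := by
    simp
  rw [this]
  refine (neg_le_abs _).trans ?_
  rw [abs_mul]
  gcongr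
  exact abs_directionalFrequency_le hμ hv

/-- `ε` is the Taylor remainder of the curve paired with `2πiμ`; its size comes from `|μ₁| + |μ₂| ≤
2√m`. -/
theorem exists_remainder (hΓ : HasUnitTaylor Γ r K s v) {w : ℂ} (hw : ‖w‖ ≤ r) {μ : Fin 2 → ℤ}
    (hμ : μ ∈ latticeCircle m) :
    ∃ ε : ℂ, ‖ε‖ ≤ 2 * torusFrequency m * K * ‖w‖ ^ 2 ∧
      Complex.exp (2 * Real.pi * Complex.I * ∑ j, (μ j : ℂ) * Γ (s + w) j) =
        Complex.exp (2 * Real.pi * Complex.I * ∑ j, (μ j : ℂ) * Γ s j) *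
          Complex.exp (Complex.I * directionalFrequency v μ * w) * Complex.exp ε := by
  set R : Fin 2 → ℂ := fun j => Γ (s + w) j - Γ s j - w * v j
  refine ⟨2 * Real.pi * Complex.I * ∑ j, (μ j : ℂ) * R j, ?_, ?_⟩
  · rw [norm_mul, Fin.sum_univ_two]
    have h1 : ‖(2 * Real.pi * Complex.I : ℂ)‖ = 2 * Real.pi := by
      simp [abs_of_pos Real.pi_pos]
    rw [h1]
    have h2 : ∀ j, ‖(μ j : ℂ) * R j‖ ≤ |(μ j : ℝ)| * (K * ‖w‖ ^ 2) := by
      intro j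
      rw [norm_mul, Complex.norm_intCast]
      gcongr
      exact hΓ.taylor w hw j
    have h3 := abs_add_abs_le_of_mem hμ
    have hK : 0 ≤ K * ‖w‖ ^ 2 := mul_nonneg (by linarith [hΓ.one_le]) (by positivity)
    calc _ ≤ 2 * Real.pi * (|(μ 0 : ℝ)| * (K * ‖w‖ ^ 2) + |(μ 1 : ℝ)| * (K * ‖w‖ ^ 2)) := by
          gcongr
          exact (norm_add_le _ _).trans (add_le_add (h2 0) (h2 1))
      _ = 2 * Real.pi * ((|(μ 0 : ℝ)| + |(μ 1 : ℝ)|) * (K * ‖w‖ ^ 2)) := by ring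
      _ ≤ 2 * Real.pi * ((2 * Real.sqrt m) * (K * ‖w‖ ^ 2)) := by gcongr
      _ = _ := by unfold torusFrequency; ring
  · rw [← Complex.exp_add, ← Complex.exp_add]
    congr 1
    simp only [Fin.sum_univ_two, R, directionalFrequency]
    push_cast
    ring

theorem norm_eigenfunction_sub_tangentSum_le (hΓ : HasUnitTaylor Γ r K s v)
    (ha : ∑ μ ∈ latticeCircle m, ‖a μ‖ ^ 2 = 1) {w : ℂ} (hw : ‖w‖ ≤ r)
    (hw1 : 2 * torusFrequency m * K * ‖w‖ ^ 2 ≤ 1) :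
    ‖complexifiedEigenfunction m a (Γ (s + w)) - tangentSum m a (Γ s) v w‖ ≤
      latticeCount m * (Real.exp (torusFrequency m * |w.im|) *
        (4 * torusFrequency m * K * ‖w‖ ^ 2)) := by
  unfold complexifiedEigenfunction tangentSum latticeCount
  rw [← Finset.sum_sub_distrib, ← nsmul_eq_mul]
  refine (norm_sum_le _ _).trans (Finset.sum_le_card_nsmul _ _ _ fun μ hμ => ?_)
  obtain ⟨ε, hε, hexp⟩ := exists_remainder hΓ hw hμ
  rw [hexp, show ∀ a b c d : ℂ, a * (b * c * d) - a * b * c = a * b * (c * (d - 1)) by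
    intros; ring, norm_mul, norm_mul, norm_phase_eq_one hΓ, mul_one, norm_mul]
  have h1 := Complex.norm_exp_sub_one_le (hε.trans hw1)
  have h2 : ‖Complex.exp ε - 1‖ ≤ 4 * torusFrequency m * K * ‖w‖ ^ 2 := by linarith
  calc _ ≤ 1 * (Real.exp (torusFrequency m * |w.im|) * (4 * torusFrequency m * K * ‖w‖ ^ 2)) := by
        gcongr
        · exact norm_coeff_le_one ha hμ
        · exact norm_exp_frequency_le hμ hΓ.unit w
    _ = _ := one_mul _

/-- A crude growth bound that needs no smallness of `λ|w|²`: since `|w| ≤ 1`, the quadratic term is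
absorbed by the linear one. -/
theorem norm_eigenfunction_le (hΓ : HasUnitTaylor Γ r K s v)
    (ha : ∑ μ ∈ latticeCircle m, ‖a μ‖ ^ 2 = 1) {w : ℂ} (hw : ‖w‖ ≤ r) :
    ‖complexifiedEigenfunction m a (Γ (s + w))‖ ≤
      latticeCount m * Real.exp (3 * torusFrequency m * K * ‖w‖) := by
  unfold complexifiedEigenfunction latticeCount
  rw [← nsmul_eq_mul]
  refine (norm_sum_le _ _).trans (Finset.sum_le_card_nsmul _ _ _ fun μ hμ => ?_)
  obtain ⟨ε, hε, hexp⟩ := exists_remainder hΓ hw hμ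
  rw [hexp, norm_mul, norm_mul, norm_mul, norm_phase_eq_one hΓ, one_mul]
  have h1 : ‖Complex.exp ε‖ ≤ Real.exp (2 * torusFrequency m * K * ‖w‖ ^ 2) := by
    rw [Complex.norm_exp]
    gcongr
    exact (Complex.re_le_norm ε).trans hε
  have hfr := torusFrequency_nonneg m
  have hw1 : ‖w‖ ≤ 1 := hw.trans hΓ.le_one
  have h2 : torusFrequency m * |w.im| ≤ torusFrequency m * K * ‖w‖ := by
    calc torusFrequency m * |w.im| ≤ torusFrequency m * ‖w‖ := by
          gcongr; exact Complex.abs_im_le_norm w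
      _ ≤ _ := by
          gcongr
          exact le_mul_of_one_le_right hfr hΓ.one_le
  have h3 : 2 * torusFrequency m * K * ‖w‖ ^ 2 ≤ 2 * torusFrequency m * K * ‖w‖ := by
    have : 0 ≤ K := by linarith [hΓ.one_le]
    have : ‖w‖ ^ 2 ≤ ‖w‖ := by nlinarith [norm_nonneg w]
    gcongr
  calc _ ≤ 1 * (Real.exp (torusFrequency m * |w.im|) *
        Real.exp (2 * torusFrequency m * K * ‖w‖ ^ 2)) := by
        gcongr
        · exact norm_coeff_le_one ha hμ
        · exact norm_exp_frequency_le hμ hΓ.unit w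
    _ ≤ _ := by
        rw [one_mul, ← Real.exp_add]
        gcongr
        linarith

theorem differentiableOn_eigenfunction_comp {U : Set ℂ} (hΓ : DifferentiableOn ℂ Γ U) :
    DifferentiableOn ℂ (fun z => complexifiedEigenfunction m a (Γ z)) U := by
  unfold complexifiedEigenfunction
  have h : ∀ j, DifferentiableOn ℂ (fun z => Γ z j) U := fun j => differentiableOn_pi.1 hΓ j
  fun_prop

theorem latticeCount_pos_of_sum_eq_one (ha : ∑ μ ∈ latticeCircle m, ‖a μ‖ ^ 2 = 1) :
    1 ≤ latticeCount m := by
  rw [latticeCount, Nat.one_le_iff_ne_zero, Ne, Finset.card_eq_zero]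
  intro h
  rw [h] at ha
  simp at ha

/-- Zeros near a point where the tangential sum is bounded below at a nearby real parameter. -/
theorem zeros_le_of_real_lower_bound {U : Set ℂ} (hU : IsOpen U)
    (hhol : DifferentiableOn ℂ Γ U) (hball : Metric.closedBall (s : ℂ) r ⊆ U)
    (hΓ : HasUnitTaylor Γ r K s v) (ha : ∑ μ ∈ latticeCircle m, ‖a μ‖ ^ 2 = 1)
    {R β x : ℝ} (hR : 0 < R) (hRr : 9 * R ≤ r) (hx : |x| ≤ R) (hβ : 0 < β) (hβ1 : β ≤ 1)
    (herr : 4 * latticeCount m * torusFrequency m * K * x ^ 2 ≤ β)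
    (hF : 2 * β ≤ ‖tangentSum m a (Γ s) v x‖) :
    {z ∈ Metric.closedBall (s : ℂ) R | complexifiedEigenfunction m a (Γ z) = 0}.Finite ∧
      ({z ∈ Metric.closedBall (s : ℂ) R | complexifiedEigenfunction m a (Γ z) = 0}.ncard : ℝ) ≤
        27 * torusFrequency m * K * R + Real.log (latticeCount m / β) := by
  have hN : (1 : ℝ) ≤ latticeCount m := by exact_mod_cast latticeCount_pos_of_sum_eq_one ha
  have hfr := torusFrequency_nonneg m
  have hK : 0 ≤ K := by linarith [hΓ.one_le]
  have hxn : ‖(x : ℂ)‖ = |x| := by rw [Complex.norm_real, Real.norm_eq_abs]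
  have hfx : β ≤ ‖complexifiedEigenfunction m a (Γ (s + x))‖ := by
    have h := norm_eigenfunction_sub_tangentSum_le hΓ ha (w := x) (by rw [hxn]; linarith) (by
      rw [hxn, sq_abs]
      have : 0 ≤ torusFrequency m * K * x ^ 2 := by positivity
      nlinarith)
    rw [hxn, sq_abs, Complex.ofReal_im, abs_zero, mul_zero, Real.exp_zero, one_mul] at h
    have h2 := norm_sub_norm_le (tangentSum m a (Γ s) v x)
      (complexifiedEigenfunction m a (Γ (s + x)))
    rw [norm_sub_rev] at h2
    linarith
  -- The zeros are counted from the centre `s + x`: the disc of radius `2R` there contains the one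
  -- of radius `R` about `s`, and four times that radius stays within `9R` of `s`.
  have hsub : Metric.closedBall ((s : ℂ) + x) (4 * (2 * R)) ⊆ Metric.closedBall (s : ℂ) (9 * R) := by
    refine Metric.closedBall_subset_closedBall' ?_
    rw [dist_eq_norm, add_sub_cancel_left, hxn]
    linarith
  refine zeros_finite_and_ncard_le (r := 2 * R) (c := s + x) hU
    (differentiableOn_eigenfunction_comp (m := m) (a := a) hhol) (by linarith)
    (hsub.trans ((Metric.closedBall_subset_closedBall hRr).trans hball))
    (A := latticeCount m * Real.exp (27 * torusFrequency m * K * R)) (fun z hz => ?_)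
    (hβ.trans_le hfx) ?_ ?_
  · have hz' := hsub hz
    rw [mem_closedBall_iff_norm] at hz'
    have h := norm_eigenfunction_le hΓ ha (w := z - s) (hz'.trans hRr)
    rw [add_sub_cancel] at h
    refine h.trans ?_
    gcongr _ * Real.exp ?_
    calc _ ≤ 3 * torusFrequency m * K * (9 * R) := by gcongr
      _ = _ := by ring
  · rw [Real.exp_add, Real.exp_log (by positivity)]
    calc _ = Real.exp (27 * torusFrequency m * K * R) * (latticeCount m / β) * β := by
          field_simp
      _ ≤ _ := by gcongr
  · rintro z ⟨hz, hz0⟩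
    refine ⟨?_, hz0⟩
    rw [mem_closedBall_iff_norm] at hz ⊢
    have := norm_sub_le (z - s) x
    rw [show z - (s + x) = z - s - x by ring]
    linarith

theorem continuous_tangentSum (p : Fin 2 → ℂ) : Continuous (tangentSum m a p v) := by
  unfold tangentSum
  fun_prop

/-- Zeros near a point where the tangential sum dominates the error on a whole disc. -/
theorem zeros_le_of_complex_lower_bound {U : Set ℂ} (hU : IsOpen U)
    (hhol : DifferentiableOn ℂ Γ U) (hball : Metric.closedBall (s : ℂ) r ⊆ U)
    (hΓ : HasUnitTaylor Γ r K s v) (ha : ∑ μ ∈ latticeCircle m, ‖a μ‖ ^ 2 = 1)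
    {R β x : ℝ} (hR : 0 < R) (hRr : 9 * R ≤ r) (hx : |x| ≤ R) (hβ : 0 < β) (hβ1 : β ≤ 1)
    (herr : latticeCount m * (Real.exp (9 * torusFrequency m * R) *
      (4 * torusFrequency m * K * (9 * R) ^ 2)) ≤ β)
    (hF : 2 * β ≤ ‖tangentSum m a (Γ s) v x‖) :
    {z ∈ Metric.closedBall (s : ℂ) R | complexifiedEigenfunction m a (Γ z) = 0}.Finite ∧
      ({z ∈ Metric.closedBall (s : ℂ) R | complexifiedEigenfunction m a (Γ z) = 0}.ncard : ℝ) ≤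
        9 * torusFrequency m * R + Real.log (4 * 72 ^ latticeCount m) := by
  have hN : (1 : ℝ) ≤ latticeCount m := by exact_mod_cast latticeCount_pos_of_sum_eq_one ha
  have hfr := torusFrequency_nonneg m
  have hK : 0 ≤ K := by linarith [hΓ.one_le]
  have hxn : ‖(x : ℂ)‖ = |x| := by rw [Complex.norm_real, Real.norm_eq_abs]
  -- Counting from a maximum point of the tangential sum cancels the size `B` of that maximum, so
  -- `β` only has to dominate the error and does not enter the count.
  obtain ⟨w₀, hw₀, hmax⟩ := (isCompact_closedBall (0 : ℂ) R).exists_isMaxOn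
    (Metric.nonempty_closedBall.2 hR.le) (continuous_tangentSum (m := m) (a := a) (v := v)
      (Γ s)).norm.continuousOn
  set B := ‖tangentSum m a (Γ s) v w₀‖
  have hBmax : ∀ w : ℂ, ‖w‖ ≤ R → ‖tangentSum m a (Γ s) v w‖ ≤ B := fun w hw =>
    hmax (by rwa [mem_closedBall_zero_iff])
  have hB : 2 * β ≤ B := hF.trans (hBmax x (by rw [hxn]; exact hx))
  rw [mem_closedBall_zero_iff] at hw₀
  have herr' : ∀ w : ℂ, ‖w‖ ≤ 9 * R →
      ‖complexifiedEigenfunction m a (Γ (s + w)) - tangentSum m a (Γ s) v w‖ ≤ B / 2 := by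
    intro w hw
    have hq : torusFrequency m * K * ‖w‖ ^ 2 ≤ torusFrequency m * K * (9 * R) ^ 2 := by gcongr
    have he : 1 ≤ Real.exp (9 * torusFrequency m * R) := Real.one_le_exp (by positivity)
    have h0 : 0 ≤ torusFrequency m * K * (9 * R) ^ 2 := by positivity
    have h1 : 4 * (torusFrequency m * K * (9 * R) ^ 2) ≤ β := by
      refine le_trans ?_ herr
      have : 1 ≤ latticeCount m * Real.exp (9 * torusFrequency m * R) :=
        one_le_mul_of_one_le_of_one_le hN he
      nlinarith
    refine (norm_eigenfunction_sub_tangentSum_le hΓ ha (hw.trans hRr) (by linarith)).trans ?_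
    refine le_trans ?_ (show β ≤ B / 2 by linarith)
    refine le_trans ?_ herr
    have him : torusFrequency m * |w.im| ≤ 9 * torusFrequency m * R := by
      have := (Complex.abs_im_le_norm w).trans hw
      nlinarith
    gcongr
  have hB0 : 0 < B := by linarith
  have hfx : B / 2 ≤ ‖complexifiedEigenfunction m a (Γ (s + w₀))‖ := by
    have h := herr' w₀ (by linarith)
    have h2 := norm_sub_norm_le (tangentSum m a (Γ s) v w₀)
      (complexifiedEigenfunction m a (Γ (s + w₀)))
    rw [norm_sub_rev] at h2
    linarith
  -- Turán with `q = 9` along the segment from `0` to `w`; hence `72 = 8 · 9`.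
  have hdouble : ∀ w : ℂ, ‖w‖ ≤ 9 * R → ‖tangentSum m a (Γ s) v w‖ ≤
      B * (72 ^ latticeCount m * Real.exp (9 * torusFrequency m * R)) := by
    intro w hw
    have h := norm_expSum_le (latticeCircle m) (directionalFrequency v)
      (fun μ => a μ * Complex.exp (2 * Real.pi * Complex.I * ∑ j, (μ j : ℂ) * Γ s j))
      (fun μ hμ => abs_directionalFrequency_le hμ hΓ.unit) (q := 9) (by norm_num) w hB0.le
      (by exact_mod_cast latticeCount_pos_of_sum_eq_one ha) (fun t ht0 ht => ?_)
    · refine h.trans ?_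
      rw [mul_assoc]
      norm_num only [Nat.cast_ofNat]
      have him : torusFrequency m * |w.im| ≤ 9 * torusFrequency m * R := by
        have := (Complex.abs_im_le_norm w).trans hw
        nlinarith
      unfold latticeCount
      gcongr
    · refine hBmax (t * w) ?_
      rw [norm_mul, Complex.norm_real, Real.norm_eq_abs, abs_of_nonneg ht0]
      calc t * ‖w‖ ≤ ((9 : ℕ) : ℝ)⁻¹ * (9 * R) := by gcongr
        _ = R := by push_cast; ring
  have hD : 1 ≤ (72 : ℝ) ^ latticeCount m * Real.exp (9 * torusFrequency m * R) :=
    one_le_mul_of_one_le_of_one_le (one_le_pow₀ (by norm_num)) (Real.one_le_exp (by positivity))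
  have hsub : Metric.closedBall ((s : ℂ) + w₀) (4 * (2 * R)) ⊆
      Metric.closedBall (s : ℂ) (9 * R) := by
    refine Metric.closedBall_subset_closedBall' ?_
    rw [dist_eq_norm, add_sub_cancel_left]
    linarith
  refine zeros_finite_and_ncard_le (r := 2 * R) (c := s + w₀) hU
    (differentiableOn_eigenfunction_comp (m := m) (a := a) hhol) (by linarith)
    (hsub.trans ((Metric.closedBall_subset_closedBall hRr).trans hball))
    (A := 2 * (B * (72 ^ latticeCount m * Real.exp (9 * torusFrequency m * R))))
    (fun z hz => ?_) (by linarith) ?_ ?_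
  · have hz' := hsub hz
    rw [mem_closedBall_iff_norm] at hz'
    have h := herr' (z - s) hz'
    rw [add_sub_cancel] at h
    have h1 := hdouble (z - s) hz'
    have h2 := norm_sub_norm_le (complexifiedEigenfunction m a (Γ z))
      (tangentSum m a (Γ s) v (z - s))
    nlinarith
  · rw [Real.exp_add, Real.exp_log (by positivity)]
    calc _ = Real.exp (9 * torusFrequency m * R) * (4 * 72 ^ latticeCount m) * (B / 2) := by
          ring
      _ ≤ _ := by gcongr
  · rintro z ⟨hz, hz0⟩
    refine ⟨?_, hz0⟩
    rw [mem_closedBall_iff_norm] at hz ⊢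
    have := norm_sub_le (z - s) w₀
    rw [show z - (s + w₀) = z - s - w₀ by ring]
    linarith

/-- The mean square lower bound for the tangential sum. -/
theorem exists_half_le_norm_tangentSum (hΓ : HasUnitTaylor Γ r K s v)
    (ha : ∑ μ ∈ latticeCircle m, ‖a μ‖ ^ 2 = 1) (hm : 0 < torusFrequency m) {δ : ℝ} (hδ : 0 < δ)
    (hsep : ∀ μ ∈ latticeCircle m, ∀ ν ∈ latticeCircle m, μ ≠ ν →
      δ * torusFrequency m ≤ |directionalFrequency v μ - directionalFrequency v ν|) :
    ∃ x : ℝ, 0 ≤ x ∧ x * torusFrequency m ≤ 5 * latticeCount m / δ + 1 ∧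
      1 / 2 ≤ ‖tangentSum m a (Γ s) v x‖ := by
  -- Two frequencies differ by at most `2λ`, so sampling with step `1/λ` keeps phase differences
  -- below `π`.
  have hpi : ∀ μ ∈ latticeCircle m, ∀ ν ∈ latticeCircle m,
      |directionalFrequency v μ - directionalFrequency v ν| * (torusFrequency m)⁻¹ ≤ Real.pi := by
    intro μ hμ ν hν
    rw [← div_eq_mul_inv, div_le_iff₀ hm]
    have h1 := abs_directionalFrequency_le hμ hΓ.unit
    have h2 := abs_directionalFrequency_le hν hΓ.unit
    have h3 := abs_sub (directionalFrequency v μ) (directionalFrequency v ν)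
    nlinarith [Real.pi_gt_three]
  have hK : 5 * ((latticeCircle m).card : ℝ) ≤
      (⌈5 * latticeCount m / δ⌉₊ : ℕ) * ((torusFrequency m)⁻¹ * (δ * torusFrequency m)) := by
    rw [show (torusFrequency m)⁻¹ * (δ * torusFrequency m) = δ by field_simp,
      ← div_le_iff₀ hδ]
    exact Nat.le_ceil _
  obtain ⟨k, hk, h⟩ := exists_half_le_norm_expSum (latticeCircle m) (directionalFrequency v)
    (fun μ => a μ * Complex.exp (2 * Real.pi * Complex.I * ∑ j, (μ j : ℂ) * Γ s j))
    (by simp_rw [norm_mul, norm_phase_eq_one hΓ, mul_one]; exact ha)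
    (inv_pos.2 hm) (mul_pos hδ hm) hsep hpi hK
  refine ⟨k * (torusFrequency m)⁻¹, by positivity, ?_, h⟩
  rw [mul_assoc, inv_mul_cancel₀ hm.ne', mul_one]
  have h1 : (k : ℝ) ≤ ⌈5 * latticeCount m / δ⌉₊ := by exact_mod_cast hk.le
  exact h1.trans (Nat.ceil_lt_add_one (by positivity)).le

/-- Turán's bound along the real axis for the tangential sum. -/
theorem exists_le_norm_tangentSum_of_long (hΓ : HasUnitTaylor Γ r K s v)
    (ha : ∑ μ ∈ latticeCircle m, ‖a μ‖ ^ 2 = 1) {q : ℕ} (hq : 1 ≤ q) {x R : ℝ}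
    (hx0 : 0 ≤ x) (hx : x ≤ q * R) (hF : 1 / 2 ≤ ‖tangentSum m a (Γ s) v x‖) :
    ∃ y : ℝ, 0 ≤ y ∧ y ≤ R ∧
      (2 * (8 * q : ℝ) ^ latticeCount m)⁻¹ ≤ ‖tangentSum m a (Γ s) v y‖ := by
  by_contra! hcon
  have hq0 : (0 : ℝ) < q := by exact_mod_cast hq
  have hP : 0 < (2 * (8 * q : ℝ) ^ latticeCount m) := by positivity
  have hR : 0 ≤ R := by
    by_contra hR
    nlinarith
  obtain ⟨y₀, hy₀, hmax⟩ := (isCompact_Icc (a := (0 : ℝ)) (b := R)).exists_isMaxOn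
    (nonempty_Icc.2 hR) ((continuous_tangentSum (m := m) (a := a) (v := v)
      (Γ s)).comp Complex.continuous_ofReal).norm.continuousOn
  have h := norm_expSum_le (latticeCircle m) (directionalFrequency v)
    (fun μ => a μ * Complex.exp (2 * Real.pi * Complex.I * ∑ j, (μ j : ℂ) * Γ s j))
    (fun μ hμ => abs_directionalFrequency_le hμ hΓ.unit) hq x (norm_nonneg
      (tangentSum m a (Γ s) v y₀)) (by exact_mod_cast latticeCount_pos_of_sum_eq_one ha)
      (fun t ht0 ht => ?_)
  · rw [Complex.ofReal_im, abs_zero, mul_zero, Real.exp_zero, mul_one] at h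
    have h1 := hcon y₀ hy₀.1 hy₀.2
    have h2 : (1 : ℝ) / 2 ≤ ‖tangentSum m a (Γ s) v y₀‖ * (8 * q) ^ latticeCount m := hF.trans h
    rw [← one_div, lt_div_iff₀ hP] at h1
    linarith
  · have := hmax (a := t * x) ⟨mul_nonneg ht0 hx0, ?_⟩
    · simpa [tangentSum] using this
    · calc t * x ≤ (q : ℝ)⁻¹ * (q * R) := by gcongr
        _ = R := by field_simp

end

/-! ### Gaussian integers and the directions of differences of lattice points. -/

section

open scoped Pointwise

/-- The Gaussian integers of norm `m`. -/
noncomputable def gaussianCircle (m : ℕ) : Finset GaussianInt :=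
  (latticeCircle m).image fun μ => ⟨μ 0, μ 1⟩

theorem mem_gaussianCircle {m : ℕ} {z : GaussianInt} : z ∈ gaussianCircle m ↔ z.norm = m := by
  unfold gaussianCircle
  simp only [Finset.mem_image, mem_latticeCircle, Zsqrtd.norm_def]
  constructor
  · rintro ⟨μ, hμ, rfl⟩
    simp only
    linarith
  · intro h
    refine ⟨![z.re, z.im], ?_, by simp⟩
    simp only [Matrix.cons_val_zero, Matrix.cons_val_one]
    linarith

theorem card_gaussianCircle (m : ℕ) : (gaussianCircle m).card = latticeCount m := by
  unfold gaussianCircle latticeCount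
  refine Finset.card_image_of_injective _ fun μ ν h => ?_
  rw [Zsqrtd.ext_iff] at h
  ext j
  fin_cases j
  · exact h.1
  · exact h.2

theorem GaussianInt.norm_dvd_norm {x y : GaussianInt} (h : x ∣ y) : x.norm ∣ y.norm := by
  obtain ⟨c, rfl⟩ := h
  exact ⟨c.norm, Zsqrtd.norm_mul x c⟩

theorem GaussianInt.prime_of_norm_eq_prime {π : GaussianInt} {p : ℕ} (hp : p.Prime)
    (hπ : π.norm = p) : Prime π := by
  rw [← irreducible_iff_prime, irreducible_iff]
  have hunit : ∀ x : GaussianInt, IsUnit x ↔ x.norm.natAbs = 1 := fun x =>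
    Zsqrtd.norm_eq_one_iff.symm
  refine ⟨fun h => ?_, fun a b hab => ?_⟩
  · rw [hunit, hπ, Int.natAbs_natCast] at h
    exact hp.one_lt.ne' h
  · have h1 : a.norm.natAbs * b.norm.natAbs = p := by
      rw [← Int.natAbs_mul, ← Zsqrtd.norm_mul, ← hab, hπ, Int.natAbs_natCast]
    rw [hunit, hunit]
    rcases (Nat.dvd_prime hp).1 ⟨_, h1.symm⟩ with h2 | h2
    · exact Or.inl h2
    · right
      rw [h2] at h1
      exact Nat.eq_of_mul_eq_mul_left hp.pos (by rw [h1, mul_one])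

theorem GaussianInt.dvd_or_star_dvd {π z : GaussianInt} (hπ : Prime π) {p : ℕ}
    (hπp : π ∣ (p : GaussianInt)) (hz : (p : ℤ) ∣ z.norm) : π ∣ z ∨ star π ∣ z := by
  obtain ⟨c, hc⟩ := hz
  have h1 : π ∣ z * star z := by
    rw [← Zsqrtd.norm_eq_mul_conj, hc]
    push_cast
    exact hπp.mul_right _
  rcases hπ.dvd_or_dvd h1 with h | ⟨d, hd⟩
  · exact Or.inl h
  · right
    refine ⟨star d, ?_⟩
    rw [← star_star z, hd, star_mul, mul_comm]

theorem GaussianInt.dvd_natCast_of_norm_eq {π : GaussianInt} {p : ℕ} (hπ : π.norm = p) :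
    π ∣ (p : GaussianInt) := by
  refine ⟨star π, ?_⟩
  rw [← Zsqrtd.norm_eq_mul_conj, hπ]
  simp

theorem gaussianCircle_eq_image {π : GaussianInt} {q m : ℕ} (hq : 0 < q) (hπ : π.norm = q)
    (h : ∀ z ∈ gaussianCircle (q * m), π ∣ z) :
    gaussianCircle (q * m) = (gaussianCircle m).image (π * ·) := by
  ext z
  simp only [Finset.mem_image]
  constructor
  · intro hz
    obtain ⟨c, rfl⟩ := h z hz
    refine ⟨c, ?_, rfl⟩
    rw [mem_gaussianCircle, Zsqrtd.norm_mul, hπ] at hz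
    rw [mem_gaussianCircle]
    push_cast at hz
    exact mul_left_cancel₀ (by exact_mod_cast hq.ne') hz
  · rintro ⟨c, hc, rfl⟩
    rw [mem_gaussianCircle] at hc ⊢
    rw [Zsqrtd.norm_mul, hπ, hc]
    push_cast
    rfl

/-- Above `2` and above `p ≡ 3 mod 4` there is a single Gaussian prime, so all points share the
factor `1 + i` or `p` and the circle is a dilate of a smaller one. In the second case a point exists
only if `p² ∣ m`. -/
theorem gaussianCircle_dvd_or_isEmpty {m p : ℕ} (hp : p.Prime) (hpm : p ∣ m) (hm : 0 < m)
    (hp1 : p % 4 ≠ 1) : gaussianCircle m = ∅ ∨ ∃ (π : GaussianInt) (q m' : ℕ), 2 ≤ q ∧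
      π.norm = q ∧ m = q * m' ∧ ∀ z ∈ gaussianCircle m, π ∣ z := by
  have hfact : Fact p.Prime := ⟨hp⟩
  have hkey : ∀ z ∈ gaussianCircle m, (p : ℤ) ∣ z.norm := by
    intro z hz
    rw [mem_gaussianCircle.1 hz]
    exact_mod_cast hpm
  rcases Finset.eq_empty_or_nonempty (gaussianCircle m) with h0 | ⟨z₀, hz₀⟩
  · exact Or.inl h0
  right
  rcases hp.eq_two_or_odd with rfl | hodd
  · obtain ⟨m', rfl⟩ := hpm
    have hn : (⟨1, 1⟩ : GaussianInt).norm = (2 : ℕ) := by simp [Zsqrtd.norm_def]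
    refine ⟨⟨1, 1⟩, 2, m', le_rfl, hn, rfl, fun z hz => ?_⟩
    rcases GaussianInt.dvd_or_star_dvd (GaussianInt.prime_of_norm_eq_prime hp hn)
      (GaussianInt.dvd_natCast_of_norm_eq hn) (hkey z hz) with h | ⟨c, rfl⟩
    · exact h
    · refine Dvd.dvd.mul_right ⟨⟨0, -1⟩, ?_⟩ c
      ext <;> simp
  · have hp3 : p % 4 = 3 := by omega
    have hprime := GaussianInt.prime_of_nat_prime_of_mod_four_eq_three p hp3
    have hdvd : ∀ z ∈ gaussianCircle m, (p : GaussianInt) ∣ z := by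
      intro z hz
      rcases GaussianInt.dvd_or_star_dvd hprime dvd_rfl (hkey z hz) with h | h
      · exact h
      · simpa using h
    have hn : (p : GaussianInt).norm = (p * p : ℕ) := by
      rw [Zsqrtd.norm_natCast]
      push_cast
      rfl
    have h2 := GaussianInt.norm_dvd_norm (hdvd z₀ hz₀)
    rw [hn, mem_gaussianCircle.1 hz₀] at h2
    obtain ⟨m', hm'⟩ : p * p ∣ m := by exact_mod_cast h2
    refine ⟨p, p * p, m', ?_, hn, hm', hdvd⟩
    nlinarith [hp.two_le]

theorem GaussianInt.exists_eq_pow_mul_pow_mul {π : GaussianInt} {p : ℕ} (hp : p.Prime)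
    (hπ : π.norm = p) (m e : ℕ) (z : GaussianInt) (hz : z ∈ gaussianCircle (p ^ e * m)) :
    ∃ i j : ℕ, i + j = e ∧ ∃ w ∈ gaussianCircle m, z = π ^ i * star π ^ j * w := by
  have hp0 : (p : ℤ) ≠ 0 := by exact_mod_cast hp.ne_zero
  induction e generalizing z with
  | zero => exact ⟨0, 0, rfl, z, by simpa using hz, by simp⟩
  | succ e ih =>
    have hzn := mem_gaussianCircle.1 hz
    push_cast at hzn
    have hdiv : (p : ℤ) ∣ z.norm := ⟨p ^ e * m, by rw [hzn]; ring⟩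
    have hred : ∀ ρ c : GaussianInt, ρ.norm = p → z = ρ * c → c ∈ gaussianCircle (p ^ e * m) := by
      rintro ρ c hρ rfl
      rw [Zsqrtd.norm_mul, hρ] at hzn
      rw [mem_gaussianCircle]
      push_cast
      apply mul_left_cancel₀ hp0
      rw [hzn]
      ring
    rcases GaussianInt.dvd_or_star_dvd (GaussianInt.prime_of_norm_eq_prime hp hπ)
      (GaussianInt.dvd_natCast_of_norm_eq hπ) hdiv with ⟨c, hc⟩ | ⟨c, hc⟩
    · obtain ⟨i, j, hij, w, hw, rfl⟩ := ih c (hred _ _ hπ hc)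
      exact ⟨i + 1, j, by omega, w, hw, by rw [hc]; ring⟩
    · obtain ⟨i, j, hij, w, hw, rfl⟩ := ih c (hred _ _ (by rw [Zsqrtd.norm_conj, hπ]) hc)
      exact ⟨i, j + 1, by omega, w, hw, by rw [hc]; ring⟩

/-- Otherwise `π` divides its trace, so `p` divides `Re π`, hence also `Im π`, and `p²` would divide
`p`. -/
theorem GaussianInt.not_dvd_star {π : GaussianInt} {p : ℕ} (hp : p.Prime) (hp1 : p % 4 = 1)
    (hπ : π.norm = p) : ¬ π ∣ star π := by
  intro h
  have h1 : π ∣ ((2 * π.re : ℤ) : GaussianInt) := by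
    have : ((2 * π.re : ℤ) : GaussianInt) = π + star π := by
      ext
      · simp; ring
      · simp
    rw [this]
    exact dvd_add dvd_rfl h
  have h2 := GaussianInt.norm_dvd_norm h1
  rw [hπ, Zsqrtd.norm_intCast] at h2
  have hpz : Prime (p : ℤ) := Nat.prime_iff_prime_int.1 hp
  have h3 : (p : ℤ) ∣ 2 * π.re := by
    rcases hpz.dvd_or_dvd h2 with h | h <;> exact h
  have h4 : (p : ℤ) ∣ π.re := by
    rcases hpz.dvd_or_dvd h3 with h | h
    · have : p ∣ 2 := by exact_mod_cast h
      have := Nat.le_of_dvd (by norm_num) this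
      have := hp.two_le
      have : p = 2 := by omega
      omega
    · exact h
  have hn : π.re ^ 2 + π.im ^ 2 = p := by
    rw [← hπ, Zsqrtd.norm_def]; ring
  obtain ⟨c, hc⟩ := h4
  have h5 : (p : ℤ) ∣ π.im := by
    apply hpz.dvd_of_dvd_pow (n := 2)
    refine ⟨1 - p * c ^ 2, ?_⟩
    rw [hc] at hn
    linear_combination hn
  obtain ⟨d, hd⟩ := h5
  rw [hc, hd] at hn
  have h6 : (p : ℤ) * (p * (c ^ 2 + d ^ 2)) = p * 1 := by linear_combination hn
  have h7 := mul_left_cancel₀ hpz.ne_zero h6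
  have : p ∣ 1 := by exact_mod_cast Dvd.intro _ h7
  exact hp.one_lt.ne' (Nat.dvd_one.1 this)

/-- `π` divides neither its conjugate nor `w`, so the exponent of `π` can be read off from the
product. -/
theorem GaussianInt.pow_mul_pow_mul_injective {π : GaussianInt} {p : ℕ} (hp : p.Prime)
    (hp1 : p % 4 = 1) (hπ : π.norm = p) {m : ℕ} (hpm : ¬ p ∣ m) {i j i' j' : ℕ}
    (hij : i + j = i' + j') {w w' : GaussianInt} (hw : w ∈ gaussianCircle m)
    (hle : i ≤ i')
    (h : π ^ i * star π ^ j * w = π ^ i' * star π ^ j' * w') : i = i' ∧ w = w' := by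
  have hprime := GaussianInt.prime_of_norm_eq_prime hp hπ
  have hne : π ≠ 0 := hprime.ne_zero
  have hne' : star π ≠ 0 := by simpa using hne
  obtain ⟨k, rfl⟩ := Nat.exists_eq_add_of_le hle
  obtain rfl : j = k + j' := by omega
  have h1 : star π ^ k * w = π ^ k * w' := by
    have : (π ^ i * star π ^ j') * (star π ^ k * w) = (π ^ i * star π ^ j') * (π ^ k * w') := by
      linear_combination h
    exact mul_left_cancel₀ (mul_ne_zero (pow_ne_zero _ hne) (pow_ne_zero _ hne')) this
  rcases Nat.eq_zero_or_pos k with rfl | hk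
  · exact ⟨rfl, by simpa using h1⟩
  · exfalso
    have h2 : π ∣ star π ^ k * w := by
      rw [h1]
      exact (dvd_pow_self π hk.ne').mul_right _
    rcases hprime.dvd_or_dvd h2 with h3 | h3
    · exact GaussianInt.not_dvd_star hp hp1 hπ (hprime.dvd_of_dvd_pow h3)
    · have h4 := GaussianInt.norm_dvd_norm h3
      rw [hπ, mem_gaussianCircle.1 hw] at h4
      exact hpm (by exact_mod_cast h4)

theorem succ_mul_card_gaussianCircle_le {π : GaussianInt} {p : ℕ} (hp : p.Prime)
    (hp1 : p % 4 = 1) (hπ : π.norm = p) {m : ℕ} (hpm : ¬ p ∣ m) (e : ℕ) :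
    (e + 1) * (gaussianCircle m).card ≤ (gaussianCircle (p ^ e * m)).card := by
  rw [← Finset.card_range (e + 1), ← Finset.card_product]
  refine Finset.card_le_card_of_injOn (fun x => π ^ x.1 * star π ^ (e - x.1) * x.2) ?_ ?_
  · rintro ⟨i, w⟩ h
    simp only [Finset.coe_product, Set.mem_prod, Finset.mem_coe, Finset.mem_range] at h
    simp only [Finset.mem_coe]
    rw [mem_gaussianCircle, Zsqrtd.norm_mul, Zsqrtd.norm_mul, mem_gaussianCircle.1 h.2]
    have hpow : ∀ (x : GaussianInt) (k : ℕ), (x ^ k).norm = x.norm ^ k := fun x k =>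
      map_pow Zsqrtd.normMonoidHom x k
    rw [hpow, hpow, Zsqrtd.norm_conj, hπ, ← pow_add, Nat.add_sub_cancel' (by omega)]
    push_cast
    rfl
  · rintro ⟨i, w⟩ h ⟨i', w'⟩ h' heq
    simp only [Finset.coe_product, Set.mem_prod, Finset.mem_coe, Finset.mem_range] at h h' heq
    rcases le_total i i' with hle | hle
    · obtain ⟨h1, h2⟩ := GaussianInt.pow_mul_pow_mul_injective hp hp1 hπ hpm (by omega) h.2 hle heq
      rw [h1, h2]
    · obtain ⟨h1, h2⟩ :=
        GaussianInt.pow_mul_pow_mul_injective hp hp1 hπ hpm (by omega) h'.2 hle heq.symm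
      rw [h1, h2]

/-- In a product of two points only the sum of the exponents of `π` matters, and it takes at most
`2e + 1` values. -/
theorem card_gaussianCircle_mul_self_le {π : GaussianInt} {p : ℕ} (hp : p.Prime)
    (hπ : π.norm = p) (m e : ℕ) :
    (gaussianCircle (p ^ e * m) * gaussianCircle (p ^ e * m)).card ≤
      (2 * e + 1) * (gaussianCircle m * gaussianCircle m).card := by
  rw [← Finset.card_range (2 * e + 1), ← Finset.card_product]
  refine Finset.card_le_card_of_surjOn (fun x => π ^ x.1 * star π ^ (2 * e - x.1) * x.2) ?_
  intro x hx
  obtain ⟨z, hz, z', hz', rfl⟩ := Finset.mem_mul.1 hx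
  obtain ⟨i, j, hij, w, hw, rfl⟩ := GaussianInt.exists_eq_pow_mul_pow_mul hp hπ m e z hz
  obtain ⟨i', j', hij', w', hw', rfl⟩ := GaussianInt.exists_eq_pow_mul_pow_mul hp hπ m e z' hz'
  refine ⟨(i + i', w * w'), ?_, ?_⟩
  · simp only [Finset.coe_product, Set.mem_prod, Finset.mem_coe, Finset.mem_range]
    exact ⟨by omega, Finset.mul_mem_mul hw hw'⟩
  · simp only
    rw [show 2 * e - (i + i') = j + j' by omega]
    ring

/-- There are few products of two Gaussian integers of norm `m`. -/
theorem card_gaussianCircle_mul_self_pow_three_le {m : ℕ} (hm : 0 < m) :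
    (gaussianCircle m * gaussianCircle m).card ^ 3 ≤ (gaussianCircle m).card ^ 5 := by
  induction m using Nat.strong_induction_on with
  | _ m ih =>
  rcases Finset.eq_empty_or_nonempty (gaussianCircle m) with h0 | hne
  · simp [h0]
  by_cases hm1 : m = 1
  · subst hm1
    have h1 : gaussianCircle 1 * gaussianCircle 1 ⊆ gaussianCircle 1 := by
      intro x hx
      obtain ⟨z, hz, w, hw, rfl⟩ := Finset.mem_mul.1 hx
      rw [mem_gaussianCircle] at hz hw ⊢
      rw [Zsqrtd.norm_mul, hz, hw]
      norm_num
    calc _ ≤ (gaussianCircle 1).card ^ 3 := Nat.pow_le_pow_left (Finset.card_le_card h1) 3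
      _ ≤ _ := Nat.pow_le_pow_right hne.card_pos (by norm_num)
  set p := m.minFac
  have hp : p.Prime := Nat.minFac_prime hm1
  have hpm : p ∣ m := Nat.minFac_dvd m
  by_cases hp1 : p % 4 = 1
  · have hfact : Fact p.Prime := ⟨hp⟩
    obtain ⟨a, b, hab⟩ := Nat.Prime.sq_add_sq (p := p) (by omega)
    have hπ : (⟨a, b⟩ : GaussianInt).norm = p := by
      rw [Zsqrtd.norm_def, ← hab]
      push_cast
      ring
    obtain ⟨e, m', hpm', hme⟩ := Nat.exists_eq_pow_mul_and_not_dvd hm.ne' p hp.ne_one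
    have hm'0 : 0 < m' := by
      rcases Nat.eq_zero_or_pos m' with h | h
      · rw [h] at hpm'; simp at hpm'
      · exact h
    have he : e ≠ 0 := by
      rintro rfl
      rw [pow_zero, one_mul] at hme
      exact hpm' (hme ▸ hpm)
    have hlt : m' < m := by
      rw [hme]
      exact lt_mul_of_one_lt_left hm'0 (Nat.one_lt_pow he hp.one_lt)
    have hD := card_gaussianCircle_mul_self_le hp hπ m' e
    have hN := succ_mul_card_gaussianCircle_le hp hp1 hπ hpm' e
    rw [← hme] at hD hN
    -- This local inequality dictates the exponents 3 and 5; the critical case is `e = 1`, where it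
    -- reads `27 ≤ 32`.
    have h35 : (2 * e + 1) ^ 3 ≤ (e + 1) ^ 5 := by
      obtain ⟨k, rfl⟩ := Nat.exists_eq_succ_of_ne_zero he
      have : (k.succ + 1) ^ 5 = (2 * k.succ + 1) ^ 3 +
          (k ^ 5 + 10 * k ^ 4 + 32 * k ^ 3 + 44 * k ^ 2 + 26 * k + 5) := by
        simp only [Nat.succ_eq_add_one]; ring
      omega
    calc _ ≤ ((2 * e + 1) * (gaussianCircle m' * gaussianCircle m').card) ^ 3 :=
          Nat.pow_le_pow_left hD 3
      _ = (2 * e + 1) ^ 3 * (gaussianCircle m' * gaussianCircle m').card ^ 3 := mul_pow _ _ _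
      _ ≤ (e + 1) ^ 5 * (gaussianCircle m').card ^ 5 := Nat.mul_le_mul h35 (ih m' hlt hm'0)
      _ = ((e + 1) * (gaussianCircle m').card) ^ 5 := (mul_pow _ _ _).symm
      _ ≤ _ := Nat.pow_le_pow_left hN 5
  · rcases gaussianCircle_dvd_or_isEmpty hp hpm hm hp1 with h0 | ⟨π, q, m', hq, hπ, hmq, hdvd⟩
    · rw [h0] at hne
      exact absurd hne (by simp)
    · have hm'0 : 0 < m' := by
        rcases Nat.eq_zero_or_pos m' with h | h
        · rw [h] at hmq; omega
        · exact h
      have hlt : m' < m := by rw [hmq]; nlinarith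
      rw [hmq] at hdvd
      have him := gaussianCircle_eq_image (by omega) hπ hdvd
      rw [← hmq] at him
      have hcard : (gaussianCircle m * gaussianCircle m).card ≤
          (gaussianCircle m' * gaussianCircle m').card := by
        refine Finset.card_le_card_of_surjOn (fun x => π * π * x) ?_
        intro x hx
        obtain ⟨z, hz, z', hz', rfl⟩ := Finset.mem_mul.1 hx
        rw [him] at hz hz'
        obtain ⟨w, hw, rfl⟩ := Finset.mem_image.1 hz
        obtain ⟨w', hw', rfl⟩ := Finset.mem_image.1 hz'
        exact ⟨w * w', Finset.mul_mem_mul hw hw', by ring⟩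
      have hπ0 : π ≠ 0 := by
        rintro rfl
        rw [Zsqrtd.norm_zero] at hπ
        omega
      have hcard' : (gaussianCircle m).card = (gaussianCircle m').card := by
        rw [him]
        exact Finset.card_image_of_injective _ (mul_right_injective₀ hπ0)
      rw [hcard']
      exact (Nat.pow_le_pow_left hcard 3).trans (ih m' hlt hm'0)

/-- The differences of lattice points on a circle point in few directions. -/
theorem exists_directions {m : ℕ} (hm : 0 < m) :
    ∃ Q : Finset ℂ, Q.card ^ 3 ≤ latticeCount m ^ 5 ∧ (∀ u ∈ Q, u.re ^ 2 + u.im ^ 2 = 1) ∧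
      ∀ μ ∈ latticeCircle m, ∀ ν ∈ latticeCircle m, ∃ u ∈ Q, ∃ c : ℝ,
        (μ 0 - ν 0 : ℝ) = c * u.re ∧ (μ 1 - ν 1 : ℝ) = c * u.im := by
  classical
  have hm0 : (m : ℂ) ≠ 0 := by exact_mod_cast hm.ne'
  -- For `|z|² = |w|² = m` one has `m(z - w)² = -|z - w|² zw`. A chosen square root of `-zw/m` is
  -- therefore the direction of `z - w` up to sign.
  have hroot : ∀ P : GaussianInt, ∃ u : ℂ, u ^ 2 = -(P : ℂ) / m := fun P =>
    IsAlgClosed.exists_pow_nat_eq _ (by norm_num)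
  choose f hf using hroot
  have hnorm : ∀ z ∈ gaussianCircle m, (z : ℂ) * (starRingEnd ℂ) z = m := by
    intro z hz
    rw [Complex.mul_conj, ← GaussianInt.intCast_complex_norm, mem_gaussianCircle.1 hz]
    simp
  refine ⟨(gaussianCircle m * gaussianCircle m).image f, ?_, ?_, ?_⟩
  · rw [← card_gaussianCircle]
    exact (Nat.pow_le_pow_left Finset.card_image_le 3).trans
      (card_gaussianCircle_mul_self_pow_three_le hm)
  · intro u hu
    obtain ⟨P, hP, rfl⟩ := Finset.mem_image.1 hu
    obtain ⟨z, hz, w, hw, rfl⟩ := Finset.mem_mul.1 hP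
    have h1 : (Complex.normSq (f (z * w)) : ℝ) ^ 2 = 1 := by
      rw [← map_pow, hf, map_div₀, Complex.normSq_neg, GaussianInt.toComplex_mul, map_mul,
        ← GaussianInt.intCast_real_norm, ← GaussianInt.intCast_real_norm,
        mem_gaussianCircle.1 hz, mem_gaussianCircle.1 hw, Complex.normSq_natCast]
      have : (m : ℝ) ≠ 0 := by exact_mod_cast hm.ne'
      push_cast
      field_simp
    have h2 : Complex.normSq (f (z * w)) = 1 := by
      have := Complex.normSq_nonneg (f (z * w))
      nlinarith
    rw [Complex.normSq_apply] at h2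
    linarith
  · intro μ hμ ν hν
    set z : GaussianInt := ⟨μ 0, μ 1⟩
    set w : GaussianInt := ⟨ν 0, ν 1⟩
    have hz : z ∈ gaussianCircle m := Finset.mem_image_of_mem _ hμ
    have hw : w ∈ gaussianCircle m := Finset.mem_image_of_mem _ hν
    refine ⟨f (z * w), Finset.mem_image_of_mem _ (Finset.mul_mem_mul hz hw), ?_⟩
    set u := f (z * w)
    have hu : u ^ 2 * m = -((z : ℂ) * w) := by
      rw [hf, div_mul_cancel₀ _ hm0, GaussianInt.toComplex_mul]
    set d : ℂ := (z : ℂ) - w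
    have hd : d ^ 2 = (‖d‖ : ℂ) ^ 2 * u ^ 2 := by
      have h3 : d ^ 2 * m = (‖d‖ : ℂ) ^ 2 * u ^ 2 * m := by
        rw [mul_assoc, hu, ← Complex.mul_conj']
        simp only [d, map_sub]
        have h1 := hnorm z hz
        have h2 := hnorm w hw
        linear_combination ((z : ℂ) - w) * (w : ℂ) * h1 - ((z : ℂ) - w) * (z : ℂ) * h2
      exact mul_right_cancel₀ hm0 h3
    have hd2 : d = ‖d‖ * u ∨ d = -(‖d‖ * u) := by
      rw [← mul_pow] at hd
      exact sq_eq_sq_iff_eq_or_eq_neg.1 hd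
    have hre : d.re = μ 0 - ν 0 := by simp [d, z, w, GaussianInt.toComplex_def]
    have him : d.im = μ 1 - ν 1 := by simp [d, z, w, GaussianInt.toComplex_def]
    rw [← hre, ← him]
    rcases hd2 with h | h
    · refine ⟨‖d‖, ?_, ?_⟩
      · nth_rewrite 1 [h]; simp
      · nth_rewrite 1 [h]; simp
    · refine ⟨-‖d‖, ?_, ?_⟩
      · nth_rewrite 1 [h]; simp
      · nth_rewrite 1 [h]; simp

end

/-! ### Exceptional intervals and separation of the frequencies. -/

/-- The points where the curve is nearly orthogonal to one of finitely many directions are covered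
by few short intervals. -/
theorem exists_cover_nearly_orthogonal {V : ℝ → Fin 2 → ℝ} {τ κ : ℝ} (hκ : 0 < κ)
    (htrans : ∀ u0 u1 : ℝ, u0 ^ 2 + u1 ^ 2 = 1 → ∀ s ∈ Icc (0 : ℝ) 1, ∀ t ∈ Icc (0 : ℝ) 1,
      |t - s| ≤ τ → |u0 * V s 0 + u1 * V s 1| ≤ 1 / 2 →
        κ * |t - s| ≤ |(u0 * V t 0 + u1 * V t 1) - (u0 * V s 0 + u1 * V s 1)|)
    {T : ℕ} (hT : 0 < T) (hTτ : 1 ≤ T * τ) (Q : Finset ℂ)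
    (hQ : ∀ u ∈ Q, u.re ^ 2 + u.im ^ 2 = 1) {η : ℝ} (hη : 0 < η) (hη2 : η ≤ 1 / 2) :
    ∃ l u : Fin (T * Q.card) → ℝ, (∀ i, 0 ≤ l i ∧ l i ≤ u i ∧ u i ≤ 1 ∧ u i - l i ≤ 4 * η / κ) ∧
      ∀ s ∈ Icc (0 : ℝ) 1, (∃ w ∈ Q, |w.re * V s 0 + w.im * V s 1| < η) →
        ∃ i, s ∈ Icc (l i) (u i) := by
  classical
  have hT0 : (0 : ℝ) < T := by exact_mod_cast hT
  have hpair : ∀ x : Fin T × Q, ∃ l u : ℝ, (0 ≤ l ∧ l ≤ u ∧ u ≤ 1 ∧ u - l ≤ 4 * η / κ) ∧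
      ∀ s ∈ Icc (0 : ℝ) 1, (x.1 : ℝ) ≤ s * T → s * T ≤ x.1 + 1 →
        |(x.2 : ℂ).re * V s 0 + (x.2 : ℂ).im * V s 1| < η → s ∈ Icc l u := by
    rintro ⟨j, w, hw⟩
    by_cases hex : ∃ s ∈ Icc (0 : ℝ) 1, (j : ℝ) ≤ s * T ∧ s * T ≤ j + 1 ∧
        |w.re * V s 0 + w.im * V s 1| < η
    · obtain ⟨s, hs, hs1, hs2, hs3⟩ := hex
      have h2 : 0 < 2 * η / κ := by positivity
      refine ⟨max 0 (s - 2 * η / κ), min 1 (s + 2 * η / κ), ⟨le_max_left _ _, ?_, min_le_left _ _,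
        ?_⟩, ?_⟩
      · exact max_le (le_min zero_le_one (by linarith [hs.1])) (le_min (by linarith [hs.2])
          (by linarith))
      · have h3 := le_max_right 0 (s - 2 * η / κ)
        have h4 := min_le_right 1 (s + 2 * η / κ)
        calc _ ≤ 2 * (2 * η / κ) := by linarith
          _ = _ := by ring
      · intro t ht ht1 ht2 ht3
        simp only at ht1 ht2 ht3
        have hts : |t - s| ≤ τ := by
          have h3 : |t - s| * T ≤ 1 := by
            rw [show |t - s| * T = |(t - s) * T| by rw [abs_mul, abs_of_pos hT0], abs_le]
            constructor <;> linarith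
          by_contra hcon
          push Not at hcon
          nlinarith
        have h4 := htrans w.re w.im (hQ w hw) s hs t ht hts (hs3.le.trans hη2)
        have h5 := abs_sub (w.re * V t 0 + w.im * V t 1) (w.re * V s 0 + w.im * V s 1)
        have h6 : |t - s| ≤ 2 * η / κ := by
          rw [le_div_iff₀ hκ]
          linarith
        rw [abs_le] at h6
        exact ⟨max_le ht.1 (by linarith), le_min ht.2 (by linarith)⟩
    -- A block without bad points gets a degenerate interval, which keeps the index set equal to
    -- `Fin (T * Q.card)`.
    · refine ⟨0, 0, ⟨le_rfl, le_rfl, zero_le_one, by rw [sub_zero]; positivity⟩, ?_⟩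
      intro s hs h1 h2 h3
      exact absurd ⟨s, hs, h1, h2, h3⟩ hex
  choose l u hlu hcov using hpair
  have hcard : Fintype.card (Fin T × Q) = T * Q.card := by
    rw [Fintype.card_prod, Fintype.card_fin, Fintype.card_coe]
  let e : Fin T × Q ≃ Fin (T * Q.card) := Fintype.equivFinOfCardEq hcard
  refine ⟨fun i => l (e.symm i), fun i => u (e.symm i), fun i => hlu _, ?_⟩
  rintro s hs ⟨w, hw, hsw⟩
  obtain ⟨j, hj1, hj2⟩ : ∃ j : Fin T, (j : ℝ) ≤ s * T ∧ s * T ≤ j + 1 := by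
    by_cases h1 : s = 1
    · subst h1
      refine ⟨⟨T - 1, by omega⟩, ?_, ?_⟩
      · simp only [one_mul, Nat.cast_le]; omega
      · simp only [one_mul]; norm_cast; omega
    · have hsT : s * T < T := by
        have : s < 1 := lt_of_le_of_ne hs.2 h1
        nlinarith
      have h0 : 0 ≤ s * T := mul_nonneg hs.1 hT0.le
      exact ⟨⟨⌊s * T⌋₊, (Nat.floor_lt h0).2 hsT⟩, Nat.floor_le h0, (Nat.lt_floor_add_one _).le⟩
  refine ⟨e (j, ⟨w, hw⟩), ?_⟩
  simp only [Equiv.symm_apply_apply]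
  exact hcov (j, ⟨w, hw⟩) s hs hj1 hj2 hsw

/-- Pigeonhole: among `k + 1` points with spacing `2ℓ`, no interval of length `ℓ` contains two. The
points run from `s` towards the farther end of `[0,1]`. -/
theorem exists_near_notMem_Icc {k : ℕ} (l u : Fin k → ℝ) {ℓ : ℝ} (hℓ : 0 < ℓ)
    (hlu : ∀ i, u i - l i ≤ ℓ) {s : ℝ} (hs : s ∈ Icc (0 : ℝ) 1) (hk : 2 * k * ℓ ≤ 1 / 2) :
    ∃ t ∈ Icc (0 : ℝ) 1, |t - s| ≤ 2 * k * ℓ ∧ ∀ i, t ∉ Icc (l i) (u i) := by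
  obtain ⟨σ, hσ, hσI⟩ : ∃ σ : ℝ, |σ| = 1 ∧ ∀ x, 0 ≤ x → x ≤ 1 / 2 → s + σ * x ∈ Icc (0 : ℝ) 1 := by
    rcases le_total s (1 / 2) with h | h
    · exact ⟨1, by simp, fun x h0 h1 => ⟨by linarith [hs.1], by linarith⟩⟩
    · exact ⟨-1, by simp, fun x h0 h1 => ⟨by linarith, by linarith [hs.2]⟩⟩
  by_contra! hcon
  have hp : ∀ i : Fin (k + 1), ∃ j, s + σ * (2 * i * ℓ) ∈ Icc (l j) (u j) := by
    intro i
    have hik : (i : ℝ) ≤ k := by exact_mod_cast Nat.lt_succ_iff.1 i.2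
    have h1 : 2 * (i : ℝ) * ℓ ≤ 2 * k * ℓ := by gcongr
    have h0 : 0 ≤ 2 * (i : ℝ) * ℓ := by positivity
    refine hcon _ (hσI _ h0 (h1.trans hk)) ?_
    rw [add_sub_cancel_left, abs_mul, hσ, one_mul, abs_of_nonneg h0]
    exact h1
  choose g hg using hp
  obtain ⟨i, i', hne, heq⟩ := Fintype.exists_ne_map_eq_of_card_lt g (by simp)
  have h1 := hg i
  have h2 := hg i'
  rw [← heq] at h2
  have h3 := hlu (g i)
  have h4 : |σ * (2 * i * ℓ) - σ * (2 * i' * ℓ)| ≤ ℓ := by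
    rw [abs_le]
    constructor <;> linarith [h1.1, h1.2, h2.1, h2.2]
  rw [← mul_sub, abs_mul, hσ, one_mul, ← sub_mul, abs_mul, abs_of_pos hℓ, ← mul_sub, abs_mul,
    abs_two] at h4
  have h5 : (1 : ℝ) ≤ |(i : ℝ) - i'| := by
    have : (1 : ℤ) ≤ |(i : ℤ) - i'| :=
      Int.one_le_abs (sub_ne_zero.2 (by exact_mod_cast fun h => hne (Fin.ext h)))
    exact_mod_cast this
  nlinarith

theorem le_abs_directionalFrequency_sub {m : ℕ} {Q : Finset ℂ}
    (hQ : ∀ u ∈ Q, u.re ^ 2 + u.im ^ 2 = 1)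
    (hdir : ∀ μ ∈ latticeCircle m, ∀ ν ∈ latticeCircle m, ∃ u ∈ Q, ∃ c : ℝ,
        (μ 0 - ν 0 : ℝ) = c * u.re ∧ (μ 1 - ν 1 : ℝ) = c * u.im)
    {M : ℝ} (hM : 0 < M)
    (hsep : ∀ μ ∈ latticeCircle m, ∀ ν ∈ latticeCircle m, μ ≠ ν →
      (m : ℝ) ≤ ((μ 0 - ν 0 : ℝ) ^ 2 + (μ 1 - ν 1 : ℝ) ^ 2) * M ^ 2)
    {η : ℝ} (hη : 0 < η) {v : Fin 2 → ℝ} (hv : ∀ u ∈ Q, η ≤ |u.re * v 0 + u.im * v 1|)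
    (μ : Fin 2 → ℤ) (hμ : μ ∈ latticeCircle m) (ν : Fin 2 → ℤ) (hν : ν ∈ latticeCircle m)
    (hne : μ ≠ ν) :
    η / M * torusFrequency m ≤ |directionalFrequency v μ - directionalFrequency v ν| := by
  obtain ⟨u, hu, c, hc0, hc1⟩ := hdir μ hμ ν hν
  have h1 := hsep μ hμ ν hν hne
  rw [hc0, hc1, show (c * u.re) ^ 2 + (c * u.im) ^ 2 = c ^ 2 * (u.re ^ 2 + u.im ^ 2) by ring,
    hQ u hu, mul_one, ← mul_pow, ← sq_abs] at h1
  have h2 : Real.sqrt m ≤ |c| * M := by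
    rw [Real.sqrt_le_iff]
    refine ⟨by positivity, h1.trans_eq ?_⟩
    rw [abs_mul, abs_of_pos hM]
  have h3 : directionalFrequency v μ - directionalFrequency v ν =
      2 * Real.pi * (c * (u.re * v 0 + u.im * v 1)) := by
    unfold directionalFrequency
    linear_combination 2 * Real.pi * v 0 * hc0 + 2 * Real.pi * v 1 * hc1
  rw [h3, abs_mul, abs_of_pos (by positivity : 0 < 2 * Real.pi), abs_mul]
  unfold torusFrequency
  calc η / M * (2 * Real.pi * Real.sqrt m) ≤ η / M * (2 * Real.pi * (|c| * M)) := by gcongr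
    _ = 2 * Real.pi * (|c| * η) := by field_simp
    _ ≤ _ := by
      gcongr
      exact hv u hu

/-! ### Zero counts in discs about the curve. -/

section

variable {U : Set ℂ} {Γ : ℂ → Fin 2 → ℂ} {m : ℕ} {a : (Fin 2 → ℤ) → ℂ} {r K : ℝ}

/-- Every short disc about the curve parameter contains few zeros. -/
theorem zeros_in_short_disc_le {V : ℝ → Fin 2 → ℝ} {τ κ : ℝ}
    (hU : IsOpen U) (hhol : DifferentiableOn ℂ Γ U)
    (hball : ∀ s ∈ Icc (0 : ℝ) 1, Metric.closedBall (s : ℂ) r ⊆ U)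
    (hΓ : ∀ s ∈ Icc (0 : ℝ) 1, HasUnitTaylor Γ r K s (V s)) (hκ : 0 < κ)
    (htrans : ∀ u0 u1 : ℝ, u0 ^ 2 + u1 ^ 2 = 1 → ∀ s ∈ Icc (0 : ℝ) 1, ∀ t ∈ Icc (0 : ℝ) 1,
      |t - s| ≤ τ → |u0 * V s 0 + u1 * V s 1| ≤ 1 / 2 →
        κ * |t - s| ≤ |(u0 * V t 0 + u1 * V t 1) - (u0 * V s 0 + u1 * V s 1)|)
    {T : ℕ} (hT : 0 < T) (hTτ : 1 ≤ T * τ) {Q : Finset ℂ}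
    (hQ : ∀ u ∈ Q, u.re ^ 2 + u.im ^ 2 = 1)
    (hdir : ∀ μ ∈ latticeCircle m, ∀ ν ∈ latticeCircle m, ∃ u ∈ Q, ∃ c : ℝ,
        (μ 0 - ν 0 : ℝ) = c * u.re ∧ (μ 1 - ν 1 : ℝ) = c * u.im)
    (hQN : Q.card ≤ latticeCount m ^ 2)
    {y : ℝ} (hy : 1 ≤ y) (hN : (latticeCount m : ℝ) ≤ y ^ 8)
    (hsep : ∀ μ ∈ latticeCircle m, ∀ ν ∈ latticeCircle m, μ ≠ ν →
      (m : ℝ) ≤ ((μ 0 - ν 0 : ℝ) ^ 2 + (μ 1 - ν 1 : ℝ) ^ 2) * (y ^ 9) ^ 2)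
    {c : ℝ} (hc : 0 < c) (hc1 : c ≤ 1 / 2) (hc2 : 16 * T * c ≤ κ * (r / 9))
    (h1 : 6 / c * y ^ 81 ≤ r / 9 * torusFrequency m)
    (h2 : 16 * K * (6 / c) ^ 2 * y ^ 122 ≤ torusFrequency m)
    (h3 : 4 * y ^ 32 ≤ torusFrequency m)
    (ha : ∑ μ ∈ latticeCircle m, ‖a μ‖ ^ 2 = 1) {s : ℝ} (hs : s ∈ Icc (0 : ℝ) 1) :
    {z ∈ Metric.closedBall (s : ℂ) (r / 18 / (latticeCount m : ℝ) ^ 3) |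
        complexifiedEigenfunction m a (Γ z) = 0}.Finite ∧
      ({z ∈ Metric.closedBall (s : ℂ) (r / 18 / (latticeCount m : ℝ) ^ 3) |
        complexifiedEigenfunction m a (Γ z) = 0}.ncard : ℝ) ≤
        (27 * K + 1) * (torusFrequency m / (latticeCount m : ℝ) ^ 3) := by
  set N : ℝ := ((latticeCount m : ℕ) : ℝ) with hNdef
  set ω := torusFrequency m with hω
  have hN1 : 1 ≤ N := Nat.one_le_cast.2 (latticeCount_pos_of_sum_eq_one ha)
  have hr : 0 < r := (hΓ s hs).pos
  have hr1 : r ≤ 1 := (hΓ s hs).le_one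
  have hK : 1 ≤ K := (hΓ s hs).one_le
  have hω0 : 0 < ω := lt_of_lt_of_le (by positivity) h3
  have hT0 : (0 : ℝ) < T := by exact_mod_cast hT
  -- At most `TN²` intervals of length `4η/κ` must be escaped by a move of at most `r/(18N³)`, so
  -- the threshold has to be of order `N⁻⁵`.
  set η := c / N ^ 5
  have hη : 0 < η := by positivity
  have hηc : η ≤ c := div_le_self hc.le (one_le_pow₀ hN1)
  obtain ⟨l, u, hlu, hcov⟩ := exists_cover_nearly_orthogonal hκ htrans hT hTτ Q hQ hη
    (hηc.trans hc1)
  have hcardQ : (Q.card : ℝ) ≤ N ^ 2 := by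
    rw [hNdef]
    exact_mod_cast hQN
  have hlen : 2 * ((T * Q.card : ℕ) : ℝ) * (4 * η / κ) ≤ r / 18 / N ^ 3 := by
    push_cast
    calc _ ≤ 2 * (T * N ^ 2) * (4 * η / κ) := by gcongr
      _ = (16 * T * c) / (2 * κ * N ^ 3) := by simp only [η]; field_simp; ring
      _ ≤ (κ * (r / 9)) / (2 * κ * N ^ 3) := by gcongr
      _ = _ := by field_simp; ring
  have hρ1 : r / 18 / N ^ 3 ≤ 1 / 2 := by
    rw [div_le_iff₀ (by positivity)]
    have : 1 ≤ N ^ 3 := one_le_pow₀ hN1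
    linarith
  obtain ⟨t, ht, hts, hgood⟩ := exists_near_notMem_Icc l u (by positivity : 0 < 4 * η / κ)
    (fun i => (hlu i).2.2.2) hs (hlen.trans hρ1)
  have hgood' : ∀ w ∈ Q, η ≤ |w.re * V t 0 + w.im * V t 1| := by
    intro w hw
    by_contra hcon
    obtain ⟨i, hi⟩ := hcov t ht ⟨w, hw, not_le.1 hcon⟩
    exact hgood i hi
  have hy0 : 0 < y := by linarith
  obtain ⟨x, hx0, hx, hF⟩ := exists_half_le_norm_tangentSum (hΓ t ht) ha hω0
    (by positivity : 0 < η / y ^ 9)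
    (le_abs_directionalFrequency_sub hQ hdir (by positivity : 0 < y ^ 9) hsep hη hgood')
  have hX : 5 * N / (η / y ^ 9) + 1 ≤ 6 / c * (N ^ 6 * y ^ 9) := by
    have h6 : 1 ≤ N ^ 6 * y ^ 9 :=
      one_le_mul_of_one_le_of_one_le (one_le_pow₀ hN1) (one_le_pow₀ hy)
    have h7 : 1 ≤ 1 / c := by rw [le_div_iff₀ hc]; linarith
    have h8 : 1 ≤ 1 / c * (N ^ 6 * y ^ 9) := one_le_mul_of_one_le_of_one_le h7 h6
    calc _ = 5 / c * (N ^ 6 * y ^ 9) + 1 := by simp only [η]; field_simp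
      _ ≤ 5 / c * (N ^ 6 * y ^ 9) + 1 / c * (N ^ 6 * y ^ 9) := by gcongr
      _ = _ := by ring
  have hxω : x * ω ≤ 6 / c * (N ^ 6 * y ^ 9) := hx.trans hX
  have hxρ : x ≤ r / 9 / N ^ 3 := by
    rw [le_div_iff₀ (by positivity), ← mul_le_mul_iff_left₀ hω0]
    calc x * N ^ 3 * ω = x * ω * N ^ 3 := by ring
      _ ≤ 6 / c * (N ^ 6 * y ^ 9) * N ^ 3 := by gcongr
      _ = 6 / c * (N ^ 9 * y ^ 9) := by ring
      _ ≤ 6 / c * ((y ^ 8) ^ 9 * y ^ 9) := by gcongr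
      _ = 6 / c * y ^ 81 := by ring
      _ ≤ _ := h1
  have herr : 4 * N * ω * K * x ^ 2 ≤ 1 / 4 := by
    have h8 : 16 * N * K * (x * ω) ^ 2 ≤ ω := by
      calc 16 * N * K * (x * ω) ^ 2 ≤ 16 * y ^ 8 * K * (6 / c * ((y ^ 8) ^ 6 * y ^ 9)) ^ 2 := by
            gcongr 16 * ?_ * K * ?_ ^ 2
            exact hxω.trans (by gcongr)
        _ = 16 * K * (6 / c) ^ 2 * y ^ 122 := by ring
        _ ≤ ω := h2
    have h9 : 16 * N * K * x ^ 2 * ω * ω ≤ 1 * ω := by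
      calc _ = 16 * N * K * (x * ω) ^ 2 := by ring
        _ ≤ _ := by rw [one_mul]; exact h8
    have h10 := le_of_mul_le_mul_right h9 hω0
    linarith
  have hmain := zeros_le_of_real_lower_bound hU hhol (hball t ht) (hΓ t ht) ha
    (R := r / 9 / N ^ 3) (β := 1 / 4) (x := x) (by positivity) (by
      have : r / 9 / N ^ 3 ≤ r / 9 := div_le_self (by positivity) (one_le_pow₀ hN1)
      linarith) (by rw [abs_of_nonneg hx0]; exact hxρ) (by norm_num) (by norm_num) herr
      (by linarith)
  have hsubset : {z ∈ Metric.closedBall (s : ℂ) (r / 18 / N ^ 3) |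
        complexifiedEigenfunction m a (Γ z) = 0} ⊆
      {z ∈ Metric.closedBall (t : ℂ) (r / 9 / N ^ 3) |
        complexifiedEigenfunction m a (Γ z) = 0} := by
    rintro z ⟨hz, hz0⟩
    refine ⟨?_, hz0⟩
    rw [Metric.mem_closedBall] at hz ⊢
    have h5 : dist (s : ℂ) t ≤ r / 18 / N ^ 3 := by
      rw [Complex.dist_of_im_eq (by simp), Complex.ofReal_re, Complex.ofReal_re, dist_comm,
        Real.dist_eq]
      exact hts.trans hlen
    calc dist z t ≤ dist z s + dist (s : ℂ) t := dist_triangle _ _ _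
      _ ≤ r / 18 / N ^ 3 + r / 18 / N ^ 3 := add_le_add hz h5
      _ = _ := by ring
  refine ⟨hmain.1.subset hsubset, ?_⟩
  have hnc := Set.ncard_le_ncard hsubset hmain.1
  refine (Nat.cast_le.2 hnc).trans (hmain.2.trans ?_)
  have hlog : Real.log (N / (1 / 4)) ≤ ω / N ^ 3 := by
    refine (Real.log_le_self (by positivity)).trans ?_
    rw [le_div_iff₀ (by positivity)]
    calc N / (1 / 4) * N ^ 3 = 4 * N ^ 4 := by ring
      _ ≤ 4 * (y ^ 8) ^ 4 := by gcongr
      _ = 4 * y ^ 32 := by ring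
      _ ≤ ω := h3
  have h27 : 27 * ω * K * (r / 9 / N ^ 3) ≤ 27 * K * (ω / N ^ 3) := by
    calc _ = 27 * K * (ω / N ^ 3) * (r / 9) := by ring
      _ ≤ 27 * K * (ω / N ^ 3) * 1 := by gcongr; linarith
      _ = _ := mul_one _
  linarith

/-- Away from nearly orthogonal directions, discs of radius `N⁷/λ` contain few zeros. -/
theorem zeros_in_good_disc_le {s : ℝ} {v : Fin 2 → ℝ}
    (hU : IsOpen U) (hhol : DifferentiableOn ℂ Γ U) (hball : Metric.closedBall (s : ℂ) r ⊆ U)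
    (hΓ : HasUnitTaylor Γ r K s v) {Q : Finset ℂ}
    (hQ : ∀ u ∈ Q, u.re ^ 2 + u.im ^ 2 = 1)
    (hdir : ∀ μ ∈ latticeCircle m, ∀ ν ∈ latticeCircle m, ∃ u ∈ Q, ∃ c : ℝ,
        (μ 0 - ν 0 : ℝ) = c * u.re ∧ (μ 1 - ν 1 : ℝ) = c * u.im)
    {y : ℝ} (hy : 1 ≤ y) (hN : (latticeCount m : ℝ) ≤ y ^ 8)
    (hsep : ∀ μ ∈ latticeCircle m, ∀ ν ∈ latticeCircle m, μ ≠ ν →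
      (m : ℝ) ≤ ((μ 0 - ν 0 : ℝ) ^ 2 + (μ 1 - ν 1 : ℝ) ^ 2) * (y ^ 9) ^ 2)
    {c : ℝ} (hc : 0 < c) (hc1 : c ≤ 1 / 2)
    (hgood : ∀ u ∈ Q, c / (latticeCount m : ℝ) ^ 3 ≤ |u.re * v 0 + u.im * v 1|)
    (hexp : Real.exp (y ^ 4 / 2) ≤ torusFrequency m)
    (h1 : 9 * y ^ 56 ≤ r * torusFrequency m)
    (h2 : 324 * K * y ^ 120 ≤ Real.exp (y ^ 4 / 4))
    (h3 : 6 / c * (Real.log (96 / c) + 41 * Real.log y) ≤ y / 16) (h4 : 32 ≤ y)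
    (ha : ∑ μ ∈ latticeCircle m, ‖a μ‖ ^ 2 = 1) :
    {z ∈ Metric.closedBall (s : ℂ) ((latticeCount m : ℝ) ^ 7 / torusFrequency m) |
        complexifiedEigenfunction m a (Γ z) = 0}.Finite ∧
      ({z ∈ Metric.closedBall (s : ℂ) ((latticeCount m : ℝ) ^ 7 / torusFrequency m) |
        complexifiedEigenfunction m a (Γ z) = 0}.ncard : ℝ) ≤
        (27 * K + 16) * (latticeCount m : ℝ) ^ 7 := by
  set N : ℝ := ((latticeCount m : ℕ) : ℝ) with hNdef
  set ω := torusFrequency m with hω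
  have hN1 : 1 ≤ N := Nat.one_le_cast.2 (latticeCount_pos_of_sum_eq_one ha)
  have hK : 1 ≤ K := hΓ.one_le
  have hω0 : 0 < ω := (Real.exp_pos _).trans_le hexp
  have hy0 : 0 < y := by linarith
  set R := N ^ 7 / ω
  have hR : 0 < R := by positivity
  have hRω : R * ω = N ^ 7 := div_mul_cancel₀ _ hω0.ne'
  have hRr : 9 * R ≤ r := by
    rw [← mul_le_mul_iff_left₀ hω0, mul_assoc, hRω]
    calc 9 * N ^ 7 ≤ 9 * (y ^ 8) ^ 7 := by gcongr
      _ = 9 * y ^ 56 := by ring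
      _ ≤ _ := h1
  -- `y⁴` plays the role of `log m`: `β` is a small negative power of `m`, still far above the
  -- linearisation error, which is `1/λ ≤ exp(-y⁴/2)` up to powers of `N`.
  set β := Real.exp (-(y ^ 4 / 8))
  have hβ0 : 0 < β := Real.exp_pos _
  have hβ1 : β ≤ 1 := Real.exp_le_one_iff.2 (by rw [neg_nonpos]; positivity)
  have hy4 : 32 ≤ y ^ 4 := h4.trans (le_self_pow₀ hy (by norm_num))
  have hβ4 : 4 ≤ Real.exp (y ^ 4 / 16) := by
    have := Real.add_one_le_exp (y ^ 4 / 16)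
    have h5 : (2 : ℝ) ≤ Real.exp 1 := by linarith [Real.add_one_le_exp (1 : ℝ)]
    calc (4 : ℝ) = 2 * 2 := by norm_num
      _ ≤ Real.exp 1 * Real.exp 1 := by gcongr
      _ = Real.exp 2 := by rw [← Real.exp_add]; norm_num
      _ ≤ _ := by gcongr; linarith
  have hβ4' : 4 * β ≤ 1 := by
    calc 4 * β ≤ Real.exp (y ^ 4 / 16) * Real.exp (-(y ^ 4 / 8)) := by gcongr
      _ = Real.exp (-(y ^ 4 / 16)) := by rw [← Real.exp_add]; congr 1; ring
      _ ≤ 1 := Real.exp_le_one_iff.2 (by rw [neg_nonpos]; positivity)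
  obtain ⟨x, hx0, hx, hF⟩ := exists_half_le_norm_tangentSum hΓ ha hω0
    (by positivity : 0 < c / N ^ 3 / y ^ 9)
    (le_abs_directionalFrequency_sub hQ hdir (by positivity : 0 < y ^ 9) hsep
      (by positivity : 0 < c / N ^ 3) hgood)
  have hX : 5 * N / (c / N ^ 3 / y ^ 9) + 1 ≤ 6 / c * (N ^ 4 * y ^ 9) := by
    have h6 : 1 ≤ N ^ 4 * y ^ 9 :=
      one_le_mul_of_one_le_of_one_le (one_le_pow₀ hN1) (one_le_pow₀ hy)
    have h7 : 1 ≤ 1 / c := by rw [le_div_iff₀ hc]; linarith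
    have h8 : 1 ≤ 1 / c * (N ^ 4 * y ^ 9) := one_le_mul_of_one_le_of_one_le h7 h6
    calc _ = 5 / c * (N ^ 4 * y ^ 9) + 1 := by field_simp
      _ ≤ 5 / c * (N ^ 4 * y ^ 9) + 1 / c * (N ^ 4 * y ^ 9) := by gcongr
      _ = _ := by ring
  set X := 6 / c * (N ^ 4 * y ^ 9)
  have hX0 : 0 < X := by positivity
  have hxω : x * ω ≤ X := hx.trans hX
  have hlower : ∃ x : ℝ, |x| ≤ R ∧ 2 * β ≤ ‖tangentSum m a (Γ s) v x‖ := by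
    -- Either the mean square point already lies within `N⁷/λ`, or `N³ ≤ (6/c)y⁹`. In the latter
    -- case `N = O(y³)`, and Turán's loss `(8q)^N = exp(O(y³ log y))` is affordable.
    by_cases hXN : X ≤ N ^ 7
    · refine ⟨x, ?_, by linarith⟩
      rw [abs_of_nonneg hx0, le_div_iff₀ hω0]
      exact hxω.trans hXN
    · push Not at hXN
      have hX1 : 1 ≤ X := (one_le_pow₀ hN1).trans hXN.le
      set q := ⌈X⌉₊
      have hqX : X ≤ q := Nat.le_ceil X
      have hq1 : 1 ≤ q := by exact_mod_cast hX1.trans hqX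
      have hq2 : (q : ℝ) ≤ 2 * X := by linarith [Nat.ceil_lt_add_one hX0.le]
      obtain ⟨x', hx'0, hx'R, hF'⟩ := exists_le_norm_tangentSum_of_long hΓ ha hq1 hx0
        (R := R) (by
          rw [← mul_le_mul_iff_left₀ hω0, mul_assoc, hRω]
          calc x * ω ≤ X := hxω
            _ ≤ q * 1 := by linarith
            _ ≤ q * N ^ 7 := by gcongr; exact one_le_pow₀ hN1) hF
      refine ⟨x', by rwa [abs_of_nonneg hx'0], le_trans ?_ hF'⟩
      have hN3 : N ^ 3 ≤ 6 / c * y ^ 9 := by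
        have : N ^ 4 * N ^ 3 ≤ N ^ 4 * (6 / c * y ^ 9) := by
          calc N ^ 4 * N ^ 3 = N ^ 7 := by ring
            _ ≤ X := hXN.le
            _ = _ := by ring
        exact le_of_mul_le_mul_left this (by positivity)
      have h6c : 1 ≤ 6 / c := by rw [le_div_iff₀ hc]; linarith
      have hNy : N ≤ 6 / c * y ^ 3 := by
        refine le_of_pow_le_pow_left₀ (n := 3) (by norm_num) (by positivity) (hN3.trans ?_)
        calc 6 / c * y ^ 9 ≤ (6 / c) ^ 3 * y ^ 9 := by
              gcongr
              exact le_self_pow₀ h6c (by norm_num)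
          _ = _ := by ring
      have hXy : 8 * (q : ℝ) ≤ 96 / c * y ^ 41 := by
        calc 8 * (q : ℝ) ≤ 8 * (2 * X) := by gcongr
          _ = 96 / c * (N ^ 4 * y ^ 9) := by ring
          _ ≤ 96 / c * ((y ^ 8) ^ 4 * y ^ 9) := by gcongr
          _ = _ := by ring
      have hlog0 : 0 ≤ Real.log (96 / c) + 41 * Real.log y := by
        have h9 : 0 ≤ Real.log y := Real.log_nonneg hy
        have h10 : 0 ≤ Real.log (96 / c) := Real.log_nonneg (by rw [le_div_iff₀ hc]; linarith)
        linarith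
      have hpow : (8 * q : ℝ) ^ latticeCount m ≤ Real.exp (y ^ 4 / 16) := by
        calc (8 * q : ℝ) ^ latticeCount m
            ≤ (Real.exp (Real.log (96 / c) + 41 * Real.log y)) ^ latticeCount m := by
              gcongr
              refine hXy.trans_eq ?_
              rw [Real.exp_add, Real.exp_log (by positivity), mul_comm (41 : ℝ),
                Real.exp_mul, Real.exp_log hy0]
              norm_cast
          _ = Real.exp (N * (Real.log (96 / c) + 41 * Real.log y)) := by
              rw [← Real.exp_nat_mul]
          _ ≤ Real.exp (y ^ 4 / 16) := by
              gcongr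
              calc _ ≤ 6 / c * y ^ 3 * (Real.log (96 / c) + 41 * Real.log y) := by gcongr
                _ = y ^ 3 * (6 / c * (Real.log (96 / c) + 41 * Real.log y)) := by ring
                _ ≤ y ^ 3 * (y / 16) := by gcongr
                _ = _ := by ring
      have hP : 0 < (8 * q : ℝ) ^ latticeCount m := by positivity
      rw [← one_div, le_div_iff₀ (by positivity)]
      calc 2 * β * (2 * (8 * q : ℝ) ^ latticeCount m)
          = 4 * (8 * q : ℝ) ^ latticeCount m * β := by ring
        _ ≤ Real.exp (y ^ 4 / 16) * Real.exp (y ^ 4 / 16) * Real.exp (-(y ^ 4 / 8)) := by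
            gcongr
        _ = Real.exp 0 := by rw [← Real.exp_add, ← Real.exp_add]; congr 1; ring
        _ = 1 := Real.exp_zero
  obtain ⟨x₁, hx₁, hF₁⟩ := hlower
  have hinv : 1 / ω ≤ Real.exp (-(y ^ 4 / 2)) := by
    rw [Real.exp_neg, ← one_div]
    gcongr
  have hN15 : N ^ 15 ≤ y ^ 120 := by
    calc N ^ 15 ≤ (y ^ 8) ^ 15 := by gcongr
      _ = _ := by ring
  -- For small `N` the growth `exp(9N⁷)` of the error off the real axis is affordable, and the
  -- doubling argument removes `β`. Otherwise `log(1/β) = y⁴/8` is itself below `9N⁷`, so the direct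
  -- count suffices.
  by_cases hcase : 9 * N ^ 7 ≤ y ^ 4 / 8
  · have hmain := zeros_le_of_complex_lower_bound hU hhol hball hΓ ha hR hRr hx₁ hβ0 hβ1 ?_ hF₁
    · refine ⟨hmain.1, hmain.2.trans ?_⟩
      have h5 : Real.log (4 * 72 ^ latticeCount m) ≤ 2 + N * 5 := by
        rw [Real.log_le_iff_le_exp (by positivity), Real.exp_add, Real.exp_nat_mul]
        have h2e : (2.7 : ℝ) ≤ Real.exp 1 := by linarith [Real.exp_one_gt_d9]
        have e2 : (4 : ℝ) ≤ Real.exp 2 := by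
          rw [show (2 : ℝ) = (2 : ℕ) * 1 by norm_num, Real.exp_nat_mul]
          calc (4 : ℝ) ≤ 2.7 ^ 2 := by norm_num
            _ ≤ _ := by gcongr
        have e5 : (72 : ℝ) ≤ Real.exp 5 := by
          rw [show (5 : ℝ) = (5 : ℕ) * 1 by norm_num, Real.exp_nat_mul]
          calc (72 : ℝ) ≤ 2.7 ^ 5 := by norm_num
            _ ≤ _ := by gcongr
        gcongr
      have h6 : N ≤ N ^ 7 := le_self_pow₀ hN1 (by norm_num)
      have h7 : 9 * ω * R = 9 * N ^ 7 := by rw [← hRω]; ring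
      rw [h7]
      nlinarith
    · have h7 : 9 * ω * R = 9 * N ^ 7 := by rw [← hRω]; ring
      rw [h7]
      calc N * (Real.exp (9 * N ^ 7) * (4 * ω * K * (9 * R) ^ 2))
          = 324 * K * N ^ 15 * Real.exp (9 * N ^ 7) * (1 / ω) := by
            simp only [R]; field_simp; ring
        _ ≤ 324 * K * y ^ 120 * Real.exp (y ^ 4 / 8) * Real.exp (-(y ^ 4 / 2)) := by gcongr
        _ ≤ Real.exp (y ^ 4 / 4) * Real.exp (y ^ 4 / 8) * Real.exp (-(y ^ 4 / 2)) := by gcongr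
        _ = β := by rw [← Real.exp_add, ← Real.exp_add]; congr 1; ring
  · push Not at hcase
    have hmain := zeros_le_of_real_lower_bound hU hhol hball hΓ ha hR hRr hx₁ hβ0 hβ1 ?_ hF₁
    · refine ⟨hmain.1, hmain.2.trans ?_⟩
      have h5 : Real.log (N / β) ≤ N ^ 7 + 9 * N ^ 7 := by
        rw [Real.log_div (by positivity) hβ0.ne', Real.log_exp]
        have h6 : N ≤ N ^ 7 := le_self_pow₀ hN1 (by norm_num)
        have := Real.log_le_self (by positivity : 0 ≤ N)
        linarith
      have h7 : 27 * ω * K * R = 27 * K * N ^ 7 := by rw [← hRω]; ring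
      rw [h7]
      have : 0 < N ^ 7 := by positivity
      linarith
    · calc 4 * N * ω * K * x₁ ^ 2 ≤ 4 * N * ω * K * R ^ 2 := by
            gcongr 4 * N * ω * K * ?_
            rw [← sq_abs]
            gcongr
        _ = 4 * K * N ^ 15 * (1 / ω) := by simp only [R]; field_simp
        _ ≤ 324 * K * y ^ 120 * Real.exp (-(y ^ 4 / 2)) := by gcongr; norm_num
        _ ≤ Real.exp (y ^ 4 / 4) * Real.exp (-(y ^ 4 / 2)) := by gcongr
        _ = Real.exp (-(y ^ 4 / 4)) := by rw [← Real.exp_add]; congr 1; ring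
        _ ≤ β := by
            apply Real.exp_le_exp.2
            linarith [hy4]

end

/-! ### Assembly for a single `m` with well separated lattice points. -/

theorem toralEigenfunction_toTorus {γ : ℝ → EuclideanSpace ℝ (Fin 2)} {U : Set ℂ}
    {Γ : ℂ → Fin 2 → ℂ} (hγ : IsAnalyticCurvedArc γ U Γ) (m : ℕ) (a : (Fin 2 → ℤ) → ℂ) {t : ℝ}
    (ht : t ∈ Icc (0 : ℝ) 1) :
    toralEigenfunction m a (toTorus (γ t)) = complexifiedEigenfunction m a (Γ t) := by
  unfold toralEigenfunction complexifiedEigenfunction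
  refine Finset.sum_congr rfl fun μ _ => ?_
  congr 1
  simp only [UnitAddTorus.mFourier, ContinuousMap.coe_mk, toTorus, fourier_coe_apply,
    Fin.prod_univ_two, Fin.sum_univ_two, hγ.extends_curve t ht]
  rw [← Complex.exp_add]
  congr 1
  push_cast
  ring

theorem torus_zeros_le_of_cover {γ : ℝ → EuclideanSpace ℝ (Fin 2)} {U : Set ℂ}
    {Γ : ℂ → Fin 2 → ℂ} (hγ : IsAnalyticCurvedArc γ U Γ) {m : ℕ} {a : (Fin 2 → ℤ) → ℂ} {G : ℕ}
    (σ : Fin G → ℝ) {ρ B : ℝ}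
    (hσ : ∀ g, {z ∈ Metric.closedBall (σ g : ℂ) ρ |
        complexifiedEigenfunction m a (Γ z) = 0}.Finite ∧
      ({z ∈ Metric.closedBall (σ g : ℂ) ρ |
        complexifiedEigenfunction m a (Γ z) = 0}.ncard : ℝ) ≤ B)
    {k : ℕ} {l u : Fin k → ℝ} (hlu : ∀ i, 0 ≤ l i ∧ u i ≤ 1)
    (hcov : ∀ i, ∀ t ∈ Icc (l i) (u i), ∃ g, |t - σ g| ≤ ρ) :
    ({x | toralEigenfunction m a x = 0} ∩
        ⋃ i, (fun t => toTorus (γ t)) '' Icc (l i) (u i)).Finite ∧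
      ((({x | toralEigenfunction m a x = 0} ∩
        ⋃ i, (fun t => toTorus (γ t)) '' Icc (l i) (u i)).ncard : ℕ) : ℝ) ≤ G * B := by
  set Z : Fin G → Set ℂ := fun g =>
    {z ∈ Metric.closedBall (σ g : ℂ) ρ | complexifiedEigenfunction m a (Γ z) = 0}
  set φ : ℂ → UnitAddTorus (Fin 2) := fun z => toTorus (γ z.re)
  have hsub : ({x | toralEigenfunction m a x = 0} ∩
      ⋃ i, (fun t => toTorus (γ t)) '' Icc (l i) (u i)) ⊆ ⋃ g, φ '' Z g := by
    rintro x ⟨hx, hx'⟩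
    obtain ⟨i, t, ht, rfl⟩ := mem_iUnion.1 hx'
    obtain ⟨g, hg⟩ := hcov i t ht
    refine mem_iUnion.2 ⟨g, t, ⟨?_, ?_⟩, by simp [φ]⟩
    · rw [mem_closedBall_iff_norm, ← Complex.ofReal_sub, Complex.norm_real]
      exact hg
    · rw [← toralEigenfunction_toTorus hγ m a ⟨(hlu i).1.trans ht.1, ht.2.trans (hlu i).2⟩]
      exact hx
  have hfin : (⋃ g, φ '' Z g).Finite := finite_iUnion fun g => (hσ g).1.image φ
  refine ⟨hfin.subset hsub, ?_⟩
  calc _ ≤ (((⋃ g, φ '' Z g).ncard : ℕ) : ℝ) := Nat.cast_le.2 (ncard_le_ncard hsub hfin)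
    _ ≤ ((∑ g, (φ '' Z g).ncard : ℕ) : ℝ) := Nat.cast_le.2 (ncard_iUnion_le_of_fintype _)
    _ = ∑ g, ((φ '' Z g).ncard : ℝ) := by push_cast; rfl
    _ ≤ ∑ _g : Fin G, B := Finset.sum_le_sum fun g _ =>
        (Nat.cast_le.2 (ncard_image_le (hσ g).1)).trans (hσ g).2
    _ = G * B := by simp

theorem eventually_mul_pow_le_exp (A : ℝ) (k : ℕ) :
    ∀ᶠ y : ℝ in atTop, A * y ^ k ≤ Real.exp (y ^ 4 / 4) := by
  have h := (isLittleO_pow_exp_pos_mul_atTop k (by norm_num : (0 : ℝ) < 1 / 4)).bound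
    (by positivity : 0 < (|A| + 1)⁻¹)
  filter_upwards [h, eventually_ge_atTop 1] with y hy hy1
  rw [Real.norm_eq_abs, Real.norm_eq_abs, abs_of_pos (Real.exp_pos _),
    abs_of_nonneg (by positivity), inv_mul_eq_div, le_div_iff₀ (by positivity)] at hy
  calc A * y ^ k ≤ y ^ k * (|A| + 1) := by
        have : A ≤ |A| + 1 := by linarith [le_abs_self A]
        rw [mul_comm]
        gcongr
    _ ≤ Real.exp (1 / 4 * y) := hy
    _ ≤ _ := by
        gcongr
        linarith [le_self_pow₀ hy1 (by norm_num : 4 ≠ 0)]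

theorem eventually_mul_log_le (A B : ℝ) :
    ∀ᶠ y : ℝ in atTop, A * (B + 41 * Real.log y) ≤ y / 16 := by
  have h1 : (fun y : ℝ => A * (B + 41 * Real.log y)) =o[atTop] (fun y => y) := by
    refine Asymptotics.IsLittleO.const_mul_left ?_ A
    exact (Asymptotics.isLittleO_const_id_atTop B).add
      (Real.isLittleO_log_id_atTop.const_mul_left 41)
  filter_upwards [h1.bound (by norm_num : (0 : ℝ) < 1 / 16), eventually_ge_atTop 0] with y hy hy0
  rw [Real.norm_eq_abs, Real.norm_eq_abs, abs_of_nonneg hy0] at hy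
  linarith [le_abs_self (A * (B + 41 * Real.log y))]

/-- The conclusion of the main theorem for those `m` whose lattice points are well separated and
not too many. -/
theorem IsAnalyticCurvedArc.exists_intervals {γ : ℝ → EuclideanSpace ℝ (Fin 2)} {U : Set ℂ}
    {Γ : ℂ → Fin 2 → ℂ} (hγ : IsAnalyticCurvedArc γ U Γ) :
    ∃ C : ℝ, 0 < C ∧ ∀ᶠ y : ℝ in atTop, ∀ m : ℕ, 0 < m → 1 ≤ latticeCount m →
      Real.exp (y ^ 4 / 2) ≤ torusFrequency m → (latticeCount m : ℝ) ≤ y ^ 8 →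
      (∀ μ ∈ latticeCircle m, ∀ ν ∈ latticeCircle m, μ ≠ ν →
        (m : ℝ) ≤ ((μ 0 - ν 0 : ℝ) ^ 2 + (μ 1 - ν 1 : ℝ) ^ 2) * (y ^ 9) ^ 2) →
      ∃ (k : ℕ) (l u : Fin k → ℝ),
        k ≤ latticeCount m ^ 2 ∧
        (∀ i, 0 ≤ l i ∧ l i ≤ u i ∧ u i ≤ 1 ∧
          u i - l i ≤ C * ((latticeCount m : ℝ) ^ 3)⁻¹) ∧
        ∀ a : (Fin 2 → ℤ) → ℂ, ∑ μ ∈ latticeCircle m, ‖a μ‖ ^ 2 = 1 →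
          (({x | toralEigenfunction m a x = 0} ∩
              ⋃ i, (fun t => toTorus (γ t)) '' Icc (l i) (u i)).Finite ∧
            ((({x | toralEigenfunction m a x = 0} ∩
              ⋃ i, (fun t => toTorus (γ t)) '' Icc (l i) (u i)).ncard : ℕ) : ℝ) ≤
                C * (torusFrequency m / latticeCount m)) ∧
          ∀ s ∈ Icc (0 : ℝ) 1 \ ⋃ i, Icc (l i) (u i),
            Metric.ball (s : ℂ) ((latticeCount m : ℝ) ^ 7 / torusFrequency m) ⊆ U ∧
            {z ∈ Metric.ball (s : ℂ) ((latticeCount m : ℝ) ^ 7 / torusFrequency m) |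
              complexifiedEigenfunction m a (Γ z) = 0}.Finite ∧
            (({z ∈ Metric.ball (s : ℂ) ((latticeCount m : ℝ) ^ 7 / torusFrequency m) |
              complexifiedEigenfunction m a (Γ z) = 0}.ncard : ℕ) : ℝ) ≤
                C * (latticeCount m : ℝ) ^ 7 := by
  obtain ⟨r, K, τ, κ, V, hr, hr1, hK, hτ, hκ, hball, htaylor, hunit, htrans⟩ := hγ.exists_velocity
  have hΓ : ∀ s ∈ Icc (0 : ℝ) 1, HasUnitTaylor Γ r K s (V s) := fun s hs =>
    ⟨hr, hr1, hK, fun j => by rw [hγ.extends_curve s hs j, Complex.ofReal_im], htaylor s hs,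
      hunit s hs⟩
  set T := ⌈τ⁻¹⌉₊
  have hT : 0 < T := Nat.ceil_pos.2 (inv_pos.2 hτ)
  have hTτ : 1 ≤ T * τ := by
    rw [← inv_mul_cancel₀ hτ.ne']
    gcongr
    exact Nat.le_ceil _
  have hT0 : (0 : ℝ) < T := by exact_mod_cast hT
  have hT1 : (1 : ℝ) ≤ T := by exact_mod_cast hT
  -- `c₁` makes each exceptional interval fit in one disc of radius `r/(18N³)`; `c₂` is the constant
  -- required by `zeros_in_short_disc_le`.
  set c₁ := min (1 / 2) (κ * r / 144)
  have hc₁ : 0 < c₁ := by positivity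
  have hc₁' : c₁ ≤ 1 / 2 := min_le_left _ _
  set c₂ := min (1 / 2) (κ * r / (144 * T))
  have hc₂ : 0 < c₂ := by positivity
  have hc₂' : c₂ ≤ 1 / 2 := min_le_left _ _
  have hc₂'' : 16 * T * c₂ ≤ κ * (r / 9) := by
    have := min_le_right (1 / 2) (κ * r / (144 * T))
    rw [le_div_iff₀ (by positivity)] at this
    linarith
  have hr60 : 60 ≤ 60 / r := by rw [le_div_iff₀ hr]; linarith
  have hT9 : (1 : ℝ) ≤ (T : ℝ) ^ 9 := one_le_pow₀ hT1
  refine ⟨(27 * K + 16) * (T : ℝ) ^ 9 * (60 / r), by positivity, ?_⟩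
  filter_upwards [eventually_ge_atTop 32, eventually_mul_pow_le_exp (9 / r * (6 / c₂)) 81,
    eventually_mul_pow_le_exp (16 * K * (6 / c₂) ^ 2) 122, eventually_mul_pow_le_exp 4 32,
    eventually_mul_pow_le_exp (9 / r) 56, eventually_mul_pow_le_exp (324 * K) 120,
    eventually_mul_log_le (6 / c₁) (Real.log (96 / c₁))] with
    y hy32 hy1 hy2 hy3 hy4 hy5 hy6 m hm hN1 hexp hN hsep
  have hy : 1 ≤ y := by linarith
  have hexp' : Real.exp (y ^ 4 / 4) ≤ torusFrequency m := by
    refine le_trans (Real.exp_le_exp.2 ?_) hexp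
    have : 0 ≤ y ^ 4 := by positivity
    linarith
  obtain ⟨Q, hQcard, hQ, hdir⟩ := exists_directions hm
  have hQN : Q.card ≤ latticeCount m ^ 2 := by
    refine (Nat.pow_le_pow_iff_left (by norm_num : 3 ≠ 0)).1 (hQcard.trans ?_)
    rw [← pow_mul]
    exact Nat.pow_le_pow_right hN1 (by norm_num)
  have hrω : ∀ A : ℝ, 9 / r * A ≤ torusFrequency m → A ≤ r / 9 * torusFrequency m := by
    intro A hA
    calc A = r / 9 * (9 / r * A) := by field_simp
      _ ≤ _ := by gcongr
  set N : ℝ := ((latticeCount m : ℕ) : ℝ) with hNdef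
  have hN1' : 1 ≤ N := Nat.one_le_cast.2 hN1
  set ω := torusFrequency m
  have hω0 : 0 < ω := (Real.exp_pos _).trans_le hexp
  have hshort := fun (a : (Fin 2 → ℤ) → ℂ) (ha : ∑ μ ∈ latticeCircle m, ‖a μ‖ ^ 2 = 1)
      (s : ℝ) (hs : s ∈ Icc (0 : ℝ) 1) =>
    zeros_in_short_disc_le hγ.isOpen hγ.holomorphic hball hΓ hκ htrans hT hTτ hQ hdir hQN hy hN
      hsep hc₂ hc₂' hc₂'' (hrω _ (by rw [← mul_assoc]; exact hy1.trans hexp')) (hy2.trans hexp')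
      (hy3.trans hexp') ha hs
  have hω3 : 0 ≤ ω / N ^ 3 := by positivity
  have hC1 : 27 * K + 16 ≤ (27 * K + 16) * (T : ℝ) ^ 9 * (60 / r) := by
    rw [mul_assoc]
    exact le_mul_of_one_le_right (by positivity)
      (one_le_mul_of_one_le_of_one_le hT9 (by linarith))
  -- With `N^(5/3)` directions the number of intervals is at most `TN^(5/3)`, which is at most `N²`
  -- once `T ≤ N^(1/3)`. For the remaining bounded `N` the single interval `[0,1]` is allowed; its
  -- length costs the factor `T⁹` in `C`.
  by_cases hTN : T ^ 3 ≤ latticeCount m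
  · obtain ⟨l, u, hlu, hcov⟩ := exists_cover_nearly_orthogonal hκ htrans hT hTτ Q hQ
      (by positivity : 0 < c₁ / N ^ 3)
      ((div_le_self hc₁.le (one_le_pow₀ hN1')).trans hc₁')
    have hk : T * Q.card ≤ latticeCount m ^ 2 := by
      refine (Nat.pow_le_pow_iff_left (by norm_num : 3 ≠ 0)).1 ?_
      calc (T * Q.card) ^ 3 = T ^ 3 * Q.card ^ 3 := mul_pow _ _ _
        _ ≤ latticeCount m * latticeCount m ^ 5 := Nat.mul_le_mul hTN hQcard
        _ = _ := by ring
    have hlen : 4 * (c₁ / N ^ 3) / κ ≤ r / 18 / N ^ 3 := by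
      have h5 : c₁ ≤ κ * r / 144 := min_le_right _ _
      calc _ = 4 * c₁ / (κ * N ^ 3) := by field_simp
        _ ≤ 4 * (κ * r / 144) / (κ * N ^ 3) := by gcongr
        _ = r / 36 / N ^ 3 := by field_simp; ring
        _ ≤ _ := by gcongr; norm_num
    refine ⟨T * Q.card, l, u, hk, fun i => ⟨(hlu i).1, (hlu i).2.1, (hlu i).2.2.1, ?_⟩,
      fun a ha => ⟨?_, ?_⟩⟩
    · refine ((hlu i).2.2.2.trans hlen).trans ?_
      rw [div_eq_mul_inv]
      gcongr
      linarith
    -- Each interval lies in the short disc centred at its left endpoint.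
    · have hz := torus_zeros_le_of_cover hγ l (fun g => hshort a ha (l g)
        ⟨(hlu g).1, (hlu g).2.1.trans (hlu g).2.2.1⟩) (l := l) (u := u)
        (fun i => ⟨(hlu i).1, (hlu i).2.2.1⟩) (fun i t ht => ⟨i, by
          rw [abs_of_nonneg (by linarith [ht.1])]
          linarith [ht.2, (hlu i).2.2.2]⟩)
      refine ⟨hz.1, hz.2.trans ?_⟩
      have hk' : ((T * Q.card : ℕ) : ℝ) ≤ N ^ 2 := by
        rw [hNdef]
        exact_mod_cast hk
      calc _ ≤ N ^ 2 * ((27 * K + 1) * (ω / N ^ 3)) := by gcongr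
        _ = (27 * K + 1) * (ω / N) := by field_simp
        _ ≤ _ := by
            gcongr
            linarith
    · rintro s ⟨hs, hsn⟩
      have hgood : ∀ w ∈ Q, c₁ / N ^ 3 ≤ |w.re * V s 0 + w.im * V s 1| := by
        intro w hw
        by_contra hcon
        obtain ⟨i, hi⟩ := hcov s hs ⟨w, hw, not_le.1 hcon⟩
        exact hsn (mem_iUnion.2 ⟨i, hi⟩)
      have h56 : 9 * y ^ 56 ≤ r * ω := by
        have := hy4.trans hexp'
        rw [div_mul_eq_mul_div, div_le_iff₀ hr] at this
        linarith
      have hz := zeros_in_good_disc_le hγ.isOpen hγ.holomorphic (hball s hs) (hΓ s hs) hQ hdir hy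
        hN hsep hc₁ hc₁' hgood hexp h56 hy5 hy6 hy32 ha
      have hsub : {z ∈ Metric.ball (s : ℂ) (N ^ 7 / ω) |
            complexifiedEigenfunction m a (Γ z) = 0} ⊆
          {z ∈ Metric.closedBall (s : ℂ) (N ^ 7 / ω) |
            complexifiedEigenfunction m a (Γ z) = 0} := fun z hz =>
        ⟨Metric.ball_subset_closedBall hz.1, hz.2⟩
      refine ⟨?_, hz.1.subset hsub, ?_⟩
      · refine Metric.ball_subset_closedBall.trans ((Metric.closedBall_subset_closedBall ?_).trans
          (hball s hs))
        rw [div_le_iff₀ hω0]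
        calc N ^ 7 ≤ (y ^ 8) ^ 7 := by gcongr
          _ = y ^ 56 := by ring
          _ ≤ 9 * y ^ 56 := by
              have : 0 ≤ y ^ 56 := by positivity
              linarith
          _ ≤ _ := h56
      · refine (Nat.cast_le.2 (ncard_le_ncard hsub hz.1)).trans (hz.2.trans ?_)
        gcongr
  · have hNT : N ≤ (T : ℝ) ^ 3 := by
      rw [hNdef]
      exact_mod_cast (not_le.1 hTN).le
    have hN3 : N ^ 3 ≤ (T : ℝ) ^ 9 := by
      calc N ^ 3 ≤ ((T : ℝ) ^ 3) ^ 3 := by gcongr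
        _ = _ := by ring
    refine ⟨1, fun _ => 0, fun _ => 1, Nat.one_le_pow _ _ hN1,
      fun _ => ⟨le_rfl, zero_le_one, le_rfl, ?_⟩, fun a ha => ⟨?_, ?_⟩⟩
    · rw [sub_zero, ← div_eq_mul_inv, le_div_iff₀ (by positivity), one_mul]
      refine hN3.trans ?_
      rw [mul_comm (27 * K + 16), mul_assoc]
      exact le_mul_of_one_le_right (by positivity)
        (one_le_mul_of_one_le_of_one_le (by linarith) (by linarith))
    -- Enough equally spaced centres `g/G` for the short discs to cover all of `[0,1]`; `t = 1` is
    -- assigned to the last one.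
    · set G := ⌈18 * N ^ 3 / r⌉₊
      have hG : 0 < G := Nat.ceil_pos.2 (by positivity)
      have hG0 : (0 : ℝ) < G := by exact_mod_cast hG
      have hG1 : 18 * N ^ 3 / r ≤ G := Nat.le_ceil _
      have hN31 : 1 ≤ N ^ 3 / r := by
        rw [le_div_iff₀ hr]
        have := one_le_pow₀ hN1' (n := 3)
        linarith
      have hG2 : (G : ℝ) ≤ 19 * (N ^ 3 / r) := by
        have := Nat.ceil_lt_add_one (by positivity : 0 ≤ 18 * N ^ 3 / r)
        have h2 : 18 * N ^ 3 / r = 18 * (N ^ 3 / r) := by ring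
        linarith
      have hGρ : 1 / (G : ℝ) ≤ r / 18 / N ^ 3 := by
        rw [div_le_iff₀ hG0]
        calc (1 : ℝ) = r / 18 / N ^ 3 * (18 * N ^ 3 / r) := by field_simp
          _ ≤ _ := by gcongr
      have hz := torus_zeros_le_of_cover hγ (fun g : Fin G => (g : ℝ) / G) (fun g =>
        hshort a ha ((g : ℝ) / G) ⟨by positivity, by
          rw [div_le_one hG0]
          exact_mod_cast g.2.le⟩) (l := fun _ : Fin 1 => 0) (u := fun _ => 1)
        (fun i => ⟨le_rfl, le_rfl⟩) (fun i t ht => by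
          have hpos : 0 ≤ t * G := mul_nonneg ht.1 hG0.le
          by_cases ht1 : t = 1
          · refine ⟨⟨G - 1, by omega⟩, le_trans (le_of_eq ?_) hGρ⟩
            simp only
            rw [ht1, Nat.cast_sub hG, Nat.cast_one, show (1 : ℝ) - (G - 1) / G = 1 / G by
              field_simp; ring, abs_of_pos (by positivity)]
          · have hlt : t * G < G := by
              have : t < 1 := lt_of_le_of_ne ht.2 ht1
              nlinarith
            refine ⟨⟨⌊t * G⌋₊, (Nat.floor_lt hpos).2 hlt⟩, le_trans ?_ hGρ⟩
            simp only
            have h5 := Nat.floor_le hpos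
            have h6 := (Nat.lt_floor_add_one (t * G)).le
            rw [show t - (⌊t * G⌋₊ : ℝ) / G = (t * G - ⌊t * G⌋₊) / G by field_simp,
              abs_of_nonneg (div_nonneg (by linarith) hG0.le)]
            gcongr
            linarith)
      refine ⟨hz.1, hz.2.trans ?_⟩
      calc (G : ℝ) * ((27 * K + 1) * (ω / N ^ 3)) ≤
            19 * (N ^ 3 / r) * ((27 * K + 1) * (ω / N ^ 3)) := by gcongr
        _ = (27 * K + 1) * N * (19 / r) * (ω / N) := by field_simp
        _ ≤ (27 * K + 16) * (T : ℝ) ^ 9 * (60 / r) * (ω / N) := by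
            have h39 : (T : ℝ) ^ 3 ≤ (T : ℝ) ^ 9 := pow_le_pow_right₀ hT1 (by norm_num)
            gcongr
            · norm_num
            · exact hNT.trans h39
            · norm_num
    · rintro s ⟨hs, hsn⟩
      exact absurd (mem_iUnion.2 ⟨0, hs⟩) hsn

/-! ### Statistics of lattice points on circles, for almost all `m`. -/

/-- Solutions of `ab = cd` with `a ≠ 0`, `|c| ≤ |a| ≤ H` and `|d| ≤ Y`, as quadruples
`(a, c, b, d)`. -/
theorem card_le_of_forall_mul_eq_mul {H Y : ℕ} (hHY : H ≤ Y) (A : Finset (ℤ × ℤ × ℤ × ℤ))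
    (hA : ∀ x ∈ A, x.1 ≠ 0 ∧ x.2.1.natAbs ≤ x.1.natAbs ∧ x.1.natAbs ≤ H ∧ x.2.2.2.natAbs ≤ Y ∧
      x.1 * x.2.2.1 = x.2.1 * x.2.2.2) :
    (A.card : ℝ) ≤ 18 * H * Y * (1 + Real.log H) := by
  classical
  set B : Finset (Σ _ : ℕ, Σ _ : ℤ, ℤ × ℤ) := (Finset.Icc 1 H).sigma fun g =>
    ((Finset.Icc (-((H / g : ℕ) : ℤ)) ((H / g : ℕ) : ℤ)).erase 0).sigma fun k =>
      (Finset.Icc (-(k.natAbs : ℤ)) (k.natAbs : ℤ)) ×ˢ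
        (Finset.Icc (-((Y / k.natAbs : ℕ) : ℤ)) ((Y / k.natAbs : ℕ) : ℤ))
  have hIcc : ∀ (n : ℕ) (i : ℤ), i ∈ Finset.Icc (-(n : ℤ)) (n : ℤ) ↔ i.natAbs ≤ n := by
    intro n i
    rw [Finset.mem_Icc]
    omega
  have hsurj : A.card ≤ B.card := by
    refine Finset.card_le_card_of_surjOn
      (fun p => ((p.1 : ℤ) * p.2.1, (p.1 : ℤ) * p.2.2.1, p.2.2.1 * p.2.2.2, p.2.1 * p.2.2.2)) ?_
    rintro ⟨a, c, b, d⟩ hx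
    obtain ⟨ha0, hca, haH, hdY, heq⟩ := hA _ hx
    simp only at ha0 hca haH hdY heq
    -- With `g = gcd(a, c)` the solutions are `a = ga'`, `c = gc'`, `b = c't`, `d = a't`. The pairs
    -- `(c', t)` number at most `9Y` for each `a'`, and the sum over `g` gives the logarithm.
    have hg0 : 0 < Int.gcd a c := Int.gcd_pos_of_ne_zero_left c ha0
    obtain ⟨a', c', hcop, ha', hc'⟩ := Int.exists_gcd_one hg0
    set g := Int.gcd a c
    have hgz : (g : ℤ) ≠ 0 := by exact_mod_cast hg0.ne'
    have ha'0 : a' ≠ 0 := by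
      rintro rfl
      rw [zero_mul] at ha'
      exact ha0 ha'
    have heq' : a' * b = c' * d := by
      rw [ha', hc'] at heq
      apply mul_left_cancel₀ hgz
      linear_combination heq
    obtain ⟨t, rfl⟩ : a' ∣ d := by
      have h1 : a' ∣ d * c' := ⟨b, by rw [heq', mul_comm]⟩
      exact (Int.isCoprime_iff_gcd_eq_one.2 hcop).dvd_of_dvd_mul_right h1
    have hb : b = c' * t := mul_left_cancel₀ ha'0 (by rw [heq']; ring)
    have haabs : a.natAbs = a'.natAbs * g := by rw [ha', Int.natAbs_mul, Int.natAbs_natCast]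
    have hcabs : c.natAbs = c'.natAbs * g := by rw [hc', Int.natAbs_mul, Int.natAbs_natCast]
    have ha'1 : 0 < a'.natAbs := Int.natAbs_pos.2 ha'0
    refine ⟨⟨g, a', c', t⟩, ?_, ?_⟩
    · simp only [B, Finset.coe_sigma, Finset.mem_coe, Set.mem_sigma_iff, Finset.mem_erase,
        Finset.mem_product, hIcc, Finset.mem_Icc]
      refine ⟨⟨hg0, ?_⟩, ⟨ha'0, ?_⟩, ?_, ?_⟩
      · rw [haabs] at haH
        exact (Nat.le_mul_of_pos_left g ha'1).trans haH
      · rw [Nat.le_div_iff_mul_le hg0, ← haabs]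
        exact haH
      · rw [haabs, hcabs] at hca
        exact Nat.le_of_mul_le_mul_right hca hg0
      · rw [Nat.le_div_iff_mul_le ha'1, mul_comm, ← Int.natAbs_mul]
        exact hdY
    · simp only [Prod.mk.injEq]
      exact ⟨by rw [ha', mul_comm], by rw [hc', mul_comm], hb.symm, trivial⟩
  have hcard : ∀ n : ℕ, (Finset.Icc (-(n : ℤ)) (n : ℤ)).card = 2 * n + 1 := by
    intro n
    rw [Int.card_Icc]
    omega
  have hB : B.card ≤ ∑ g ∈ Finset.Icc 1 H, 18 * Y * (H / g) := by
    rw [Finset.card_sigma]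
    refine Finset.sum_le_sum fun g hg => ?_
    rw [Finset.card_sigma]
    have hterm : ∀ k ∈ (Finset.Icc (-((H / g : ℕ) : ℤ)) ((H / g : ℕ) : ℤ)).erase 0,
        ((Finset.Icc (-(k.natAbs : ℤ)) (k.natAbs : ℤ)) ×ˢ
        (Finset.Icc (-((Y / k.natAbs : ℕ) : ℤ)) ((Y / k.natAbs : ℕ) : ℤ))).card ≤ 9 * Y := by
      intro k hk
      rw [Finset.mem_erase, hIcc] at hk
      have hk0 : 0 < k.natAbs := Int.natAbs_pos.2 hk.1
      have hkY : k.natAbs ≤ Y := hk.2.trans ((Nat.div_le_self H g).trans hHY)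
      rw [Finset.card_product, hcard, hcard]
      have h1 : 1 ≤ Y / k.natAbs := (Nat.one_le_div_iff hk0).2 hkY
      calc (2 * k.natAbs + 1) * (2 * (Y / k.natAbs) + 1)
          ≤ (3 * k.natAbs) * (3 * (Y / k.natAbs)) := Nat.mul_le_mul (by omega) (by omega)
        _ = 9 * (k.natAbs * (Y / k.natAbs)) := by ring
        _ ≤ 9 * Y := Nat.mul_le_mul_left 9 (Nat.mul_div_le Y k.natAbs)
    refine (Finset.sum_le_card_nsmul _ _ _ hterm).trans ?_
    rw [Finset.card_erase_of_mem (by rw [hIcc]; simp), hcard, smul_eq_mul]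
    exact le_of_eq (by rw [Nat.add_sub_cancel]; ring)
  have hH : ∑ g ∈ Finset.Icc 1 H, ((H / g : ℕ) : ℝ) ≤ H * (1 + Real.log H) := by
    have h1 := harmonic_le_one_add_log H
    rw [harmonic_eq_sum_Icc] at h1
    push_cast at h1
    calc _ ≤ ∑ g ∈ Finset.Icc 1 H, (H : ℝ) * (g : ℝ)⁻¹ := Finset.sum_le_sum fun g _ => by
          rw [← div_eq_mul_inv]
          exact Nat.cast_div_le
      _ = H * ∑ g ∈ Finset.Icc 1 H, (g : ℝ)⁻¹ := by rw [Finset.mul_sum]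
      _ ≤ _ := by gcongr
  calc (A.card : ℝ) ≤ ((∑ g ∈ Finset.Icc 1 H, 18 * Y * (H / g) : ℕ) : ℝ) :=
        Nat.cast_le.2 (hsurj.trans hB)
    _ = 18 * Y * ∑ g ∈ Finset.Icc 1 H, ((H / g : ℕ) : ℝ) := by
        push_cast
        rw [Finset.mul_sum]
    _ ≤ 18 * Y * (H * (1 + Real.log H)) := by gcongr
    _ = _ := by ring

/-- The pairs of distinct lattice points on a circle whose coordinates differ by at most `H`. -/
noncomputable def closePairs (m H : ℕ) : Finset ((Fin 2 → ℤ) × (Fin 2 → ℤ)) :=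
  (latticeCircle m ×ˢ latticeCircle m).filter fun p =>
    p.1 ≠ p.2 ∧ ∀ j, (p.1 j - p.2 j).natAbs ≤ H

theorem natAbs_le_sqrt_of_mem {m x : ℕ} (hmx : m ≤ x) {μ : Fin 2 → ℤ} (hμ : μ ∈ latticeCircle m)
    (j : Fin 2) : (μ j).natAbs ≤ Nat.sqrt x := by
  rw [Nat.le_sqrt']
  have h := mem_latticeCircle.1 hμ
  zify
  rw [sq_abs]
  have hmx' : (m : ℤ) ≤ x := by exact_mod_cast hmx
  fin_cases j
  · simp only [Fin.zero_eta]; nlinarith [sq_nonneg (μ 1)]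
  · simp only [Fin.mk_one]; nlinarith [sq_nonneg (μ 0)]

/-- Equality of norms factors as `(μ₁ - ν₁)(μ₁ + ν₁) = (ν₂ - μ₂)(ν₂ + μ₂)`. The pairs are split by
which difference is larger, and that one serves as the nonzero `a`. -/
theorem sum_card_closePairs_le {x H : ℕ} (hH : H ≤ 2 * Nat.sqrt x) :
    ((∑ m ∈ Finset.Icc 1 x, (closePairs m H).card : ℕ) : ℝ) ≤
      72 * H * Nat.sqrt x * (1 + Real.log H) := by
  classical
  rw [← Finset.card_sigma]
  set P := (Finset.Icc 1 x).sigma fun m => closePairs m H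
  let f : (Σ _ : ℕ, (Fin 2 → ℤ) × (Fin 2 → ℤ)) → ℤ × ℤ × ℤ × ℤ := fun p =>
    (p.2.1 0 - p.2.2 0, p.2.2 1 - p.2.1 1, p.2.1 0 + p.2.2 0, p.2.2 1 + p.2.1 1)
  let f' : (Σ _ : ℕ, (Fin 2 → ℤ) × (Fin 2 → ℤ)) → ℤ × ℤ × ℤ × ℤ := fun p =>
    (p.2.2 1 - p.2.1 1, p.2.1 0 - p.2.2 0, p.2.2 1 + p.2.1 1, p.2.1 0 + p.2.2 0)
  have hP : ∀ p ∈ P, (p.2.1 0 ^ 2 + p.2.1 1 ^ 2 = (p.1 : ℤ) ∧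
      p.2.2 0 ^ 2 + p.2.2 1 ^ 2 = (p.1 : ℤ)) ∧ p.2.1 ≠ p.2.2 ∧
      (∀ j, (p.2.1 j - p.2.2 j).natAbs ≤ H) ∧ ∀ j, (p.2.1 j).natAbs ≤ Nat.sqrt x ∧
        (p.2.2 j).natAbs ≤ Nat.sqrt x := by
    rintro ⟨m, μ, ν⟩ hp
    simp only [P, closePairs, Finset.mem_sigma, Finset.mem_filter, Finset.mem_product,
      Finset.mem_Icc] at hp
    exact ⟨⟨mem_latticeCircle.1 hp.2.1.1, mem_latticeCircle.1 hp.2.1.2⟩, hp.2.2.1, hp.2.2.2,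
      fun j => ⟨natAbs_le_sqrt_of_mem hp.1.2 hp.2.1.1 j, natAbs_le_sqrt_of_mem hp.1.2 hp.2.1.2 j⟩⟩
  have hinj : ∀ p ∈ P, ∀ q ∈ P, p.2.1 0 - p.2.2 0 = q.2.1 0 - q.2.2 0 →
      p.2.2 1 - p.2.1 1 = q.2.2 1 - q.2.1 1 → p.2.1 0 + p.2.2 0 = q.2.1 0 + q.2.2 0 →
      p.2.2 1 + p.2.1 1 = q.2.2 1 + q.2.1 1 → p = q := by
    rintro ⟨m, μ, ν⟩ hp ⟨m', μ', ν'⟩ hq h1 h2 h3 h4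
    simp only at h1 h2 h3 h4
    have e1 : μ = μ' := by
      ext j; fin_cases j
      · simp only [Fin.zero_eta]; omega
      · simp only [Fin.mk_one]; omega
    have e2 : ν = ν' := by
      ext j; fin_cases j
      · simp only [Fin.zero_eta]; omega
      · simp only [Fin.mk_one]; omega
    subst e1 e2
    have h5 := (hP _ hp).1.1
    have h6 := (hP _ hq).1.1
    simp only at h5 h6
    have e3 : m = m' := by
      have : (m : ℤ) = m' := by rw [← h5, ← h6]
      exact_mod_cast this
    rw [e3]
  set P₁ := P.filter fun p => (p.2.2 1 - p.2.1 1).natAbs ≤ (p.2.1 0 - p.2.2 0).natAbs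
  set P₂ := P.filter fun p => ¬ (p.2.2 1 - p.2.1 1).natAbs ≤ (p.2.1 0 - p.2.2 0).natAbs
  have hsplit : P₁.card + P₂.card = P.card := Finset.card_filter_add_card_filter_not _
  have h1 : (P₁.card : ℝ) ≤ 18 * H * (2 * Nat.sqrt x : ℕ) * (1 + Real.log H) := by
    rw [← Finset.card_image_of_injOn (f := f) (s := P₁) (fun p hp q hq h => by
      simp only [f, Prod.mk.injEq] at h
      exact hinj p (Finset.mem_filter.1 hp).1 q (Finset.mem_filter.1 hq).1 h.1 h.2.1 h.2.2.1
        h.2.2.2)]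
    refine card_le_of_forall_mul_eq_mul hH _ fun y hy => ?_
    obtain ⟨p, hp, rfl⟩ := Finset.mem_image.1 hy
    obtain ⟨hp, hle⟩ := Finset.mem_filter.1 hp
    obtain ⟨⟨hm1, hm2⟩, hne, hHj, hX⟩ := hP p hp
    have hH0 := hHj 0
    have hX1 := hX 1
    simp only [f]
    refine ⟨fun h0 => hne ?_, hle, hH0, by omega, by linear_combination hm1 - hm2⟩
    have h5 : p.2.2 1 - p.2.1 1 = 0 := by
      rw [h0] at hle
      simpa using hle
    ext j; fin_cases j
    · simp only [Fin.zero_eta]; omega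
    · simp only [Fin.mk_one]; omega
  have h2 : (P₂.card : ℝ) ≤ 18 * H * (2 * Nat.sqrt x : ℕ) * (1 + Real.log H) := by
    rw [← Finset.card_image_of_injOn (f := f') (s := P₂) (fun p hp q hq h => by
      simp only [f', Prod.mk.injEq] at h
      exact hinj p (Finset.mem_filter.1 hp).1 q (Finset.mem_filter.1 hq).1 h.2.1 h.1 h.2.2.2
        h.2.2.1)]
    refine card_le_of_forall_mul_eq_mul hH _ fun y hy => ?_
    obtain ⟨p, hp, rfl⟩ := Finset.mem_image.1 hy
    obtain ⟨hp, hle⟩ := Finset.mem_filter.1 hp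
    obtain ⟨⟨hm1, hm2⟩, hne, hHj, hX⟩ := hP p hp
    have hH1 := hHj 1
    have hX0 := hX 0
    simp only [f']
    exact ⟨by omega, by omega, by omega, by omega, by linear_combination hm2 - hm1⟩
  rw [← hsplit]
  push_cast at h1 h2 ⊢
  linarith

theorem sum_latticeCount_le (x : ℕ) :
    ∑ m ∈ Finset.Icc 1 x, latticeCount m ≤ (2 * Nat.sqrt x + 1) ^ 2 := by
  classical
  have hbox : ∑ m ∈ Finset.Icc 1 x, latticeCount m ≤ (Fintype.piFinset fun _ : Fin 2 =>
      Finset.Icc (-(Nat.sqrt x : ℤ)) (Nat.sqrt x : ℤ)).card := by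
    unfold latticeCount
    rw [← Finset.card_biUnion]
    · refine Finset.card_le_card fun μ hμ => ?_
      obtain ⟨m, hm, hμ⟩ := Finset.mem_biUnion.1 hμ
      rw [Fintype.mem_piFinset]
      intro j
      have := natAbs_le_sqrt_of_mem (Finset.mem_Icc.1 hm).2 hμ j
      rw [Finset.mem_Icc]
      omega
    · intro m _ m' _ hne
      rw [Function.onFun, Finset.disjoint_left]
      intro μ h1 h2
      apply hne
      rw [mem_latticeCircle] at h1 h2
      exact_mod_cast h1.symm.trans h2
  refine hbox.trans_eq ?_
  rw [Fintype.card_piFinset_const, Int.card_Icc]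
  congr 1
  omega

/-- At the scale `2√x` every pair of distinct points is close, so the close pair count also controls
the second moment of `N`. -/
theorem latticeCount_sq_le {m x : ℕ} (hmx : m ≤ x) :
    latticeCount m ^ 2 ≤ latticeCount m + (closePairs m (2 * Nat.sqrt x)).card := by
  classical
  unfold latticeCount
  rw [sq, ← Finset.card_product, ← Finset.diag_card (latticeCircle m)]
  refine (Finset.card_le_card ?_).trans (Finset.card_union_le _ _)
  rintro ⟨μ, ν⟩ h
  rw [Finset.mem_union]
  by_cases hne : μ = ν
  · left
    subst hne
    exact Finset.mem_diag.2 ⟨(Finset.mem_product.1 h).1, rfl⟩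
  · right
    refine Finset.mem_filter.2 ⟨h, hne, fun j => ?_⟩
    have h1 := natAbs_le_sqrt_of_mem hmx (Finset.mem_product.1 h).1 j
    have h2 := natAbs_le_sqrt_of_mem hmx (Finset.mem_product.1 h).2 j
    simp only at h1 h2 ⊢
    omega

theorem sum_latticeCount_sq_le {x : ℕ} (hx : 4 ≤ x) :
    ((∑ m ∈ Finset.Icc 1 x, latticeCount m ^ 2 : ℕ) : ℝ) ≤ 297 * x * Real.log x := by
  set X := Nat.sqrt x
  have hX2 : 2 ≤ X := by rw [Nat.le_sqrt]; omega
  have hXX : X * X ≤ x := Nat.sqrt_le x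
  have h1 : ∑ m ∈ Finset.Icc 1 x, latticeCount m ^ 2 ≤ (2 * X + 1) ^ 2 +
      ∑ m ∈ Finset.Icc 1 x, (closePairs m (2 * X)).card := by
    refine le_trans ?_ (Nat.add_le_add_right (sum_latticeCount_le x) _)
    rw [← Finset.sum_add_distrib]
    exact Finset.sum_le_sum fun m hm => latticeCount_sq_le (Finset.mem_Icc.1 hm).2
  have h2 := sum_card_closePairs_le (x := x) (H := 2 * X) le_rfl
  have hx0 : (4 : ℝ) ≤ x := by exact_mod_cast hx
  have hlog1 : 1 ≤ Real.log x := by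
    rw [Real.le_log_iff_exp_le (by linarith)]
    linarith [Real.exp_one_lt_d9]
  have hXx : (2 * X : ℝ) ≤ x := by
    have : 2 * X ≤ x := (Nat.mul_le_mul_right X hX2).trans hXX
    exact_mod_cast this
  have hX0 : (2 : ℝ) ≤ X := by exact_mod_cast hX2
  have hlog : Real.log (2 * X) ≤ Real.log x := Real.log_le_log (by linarith) hXx
  have hXX' : (X : ℝ) * X ≤ x := by exact_mod_cast hXX
  have h3 : ((∑ m ∈ Finset.Icc 1 x, latticeCount m ^ 2 : ℕ) : ℝ) ≤ (2 * X + 1) ^ 2 +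
      72 * (2 * X) * X * (1 + Real.log (2 * X)) := by
    refine (Nat.cast_le.2 h1).trans ?_
    push_cast at h2 ⊢
    linarith
  have h4 : (2 * (X : ℝ) + 1) ^ 2 ≤ 9 * x * Real.log x := by
    have h5 : (2 * (X : ℝ) + 1) ^ 2 ≤ 9 * x := by nlinarith
    have h6 : (9 * x : ℝ) ≤ 9 * x * Real.log x := le_mul_of_one_le_right (by linarith) hlog1
    linarith
  have h5 : 72 * (2 * (X : ℝ)) * X * (1 + Real.log (2 * X)) ≤ 288 * x * Real.log x := by
    calc 72 * (2 * (X : ℝ)) * X * (1 + Real.log (2 * X))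
        = 144 * (X * X) * (1 + Real.log (2 * X)) := by ring
      _ ≤ 144 * x * (Real.log x + Real.log x) := by
          have := Real.log_nonneg (by linarith : (1 : ℝ) ≤ 2 * X)
          gcongr
      _ = _ := by ring
  linarith

theorem sumsOfTwoSquaresUpTo_finite (x : ℕ) : (sumsOfTwoSquaresUpTo x).Finite :=
  (Finset.finite_toSet (Finset.Icc 1 x)).subset fun _ hm =>
    Finset.mem_coe.2 (Finset.mem_Icc.2 ⟨hm.1, hm.2.1⟩)

theorem one_le_latticeCount_of_mem {m x : ℕ} (hm : m ∈ sumsOfTwoSquaresUpTo x) :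
    1 ≤ latticeCount m := by
  obtain ⟨-, -, p, q, h⟩ := hm
  refine Finset.card_pos.2 ⟨![p, q], mem_latticeCircle.2 ?_⟩
  rw [h]
  simp

/-- A lower bound for the number of sums of two squares. -/
theorem le_ncard_sumsOfTwoSquaresUpTo_mul_log {x : ℕ} (hx : 4 ≤ x) :
    (x : ℝ) ≤ 76032 * (sumsOfTwoSquaresUpTo x).ncard * Real.log x := by
  classical
  set S := (sumsOfTwoSquaresUpTo_finite x).toFinset
  have hS : ∀ m, m ∈ S ↔ m ∈ sumsOfTwoSquaresUpTo x := fun m => Finite.mem_toFinset _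
  have hSsub : S ⊆ Finset.Icc 1 x := fun m hm => by
    have := (hS m).1 hm
    exact Finset.mem_Icc.2 ⟨this.1, this.2.1⟩
  set Z := Nat.sqrt (x / 2)
  have hZ1 : 1 ≤ Z := by rw [Nat.le_sqrt]; omega
  have hZle : Z * Z ≤ x / 2 := Nat.sqrt_le _
  have hZlt : x / 2 < (Z + 1) * (Z + 1) := Nat.lt_succ_sqrt _
  have hlow : Z * Z ≤ ∑ m ∈ S, latticeCount m := by
    unfold latticeCount
    rw [← Finset.card_sigma]
    have hc : (Finset.Icc 1 Z ×ˢ Finset.Icc 1 Z).card = Z * Z := by simp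
    rw [← hc]
    refine Finset.card_le_card_of_injOn
      (fun p => ⟨p.1 ^ 2 + p.2 ^ 2, ![(p.1 : ℤ), (p.2 : ℤ)]⟩) ?_ ?_
    · rintro ⟨p, q⟩ hpq
      simp only [Finset.coe_product, Finset.coe_Icc, Set.mem_prod, Set.mem_Icc] at hpq
      simp only [Finset.mem_coe, Finset.mem_sigma, hS]
      refine ⟨⟨?_, ?_, p, q, rfl⟩, mem_latticeCircle.2 (by simp)⟩
      · nlinarith
      · have h1 : p ^ 2 ≤ Z * Z := by nlinarith
        have h2 : q ^ 2 ≤ Z * Z := by nlinarith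
        omega
    · rintro ⟨p, q⟩ _ ⟨p', q'⟩ _ h
      simp only [Sigma.mk.injEq, heq_eq_eq] at h
      have h0 := congrFun h.2 0
      have h1 := congrFun h.2 1
      simp at h0 h1
      rw [h0, h1]
  -- Cauchy–Schwarz: the first moment is at least `x/16` and the second at most `297 x log x`,
  -- whence `76032 = 16² · 297`. This is weaker than Landau's asymptotics but sufficient.
  have hcs := sq_sum_le_card_mul_sum_sq (s := S) (f := fun m => (latticeCount m : ℝ))
  have hsq : ∑ m ∈ S, (latticeCount m : ℝ) ^ 2 ≤ 297 * x * Real.log x := by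
    refine le_trans ?_ (sum_latticeCount_sq_le hx)
    push_cast
    exact Finset.sum_le_sum_of_subset_of_nonneg hSsub fun _ _ _ => by positivity
  have hZx : (x : ℝ) ≤ 16 * (Z * Z) := by
    have : x ≤ 16 * (Z * Z) := by
      have h1 : (Z + 1) * (Z + 1) ≤ 4 * (Z * Z) := by nlinarith
      omega
    exact_mod_cast this
  have hlow' : (Z * Z : ℝ) ≤ ∑ m ∈ S, (latticeCount m : ℝ) := by exact_mod_cast hlow
  have hx0 : (0 : ℝ) < x := by
    have : 0 < x := by omega
    exact_mod_cast this
  rw [ncard_eq_toFinset_card _ (sumsOfTwoSquaresUpTo_finite x)]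
  change (x : ℝ) ≤ 76032 * S.card * Real.log x
  have h1 : (x / 16 : ℝ) ^ 2 ≤ S.card * (297 * x * Real.log x) := by
    calc (x / 16 : ℝ) ^ 2 ≤ (∑ m ∈ S, (latticeCount m : ℝ)) ^ 2 := by
          gcongr
          linarith
      _ ≤ _ := hcs
      _ ≤ _ := by gcongr
  have h2 : (x : ℝ) * x ≤ x * (76032 * S.card * Real.log x) := by nlinarith
  exact le_of_mul_le_mul_left h2 hx0

/-- The three terms account for `m ≤ √x`, for large `N` (Chebyshev with the second moment), and for
circles with a close pair. For the other `m`, `log m ≥ (log x)/2`, so `y = (log m)^(1/4)` is at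
least `z/2`; this is the origin of `256 = 2⁸` and `512 = 2⁹`. -/
theorem ncard_exceptional_le {P : ℕ → Prop} {m₀ x : ℕ} (hx : 4 ≤ x) (hm₀ : m₀ * m₀ ≤ x)
    (hP : ∀ m, m₀ ≤ m → 1 ≤ latticeCount m →
      (latticeCount m : ℝ) ≤ Real.sqrt (Real.sqrt (Real.log m)) ^ 8 →
      (∀ μ ∈ latticeCircle m, ∀ ν ∈ latticeCircle m, μ ≠ ν →
        (m : ℝ) ≤ ((μ 0 - ν 0 : ℝ) ^ 2 + (μ 1 - ν 1 : ℝ) ^ 2) *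
          (Real.sqrt (Real.sqrt (Real.log m)) ^ 9) ^ 2) → P m)
    {z : ℝ} (hz : 2 ≤ z) (hzx : z ^ 4 = Real.log x) :
    (({m ∈ sumsOfTwoSquaresUpTo x | ¬ P m}.ncard : ℕ) : ℝ) ≤
      Real.sqrt x + 19464192 * (x / z ^ 12) + 73728 * (x / z ^ 5) := by
  classical
  set X := Nat.sqrt x with hXdef
  set H := ⌊512 * Real.sqrt x / z ^ 9⌋₊ with hHdef
  set A := Finset.Icc 1 X
  set B := (Finset.Icc 1 x).filter fun m => z ^ 8 / 256 < latticeCount m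
  set D := (Finset.Icc 1 x).filter fun m => 1 ≤ (closePairs m H).card
  have hx0 : (4 : ℝ) ≤ x := by exact_mod_cast hx
  have hz0 : 0 < z := by linarith
  have hsub : {m ∈ sumsOfTwoSquaresUpTo x | ¬ P m} ⊆ ((A ∪ B ∪ D : Finset ℕ) : Set ℕ) := by
    rintro m ⟨hm, hPm⟩
    have hmI : m ∈ Finset.Icc 1 x := Finset.mem_Icc.2 ⟨hm.1, hm.2.1⟩
    simp only [Finset.coe_union, mem_union, Finset.mem_coe]
    by_contra! hcon
    obtain ⟨⟨hmA, hmB⟩, hmD⟩ := hcon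
    have hmx : x < m * m := by
      by_contra hle
      exact hmA (Finset.mem_Icc.2 ⟨hm.1, Nat.le_sqrt.2 (not_lt.1 hle)⟩)
    have hmm₀ : m₀ ≤ m := by
      by_contra hlt
      push Not at hlt
      nlinarith
    have hm1 : (1 : ℝ) ≤ m := by exact_mod_cast hm.1
    have hlogm : 0 ≤ Real.log m := Real.log_nonneg hm1
    set y := Real.sqrt (Real.sqrt (Real.log m)) with hydef
    have hy0 : 0 ≤ y := Real.sqrt_nonneg _
    have hy4 : y ^ 4 = Real.log m := by
      rw [show y ^ 4 = (y ^ 2) ^ 2 by ring, Real.sq_sqrt (Real.sqrt_nonneg _), Real.sq_sqrt hlogm]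
    have hlog2 : z ^ 4 ≤ 2 * Real.log m := by
      rw [hzx, ← Nat.cast_two, ← Real.log_pow]
      apply Real.log_le_log (by linarith)
      rw [sq]
      exact_mod_cast hmx.le
    have hyz : z / 2 ≤ y := by
      refine le_of_pow_le_pow_left₀ (n := 4) (by norm_num) hy0 ?_
      rw [hy4, div_pow]
      linarith
    refine hPm (hP m hmm₀ (one_le_latticeCount_of_mem hm) ?_ ?_)
    · by_contra hlt
      push Not at hlt
      refine hmB (Finset.mem_filter.2 ⟨hmI, lt_of_le_of_lt ?_ hlt⟩)
      calc z ^ 8 / 256 = (z / 2) ^ 8 := by ring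
        _ ≤ y ^ 8 := by gcongr
    · intro μ hμ ν hν hne
      by_contra hlt
      push Not at hlt
      refine hmD (Finset.mem_filter.2 ⟨hmI, Finset.card_pos.2 ⟨(μ, ν), Finset.mem_filter.2
        ⟨Finset.mem_product.2 ⟨hμ, hν⟩, hne, ?_⟩⟩⟩)
      have hmx' : (m : ℝ) ≤ x := by exact_mod_cast hm.2.1
      have hkey : ∀ d : ℤ, ((d : ℝ) * y ^ 9) ^ 2 ≤ x → d.natAbs ≤ H := by
        intro d hd
        have h1 := Real.abs_le_sqrt hd
        rw [abs_mul, abs_of_nonneg (by positivity : 0 ≤ y ^ 9)] at h1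
        apply Nat.le_floor
        rw [le_div_iff₀ (by positivity), Nat.cast_natAbs, Int.cast_abs]
        calc |(d : ℝ)| * z ^ 9 = 512 * (|(d : ℝ)| * (z / 2) ^ 9) := by ring
          _ ≤ 512 * (|(d : ℝ)| * y ^ 9) := by gcongr
          _ ≤ 512 * Real.sqrt x := by gcongr
      have h0 := hkey (μ 0 - ν 0) (by
        push_cast
        nlinarith [mul_nonneg (sq_nonneg (μ 1 - ν 1 : ℝ)) (sq_nonneg (y ^ 9))])
      have h1 := hkey (μ 1 - ν 1) (by
        push_cast
        nlinarith [mul_nonneg (sq_nonneg (μ 0 - ν 0 : ℝ)) (sq_nonneg (y ^ 9))])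
      intro j
      fin_cases j
      · exact h0
      · exact h1
  have hcard : ({m ∈ sumsOfTwoSquaresUpTo x | ¬ P m}.ncard : ℝ) ≤ A.card + B.card + D.card := by
    have h1 := ncard_le_ncard hsub (Finset.finite_toSet _)
    rw [ncard_coe_finset] at h1
    have h2 := h1.trans ((Finset.card_union_le (A ∪ B) D).trans
      (Nat.add_le_add_right (Finset.card_union_le A B) _))
    exact_mod_cast h2
  have hXs : (X : ℝ) ≤ Real.sqrt x := Real.le_sqrt_of_sq_le (by
    rw [sq]; exact_mod_cast Nat.sqrt_le x)
  have hA : (A.card : ℝ) ≤ Real.sqrt x := by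
    simpa [A] using hXs
  have hB : (B.card : ℝ) ≤ 19464192 * (x / z ^ 12) := by
    have h1 : (B.card : ℝ) * (z ^ 8 / 256) ^ 2 ≤ 297 * x * z ^ 4 := by
      rw [hzx]
      refine le_trans ?_ (sum_latticeCount_sq_le hx)
      push_cast
      rw [← nsmul_eq_mul]
      refine (Finset.card_nsmul_le_sum B (fun m => (latticeCount m : ℝ) ^ 2) _ fun m hm => ?_).trans
        (Finset.sum_le_sum_of_subset_of_nonneg (Finset.filter_subset _ _)
          fun _ _ _ => by positivity)
      have := (Finset.mem_filter.1 hm).2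
      gcongr
    rw [← le_div_iff₀ (by positivity)] at h1
    refine h1.trans_eq ?_
    field_simp
    ring
  have hH : (H : ℝ) ≤ 512 * Real.sqrt x / z ^ 9 := Nat.floor_le (by positivity)
  have hz9 : 512 ≤ z ^ 9 := by
    calc (512 : ℝ) = 2 ^ 9 := by norm_num
      _ ≤ z ^ 9 := by gcongr
  have hHs : (H : ℝ) ≤ Real.sqrt x := hH.trans (by
    rw [div_le_iff₀ (by positivity), mul_comm]
    gcongr)
  have hHX : H ≤ 2 * X := by
    have h1 : H ≤ X := by
      rw [Nat.le_sqrt']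
      have : (H : ℝ) ^ 2 ≤ x := by
        rw [← Real.sq_sqrt (by linarith : (0 : ℝ) ≤ x)]
        gcongr
      exact_mod_cast this
    omega
  have hlogH : 1 + Real.log H ≤ 2 * z ^ 4 := by
    have hl1 : 1 ≤ z ^ 4 := one_le_pow₀ (by linarith)
    have hl2 : Real.log H ≤ z ^ 4 := by
      -- For `H = 0` the convention `log 0 = 0` is used.
      rcases Nat.eq_zero_or_pos H with h0 | h0
      · rw [h0, Nat.cast_zero, Real.log_zero]; positivity
      · rw [hzx]
        apply Real.log_le_log (by exact_mod_cast h0)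
        refine hHs.trans (Real.sqrt_le_iff.2 ⟨by linarith, by nlinarith⟩)
    linarith
  have hD : (D.card : ℝ) ≤ 73728 * (x / z ^ 5) := by
    have h1 : D.card ≤ ∑ m ∈ Finset.Icc 1 x, (closePairs m H).card := by
      rw [Finset.card_eq_sum_ones]
      exact (Finset.sum_le_sum fun m hm => (Finset.mem_filter.1 hm).2).trans
        (Finset.sum_le_sum_of_subset (Finset.filter_subset _ _))
    calc (D.card : ℝ) ≤ 72 * H * X * (1 + Real.log H) :=
          (Nat.cast_le.2 h1).trans (sum_card_closePairs_le hHX)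
      _ ≤ 72 * (512 * Real.sqrt x / z ^ 9) * Real.sqrt x * (2 * z ^ 4) := by
          gcongr 72 * ?_ * ?_ * ?_
      _ = 73728 * (Real.sqrt x * Real.sqrt x / z ^ 5) := by field_simp; ring
      _ = _ := by rw [Real.mul_self_sqrt (by linarith)]
  linarith

theorem tendsto_sqrt_sqrt_log : Tendsto (fun x : ℕ => Real.sqrt (Real.sqrt (Real.log x)))
    atTop atTop :=
  Real.tendsto_sqrt_atTop.comp (Real.tendsto_sqrt_atTop.comp
    (Real.tendsto_log_atTop.comp tendsto_natCast_atTop_atTop))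

/-- For almost all `m` the lattice points on the circle are well separated and not too many. -/
theorem forAlmostAllEigenvalues_of_separated {P : ℕ → Prop} {m₀ : ℕ}
    (hP : ∀ m, m₀ ≤ m → 1 ≤ latticeCount m →
      (latticeCount m : ℝ) ≤ Real.sqrt (Real.sqrt (Real.log m)) ^ 8 →
      (∀ μ ∈ latticeCircle m, ∀ ν ∈ latticeCircle m, μ ≠ ν →
        (m : ℝ) ≤ ((μ 0 - ν 0 : ℝ) ^ 2 + (μ 1 - ν 1 : ℝ) ^ 2) *
          (Real.sqrt (Real.sqrt (Real.log m)) ^ 9) ^ 2) → P m) :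
    ForAlmostAllEigenvalues P := by
  unfold ForAlmostAllEigenvalues
  set z : ℕ → ℝ := fun x => Real.sqrt (Real.sqrt (Real.log x))
  have hzt : Tendsto z atTop atTop := tendsto_sqrt_sqrt_log
  have hinv : ∀ k : ℕ, k ≠ 0 → Tendsto (fun x => (z x ^ k)⁻¹) atTop (𝓝 0) := fun k hk =>
    tendsto_inv_atTop_zero.comp ((tendsto_pow_atTop hk).comp hzt)
  have hsq : Tendsto (fun x : ℕ => Real.log x / Real.sqrt x) atTop (𝓝 0) := by
    have h := (isLittleO_log_rpow_atTop (by norm_num : (0 : ℝ) < 1 / 2)).tendsto_div_nhds_zero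
    simp_rw [← Real.sqrt_eq_rpow] at h
    exact h.comp tendsto_natCast_atTop_atTop
  -- Dividing by the lower bound `x/(76032 z⁴)` leaves `z⁻⁸` and `z⁻¹`: the exponent 9 in the
  -- separation is the least integer that beats one `log x = z⁴` from the pair count and another
  -- from the density.
  have hlim : Tendsto (fun x : ℕ => 76032 * (Real.log x / Real.sqrt x +
      19464192 * (z x ^ 8)⁻¹ + 73728 * (z x ^ 1)⁻¹)) atTop (𝓝 0) := by
    have := ((hsq.add ((hinv 8 (by norm_num)).const_mul 19464192)).add
      ((hinv 1 (by norm_num)).const_mul 73728)).const_mul 76032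
    simpa using this
  refine squeeze_zero' (Eventually.of_forall fun x => by positivity) ?_ hlim
  filter_upwards [eventually_ge_atTop 4, eventually_ge_atTop (m₀ * m₀),
    hzt.eventually_ge_atTop 2] with x hx hxm hz2
  have hx0 : (4 : ℝ) ≤ x := by exact_mod_cast hx
  have hz0 : 0 < z x := by linarith
  have hz4 : z x ^ 4 = Real.log x := by
    rw [show z x ^ 4 = (z x ^ 2) ^ 2 by ring, Real.sq_sqrt (Real.sqrt_nonneg _),
      Real.sq_sqrt (Real.log_nonneg (by linarith))]
  have h1 := ncard_exceptional_le hx hxm hP hz2 hz4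
  have h2 := le_ncard_sumsOfTwoSquaresUpTo_mul_log hx
  rw [← hz4] at h2 ⊢
  have hs0 : 0 < Real.sqrt x := Real.sqrt_pos.2 (by linarith)
  have hSpos : (0 : ℝ) < (sumsOfTwoSquaresUpTo x).ncard := by
    by_contra hcon
    have h3 : ((sumsOfTwoSquaresUpTo x).ncard : ℝ) = 0 :=
      le_antisymm (not_lt.1 hcon) (Nat.cast_nonneg _)
    rw [h3] at h2
    linarith
  rw [div_le_iff₀ hSpos]
  refine h1.trans ?_
  set w := Real.sqrt (x : ℝ)
  have hw : (x : ℝ) = w * w := (Real.mul_self_sqrt (by linarith)).symm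
  calc w + 19464192 * (x / z x ^ 12) + 73728 * (x / z x ^ 5)
      = x * (1 / w + 19464192 / z x ^ 12 + 73728 / z x ^ 5) := by
        rw [hw]; field_simp
    _ ≤ 76032 * (sumsOfTwoSquaresUpTo x).ncard * z x ^ 4 *
        (1 / w + 19464192 / z x ^ 12 + 73728 / z x ^ 5) := by gcongr
    _ = _ := by field_simp

theorem mainTheorem8 (γ : ℝ → EuclideanSpace ℝ (Fin 2)) (U : Set ℂ) (Γ : ℂ → Fin 2 → ℂ)
    (hγ : IsAnalyticCurvedArc γ U Γ) :
    ∃ C : ℝ, 0 < C ∧ ForAlmostAllEigenvalues fun m =>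
      ∃ (k : ℕ) (l u : Fin k → ℝ),
        k ≤ latticeCount m ^ 2 ∧
        (∀ i, 0 ≤ l i ∧ l i ≤ u i ∧ u i ≤ 1 ∧
          u i - l i ≤ C * ((latticeCount m : ℝ) ^ 3)⁻¹) ∧
        ∀ a : (Fin 2 → ℤ) → ℂ, ∑ μ ∈ latticeCircle m, ‖a μ‖ ^ 2 = 1 →
          (({x | toralEigenfunction m a x = 0} ∩
              ⋃ i, (fun t => toTorus (γ t)) '' Icc (l i) (u i)).Finite ∧
            ((({x | toralEigenfunction m a x = 0} ∩
              ⋃ i, (fun t => toTorus (γ t)) '' Icc (l i) (u i)).ncard : ℕ) : ℝ) ≤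
                C * (torusFrequency m / latticeCount m)) ∧
          ∀ s ∈ Icc (0 : ℝ) 1 \ ⋃ i, Icc (l i) (u i),
            Metric.ball (s : ℂ) ((latticeCount m : ℝ) ^ 7 / torusFrequency m) ⊆ U ∧
            {z ∈ Metric.ball (s : ℂ) ((latticeCount m : ℝ) ^ 7 / torusFrequency m) |
              complexifiedEigenfunction m a (Γ z) = 0}.Finite ∧
            (({z ∈ Metric.ball (s : ℂ) ((latticeCount m : ℝ) ^ 7 / torusFrequency m) |
              complexifiedEigenfunction m a (Γ z) = 0}.ncard : ℕ) : ℝ) ≤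
                C * (latticeCount m : ℝ) ^ 7 := by
  obtain ⟨C, hC, hev⟩ := hγ.exists_intervals
  refine ⟨C, hC, ?_⟩
  -- The parameter is `y = (log m)^(1/4)`, so that `exp(y⁴/2) = √m ≤ λ`.
  obtain ⟨m₀, hm₀⟩ := eventually_atTop.1 (tendsto_sqrt_sqrt_log.eventually hev)
  refine forAlmostAllEigenvalues_of_separated (m₀ := m₀ + 1) fun m hm hN1 hN hsep => ?_
  have hm0 : 0 < m := by omega
  refine hm₀ m (by omega) m hm0 hN1 ?_ hN hsep
  have hm1 : (1 : ℝ) ≤ m := by exact_mod_cast hm0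
  have hy4 : Real.sqrt (Real.sqrt (Real.log m)) ^ 4 = Real.log m := by
    rw [show ∀ y : ℝ, y ^ 4 = (y ^ 2) ^ 2 by intro y; ring, Real.sq_sqrt (Real.sqrt_nonneg _),
      Real.sq_sqrt (Real.log_nonneg hm1)]
  rw [hy4, ← Real.log_sqrt (by linarith), Real.exp_log (Real.sqrt_pos.2 (by linarith))]
  unfold torusFrequency
  exact le_mul_of_one_le_left (Real.sqrt_nonneg _) (by linarith [Real.pi_gt_three])
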